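/- Write a sign string as $S=s_1,\dots,s_n$ ($s_k\in\{+,-\}$, $n\ge 0$) and a state string as $J=j_1,\dots,j_n$ ($j_k\in\{-1,0,1\}$). Let $\mu^+,\mu^-$ be the fundamental weights of $\mathfrak{sl}(3)$. Give $(+,1),(+,0),(+,-1)$ the weights $\mu^+,\ -\mu^++\mu^-,\ -\mu^-$ and $(-,1),(-,0),(-,-1)$ the weights $\mu^-,\ \mu^+-\mu^-,\ -\mu^+$. The lattice path of $(S,J)$ is $\pi_0=0$, $\pi_k=\pi_{k-1}+\mathrm{wt}(s_k,j_k)$. Call $J$ dominant (for $S$) if $\pi_n=0$ and every $\pi_k$ lies in $\mathbb{Z}_{\ge0}\mu^++\mathbb{Z}_{\ge0}\mu^-$. A web with boundary $S$ is an oriented graph in a disk, up to isotopy fixing the boundary, possibly with closed loops, with trivalent interior vertices, each a source or a sink, and with $n$ univalent endpoints on the upper part of the boundary circle, numbered from left to right; the edge at the $k$-th endpoint is oriented towards it if $s_k=+$ and away from it if $s_k=-$. A web is non-elliptic if every internal face (a face not touching the boundary circle) has at least six sides. Growth algorithm. Starting from $(S,J)$, repeatedly choose two adjacent letters $(s,j),(s',j')$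 to which a rule applies, attach the corresponding piece below the two strands, and replace the two letters by those at the bottom of the piece. If $s'=-s$: the states $1,0$ become $0,1$, the states $0,0$ become $-1,1$, and the states $0,-1$ become $-1,0$, each by attaching an H (two trivalent vertices joined by a horizontal edge), the signs becoming $-s,s$; the states $1,-1$ are deleted by attaching an arc U that joins the two strands. If $s'=s$: the states $1,0$ become $1$, the states $0,-1$ become $-1$, and the states $1,-1$ become $0$, each by attaching a Y (one trivalent vertex), the new sign being $-s$. The algorithm stops when no rule applies; the web produced is the concatenation of all the attached pieces. Minimal cut path algorithm. Let $w$ be a non-elliptic web with boundary $S$, let $P$ be a point at the bottom of the boundary circle, and let $Q_0,\dots,Q_n$ be points of its upper part that alternate with the endpoints. A minimal cut path from $P$ to $Q_k$ is a path in the disk, transverse to $w$ and avoiding its vertices, that crosses as few strands of $w$ as possible. Its weight is $a\mu^++b\mu^-$ if it crosses $a$ strands directed from its right to its left and $b$ strands directed from its left to its right. The output of the algorithm is the state string $J$ such that, for every $k$, the weight of the minimal cut paths from $P$ to $Q_k$ is the $k$-th vertex $\pi_k$ of the lattice path of $(S,J)$. Proposition. Fix a sign string $S$. (1) For every dominant state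 string $J$, the growth algorithm started at $(S,J)$ terminates, it stops only when the strings have length $0$, and, independently of the choices made, it produces one and the same web $g(J)$, which is non-elliptic with boundary $S$. (2) For every non-elliptic web $w$ with boundary $S$, the minimal cut path algorithm is well-defined (for each $k$ all minimal cut paths from $P$ to $Q_k$ have the same weight, and these weights form the lattice path of a unique state string) and its output $m(w)$ is dominant. (3) $m$ and $g$ are mutually inverse bijections between the dominant state strings for $S$ and the non-elliptic webs with boundary $S$. Thus non-elliptic webs are indexed by dominant lattice paths in the $\mathfrak{sl}(3)$ Weyl chamber. -/

import Mathlib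

open Relation

/-! ## Sign strings, state strings, dominant lattice paths

Signs are Booleans: `true` is `+`, `false` is `-`.  States are elements of
`SignType = {-1, 0, 1}`.  A sign string together with a state string of the same length is a list
of pairs. -/

/-- A sign string `s₁,…,sₙ` together with a state string `j₁,…,jₙ`. -/
abbrev SignStateString : Type := List (Bool × SignType)

/-- The weight of the basis vector `e^s_j` of `V^s`, an element of the weight lattice of `sl(3)`.
The pair `(a, b)` stands for `a μ⁺ + b μ⁻`, where `μ⁺`, `μ⁻` are the weights of `e⁺₁`, `e⁻₁`. -/
def stateWeight : Bool × SignType → ℤ × ℤ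
  | (true, .pos) => (1, 0)
  | (true, .zero) => (-1, 1)
  | (true, .neg) => (0, -1)
  | (false, .pos) => (0, 1)
  | (false, .zero) => (1, -1)
  | (false, .neg) => (-1, 0)

/-- The `k`-th vertex `π_k = μ₁ + ⋯ + μ_k` of the lattice path of a sign and state string. -/
def latticePath (x : SignStateString) (k : ℕ) : ℤ × ℤ :=
  ((x.take k).map stateWeight).sum

/-- The lattice path runs from the origin to itself inside the dominant Weyl chamber. -/
def IsDominant (x : SignStateString) : Prop :=
  (∀ k ≤ x.length, 0 ≤ (latticePath x k).1 ∧ 0 ≤ (latticePath x k).2) ∧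
    latticePath x x.length = 0

/-- State strings (paired with `S`) whose lattice path is dominant. -/
def DominantString (S : List Bool) : Type :=
  {x : SignStateString // x.map Prod.fst = S ∧ IsDominant x}

/-! ## Webs

A web is an oriented graph in a disk, considered up to isotopy.  It is recorded as a (possibly
disconnected) planar combinatorial map.  The complement of the disk is shrunk to one vertex `∞` of
the resulting planar graph on the sphere; the endpoints of the web become the edges at `∞`.

* `Dart` is the set of half-edges; `next` turns counterclockwise to the next half-edge around the
  same vertex; `opp` gives the other half of the same edge.
* `base` is a stub at `∞` (the only half-edge without an other half).  It marks the point `P` of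
  the boundary of the disk at which the cyclic order of the endpoints is cut open.  With `P` at the
  bottom of the disk, `next base`, `next² base`, … are the endpoints from left to right.
* `out d` says that the edge of `d` is oriented away from the vertex of `d`.
* A half-edge `d` stands also for the place just to the left of `d`, that is, for the corner
  between `d` and `next d`.  `region` says that two such places lie in the same region of the
  complement of the graph.  Regions need not be simply connected, so that closed components of the
  web may be placed in any region.
* A closed loop of the web without a vertex is recorded as an edge from an auxiliary bivalent
  vertex to itself. -/
structure Web where
  /-- half-edges -/
  Dart : Type
  finite : Finite Dart
  next : Equiv.Perm Dart
  opp : Equiv.Perm Dart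
  base : Dart
  out : Dart → Bool
  region : Setoid Dart
  opp_opp : ∀ d, opp (opp d) = d
  opp_eq_self : ∀ d, opp d = d ↔ d = base
  out_opp : ∀ d, d ≠ base → out (opp d) = !out d
  /-- The stub carries no orientation; this is a normalization. -/
  out_base : out base = false
  /-- A vertex other than `∞` is trivalent and a source or a sink, or it is the auxiliary vertex
  of a closed loop. -/
  vertex : ∀ d, ¬ next.SameCycle base d →
    (next d ≠ d ∧ next (next (next d)) = d ∧ out (next d) = out d) ∨
      (next d = opp d ∧ next (opp d) = d)
  /-- Going along an edge and keeping left one stays in the same region. -/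
  region_keep_left : ∀ d, region d (next.symm (opp d))
  /-- Vertices, edges and regions together form a connected space. -/
  connected :
    Equiv.Perm.SameCycle.setoid next ⊔ Equiv.Perm.SameCycle.setoid opp ⊔ region = ⊤
  /-- Euler's formula `V - E + F = 1 + C` for a planar graph with `C` components. The stub is not
  an edge, so `E + 1` is the number of orbits of `opp`. -/
  euler :
    Nat.card (Quotient (Equiv.Perm.SameCycle.setoid next)) + Nat.card (Quotient region) =
      Nat.card (Quotient (Equiv.Perm.SameCycle.setoid opp)) +
        Nat.card (Quotient (Equiv.Perm.SameCycle.setoid next ⊔ Equiv.Perm.SameCycle.setoid opp))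

namespace Web

/-- `W.pt 0` is the stub, and `W.pt 1, …, W.pt n` are the endpoints from left to right (as
half-edges at `∞`).  The corner at `W.pt k` is the point `Q_k` between the `k`-th and the
`(k+1)`-st endpoint. -/
def pt (W : Web) (k : ℕ) : W.Dart := (W.next ^ k) W.base

/-- The number of endpoints. -/
noncomputable def numEndpoints (W : Web) : ℕ := Function.minimalPeriod W.next W.base - 1

/-- The sign string at the boundary: `+` at an endpoint towards which the edge is oriented. -/
noncomputable def boundary (W : Web) : List Bool :=
  (List.range W.numEndpoints).map fun k => !W.out (W.pt (k + 1))

/-- Isotopy of webs relative to the boundary. -/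
def Iso (W W' : Web) : Prop :=
  ∃ e : W.Dart ≃ W'.Dart,
    (∀ d, e (W.next d) = W'.next (e d)) ∧
    (∀ d, e (W.opp d) = W'.opp (e d)) ∧
    e W.base = W'.base ∧
    (∀ d, W'.out (e d) = W.out d) ∧
    ∀ d d', W'.region (e d) (e d') ↔ W.region d d'

/-- Every internal region (one that does not touch the boundary of the disk) has at least six
sides. -/
def NonElliptic (W : Web) : Prop :=
  ∀ d, (∀ k, ¬ W.region d (W.pt k)) → 6 ≤ Nat.card {d' // W.region d d'}

theorem Iso.refl (W : Web) : W.Iso W :=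
  ⟨Equiv.refl _, fun _ => rfl, fun _ => rfl, rfl, fun _ => rfl, fun _ _ => Iff.rfl⟩

theorem Iso.symm {W W' : Web} : W.Iso W' → W'.Iso W := by
  rintro ⟨e, h1, h2, h3, h4, h5⟩
  refine ⟨e.symm, fun d => ?_, fun d => ?_, ?_, fun d => ?_, fun d d' => ?_⟩
  · rw [Equiv.symm_apply_eq, h1, Equiv.apply_symm_apply]
  · rw [Equiv.symm_apply_eq, h2, Equiv.apply_symm_apply]
  · rw [Equiv.symm_apply_eq, h3]
  · rw [← h4, Equiv.apply_symm_apply]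
  · rw [← h5, Equiv.apply_symm_apply, Equiv.apply_symm_apply]

theorem Iso.trans {W W' W'' : Web} : W.Iso W' → W'.Iso W'' → W.Iso W'' := by
  rintro ⟨e, h1, h2, h3, h4, h5⟩ ⟨f, k1, k2, k3, k4, k5⟩
  refine ⟨e.trans f, fun d => ?_, fun d => ?_, ?_, fun d => ?_, fun d d' => ?_⟩ <;>
    simp [h1, h2, h3, h4, h5, k1, k2, k3, k4, k5]

end Web

/-- The non-elliptic webs with boundary `S`, before identifying isotopic ones. -/
abbrev NonEllipticRep (S : List Bool) : Type 1 := {W : Web // W.NonElliptic ∧ W.boundary = S}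

instance nonEllipticSetoid (S : List Bool) : Setoid (NonEllipticRep S) where
  r W W' := W.1.Iso W'.1
  iseqv := ⟨fun W => Web.Iso.refl W.1, Web.Iso.symm, Web.Iso.trans⟩

/-- The non-elliptic webs with boundary sign string `S`, up to isotopy. -/
abbrev NonEllipticWeb (S : List Bool) : Type 1 := Quotient (nonEllipticSetoid S)

/-! ## The growth algorithm -/

/-- The pieces that the growth rules attach: an H, a Y, or an arc U.  For the arc, the sign of its
left endpoint is recorded. -/
inductive Piece where
  | H
  | Y
  | U (s : Bool)

/-- The growth rules: the piece, the signs and states at its top, those at its bottom. -/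
inductive GrowthRule : Piece → SignStateString → SignStateString → Prop
  | H₁ (s : Bool) : GrowthRule .H [(s, 1), (!s, 0)] [(!s, 0), (s, 1)]
  | H₂ (s : Bool) : GrowthRule .H [(s, 0), (!s, 0)] [(!s, -1), (s, 1)]
  | H₃ (s : Bool) : GrowthRule .H [(s, 0), (!s, -1)] [(!s, -1), (s, 0)]
  | U₁ (s : Bool) : GrowthRule (.U s) [(s, 1), (!s, -1)] []
  | Y₁ (s : Bool) : GrowthRule .Y [(s, 1), (s, 0)] [(!s, 1)]
  | Y₂ (s : Bool) : GrowthRule .Y [(s, 0), (s, -1)] [(!s, -1)]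
  | Y₃ (s : Bool) : GrowthRule .Y [(s, 1), (s, -1)] [(!s, 0)]

/-- One step of the growth algorithm replaces a substring of `x`, which starts after the first `k`
letters, by a rule that attaches the piece `c`; the result is `y`. -/
def GrowthStepAt (c : Piece) (k : ℕ) (x y : SignStateString) : Prop :=
  ∃ l r t b, GrowthRule c t b ∧ l.length = k ∧ x = l ++ t ++ r ∧ y = l ++ b ++ r

/-- One step of the growth algorithm, wherever and by whichever rule. -/
def GrowthStep (x y : SignStateString) : Prop := ∃ c k, GrowthStepAt c k x y

/-- `W` is obtained from `W₁` by attaching an arc with left sign `s` on top, to the right of the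
first `k` strands.  The half-edges `0`, `1` are the new endpoints. -/
def AttachU (s : Bool) (k : ℕ) (W₁ W : Web) : Prop :=
  ∃ e : W₁.Dart ⊕ Fin 2 ≃ W.Dart,
    let i : W₁.Dart → W.Dart := fun d => e (.inl d)
    let n : Fin 2 → W.Dart := fun j => e (.inr j)
    W.base = i W₁.base ∧
    (∀ d, W.opp (i d) = i (W₁.opp d)) ∧ W.opp (n 0) = n 1 ∧
    (∀ d, d ≠ W₁.pt k → W.next (i d) = i (W₁.next d)) ∧
    W.next (i (W₁.pt k)) = n 0 ∧ W.next (n 0) = n 1 ∧ W.next (n 1) = i (W₁.pt (k + 1)) ∧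
    (∀ d, W.out (i d) = W₁.out d) ∧ W.out (n 0) = !s ∧
    (∀ d d', W.region (i d) (i d') ↔ W₁.region d d') ∧ ∀ d, ¬ W.region (n 0) (i d)

/-- `W` is obtained from `W₁` by attaching a Y on top of the strand `k + 1`.  The half-edges `0`,
`1` are the new endpoints; `2`, `3` are the upper left and the upper right half-edge at the new
vertex, whose lower half-edge is the former endpoint `W₁.pt (k + 1)`. -/
def AttachY (k : ℕ) (W₁ W : Web) : Prop :=
  ∃ e : W₁.Dart ⊕ Fin 4 ≃ W.Dart,
    let i : W₁.Dart → W.Dart := fun d => e (.inl d)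
    let n : Fin 4 → W.Dart := fun j => e (.inr j)
    W.base = i W₁.base ∧
    (∀ d, W.opp (i d) = i (W₁.opp d)) ∧ W.opp (n 0) = n 2 ∧ W.opp (n 1) = n 3 ∧
    (∀ d, d ≠ W₁.pt k → d ≠ W₁.pt (k + 1) → W.next (i d) = i (W₁.next d)) ∧
    W.next (i (W₁.pt k)) = n 0 ∧ W.next (n 0) = n 1 ∧ W.next (n 1) = i (W₁.pt (k + 2)) ∧
    W.next (n 3) = n 2 ∧ W.next (n 2) = i (W₁.pt (k + 1)) ∧ W.next (i (W₁.pt (k + 1))) = n 3 ∧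
    (∀ d, W.out (i d) = W₁.out d) ∧
    (∀ d d', W.region (i d) (i d') ↔ W₁.region d d') ∧ ∀ d, ¬ W.region (n 0) (i d)

/-- `W` is obtained from `W₁` by attaching an H on top of the strands `k + 1` and `k + 2`.  The
half-edges `0`, `1` are the new endpoints; `2` and `3` are the upper half-edges and `4` and `5` the
halves of the horizontal edge, at the left and at the right new vertex respectively.  The lower
half-edges at the new vertices are the former endpoints `W₁.pt (k + 1)` and `W₁.pt (k + 2)`. -/
def AttachH (k : ℕ) (W₁ W : Web) : Prop :=
  ∃ e : W₁.Dart ⊕ Fin 6 ≃ W.Dart,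
    let i : W₁.Dart → W.Dart := fun d => e (.inl d)
    let n : Fin 6 → W.Dart := fun j => e (.inr j)
    W.base = i W₁.base ∧
    (∀ d, W.opp (i d) = i (W₁.opp d)) ∧
    W.opp (n 0) = n 2 ∧ W.opp (n 1) = n 3 ∧ W.opp (n 4) = n 5 ∧
    (∀ d, d ≠ W₁.pt k → d ≠ W₁.pt (k + 1) → d ≠ W₁.pt (k + 2) →
      W.next (i d) = i (W₁.next d)) ∧
    W.next (i (W₁.pt k)) = n 0 ∧ W.next (n 0) = n 1 ∧ W.next (n 1) = i (W₁.pt (k + 3)) ∧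
    W.next (n 2) = i (W₁.pt (k + 1)) ∧ W.next (i (W₁.pt (k + 1))) = n 4 ∧ W.next (n 4) = n 2 ∧
    W.next (n 3) = n 5 ∧ W.next (n 5) = i (W₁.pt (k + 2)) ∧ W.next (i (W₁.pt (k + 2))) = n 3 ∧
    (∀ d, W.out (i d) = W₁.out d) ∧
    (∀ d d', W.region (i d) (i d') ↔ W₁.region d d') ∧ ∀ d, ¬ W.region (n 0) (i d)

/-- `W` is obtained from `W₁` by attaching the piece `c` on top, after the first `k` strands. -/
def Attach : Piece → ℕ → Web → Web → Prop
  | .H, k => AttachH k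
  | .Y, k => AttachY k
  | .U s, k => AttachU s k

/-- `Grows x W`: some complete run of the growth algorithm from the sign and state string `x` down
to strings of length `0` produces the web `W`.  The pieces are concatenated from top to bottom, so
the piece of the first step lies on top of the web produced by the remaining steps. -/
inductive Grows : SignStateString → Web → Prop
  | empty (W : Web) (h : ∀ d, d = W.base) : Grows [] W
  | step {c : Piece} {k : ℕ} {x y : SignStateString} {W₁ W : Web}
      (hxy : GrowthStepAt c k x y) (h₁ : Grows y W₁) (h : Attach c k W₁ W) : Grows x W

/-! ## The minimal cut path algorithm -/

namespace Web

/-- `W.IsCutPath a l b`: there is a path, transverse to the web, from the region at `a` to the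
region at `b` that crosses successively the edges of the half-edges in `l`, each of them from the
left side to the right side of the half-edge. -/
def IsCutPath (W : Web) : W.Dart → List W.Dart → W.Dart → Prop
  | a, [], b => W.region a b
  | a, d :: l, b => W.region a d ∧ d ≠ W.base ∧ W.IsCutPath (W.opp d) l b

/-- A cut path that crosses as few strands as possible. -/
def IsMinCutPath (W : Web) (a : W.Dart) (l : List W.Dart) (b : W.Dart) : Prop :=
  W.IsCutPath a l b ∧ ∀ l', W.IsCutPath a l' b → l.length ≤ l'.length

/-- The weight of a cut path: `μ⁺` for each strand that crosses the path from its right to its left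
(the transverse orientation), and `μ⁻` for each strand that crosses it the other way. -/
def cutWeight (W : Web) (l : List W.Dart) : ℤ × ℤ :=
  (l.map fun d => if W.out d then ((1, 0) : ℤ × ℤ) else (0, 1)).sum

/-- The minimal cut path algorithm is well-defined on `W` and returns the sign and state string
`x`: the signs are those of the boundary, and for each `k` the minimal cut paths from `P` to `Q_k`
all have weight `π_k`, where `π` is the lattice path of `x`. -/
def MinCutString (W : Web) (x : SignStateString) : Prop :=
  x.map Prod.fst = W.boundary ∧
  ∀ k ≤ x.length,
    (∃ l, W.IsMinCutPath W.base l (W.pt k)) ∧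
    ∀ l, W.IsMinCutPath W.base l (W.pt k) → W.cutWeight l = latticePath x k

end Web

/-!
The growth algorithm and the minimal cut path algorithm are shown to be inverse to each other by
local arguments at the boundary of the disk, together with one count with Euler's formula.

**Pieces as strips.** The arc `U`, the `Y` and the `H` are the cases `b = 0, 1, 2` of a strip
(`Glue b k W₁ W`): a path of `b + 1` edges between two new neighbouring endpoints, each of whose
`b` inner vertices stands on an old strand. It creates one region with `b + 1` sides, which
touches the boundary of the disk only between the new endpoints (a *cap*), and every edge of the
path gives one new side to the old region below it.

**Webs that are produced are non-elliptic and remember the string** (`Grows.sound`). Two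
invariants pass through every growth step. The first is a potential (`Raw.IsPotential`), which
assigns weights to the regions, is compatible with crossing edges, and has a descending edge at
every region other than that of the stub: it certifies the weights of all minimal cut paths, and
it follows the lattice path of the string. The second is a lower bound for the number of sides of
a region by the increases of the states at its corners on the boundary (`Raw.Balanced`). It forces
a region that is closed by an `H` to have at least five, hence, since orientations alternate, six
sides.

**Non-elliptic webs have caps** (`Raw.Good.exists_cap`). Euler's inequality (`card_cycles_add_le`)
for the component of `∞`, compared with Euler's formula, shows that a non-elliptic web is
connected (`Web.connected_of_nonElliptic`) and that each of its regions is bounded by one closed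
walk (`Raw.Good.region_iff`). The sum of `6 - (sides) - 2 (boundary corners)` over the regions is
`3`. Only a region with one corner at the boundary and at most three sides contributes positively,
which is a cap of an arc, a `Y` or an `H`. The strip below it can be removed
(`Raw.Good.exists_glue_of_cap`).

**Confluence** (`Web.exists_grows_and_confluent`). By induction on the number of half-edges, a
non-elliptic web `W` is produced by the growth algorithm, and every growth step of its string can
be the first one. Remove a strip from `W`; the rest is produced from some string. If the states
below the strip are not those at the bottom of a growth rule, then either they are `1, 1` or
`-1, -1` below an `H`, or a growth step applies to them, and by induction `W` has an internal region
with at most four sides. In all remaining cases (`LocalRule`) the potential extends, and a string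
`x` is read off from `W` by minimal cut paths; in particular it is dominant, so that a growth step
applies to it. For every such step, `W` has a cap at its place (`Glue.cap_of_growthStepAt`).
Removing this cap instead and comparing with `x`, which is determined by `W`, shows that the cap
belongs to the step.

**Conclusion.** Confluence and the uniqueness of gluing (`Glue.iso`) give the independence of the
choices, and `Web.MinCutString.unique` gives injectivity. Growth steps decrease a measure and
preserve dominance, and they apply to every dominant string that is not empty.
-/

/-! ### Counting the classes of setoids and the cycles of permutations -/

section Counting

open Equiv Equiv.Perm

variable {X : Type*}

theorem sameCycle_le_iff {f : Perm X} {s : Setoid X} :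
    SameCycle.setoid f ≤ s ↔ ∀ x, s x (f x) := by
  constructor
  · intro h x
    exact h ⟨1, by simp⟩
  · rintro h x y ⟨i, rfl⟩
    induction i with
    | zero => exact s.refl x
    | succ i ih =>
      refine s.trans ih ?_
      rw [add_comm, zpow_add, zpow_one, Perm.mul_apply]
      exact h _
    | pred i ih =>
      refine s.trans ih (s.symm ?_)
      have := h ((f ^ (-(i : ℤ) - 1)) x)
      rwa [← Perm.mul_apply, ← zpow_one_add, add_sub_cancel] at this

theorem card_quotient_le_of_le [Finite X] {s t : Setoid X} (h : s ≤ t) :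
    Nat.card (Quotient t) ≤ Nat.card (Quotient s) := by
  refine Nat.card_le_card_of_surjective (Quotient.map' (s₁ := s) (s₂ := t) id fun _ _ h' => h h') ?_
  intro q
  induction q using Quotient.inductionOn with
  | _ x => exact ⟨Quotient.mk s x, rfl⟩

theorem setoid_eq_of_le_of_card_le [Finite X] {s t : Setoid X} (h : s ≤ t)
    (hc : Nat.card (Quotient s) ≤ Nat.card (Quotient t)) : s = t := by
  let f : Quotient s → Quotient t := Quotient.map' (s₁ := s) (s₂ := t) id fun _ _ h' => h h'
  have hf : Function.Surjective f := by
    intro q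
    induction q using Quotient.inductionOn with
    | _ x => exact ⟨Quotient.mk s x, rfl⟩
  have hb : Function.Bijective f :=
    (Nat.bijective_iff_surjective_and_card f).2
      ⟨hf, le_antisymm hc (card_quotient_le_of_le h)⟩
  refine le_antisymm h fun x y hxy => ?_
  have : f (Quotient.mk s x) = f (Quotient.mk s y) := Quotient.sound (s := t) hxy
  exact Quotient.exact (hb.1 this)

/-- Identifying two points merges at most, and if they were inequivalent exactly, two classes. -/
theorem exists_merge [Finite X] (s : Setoid X) (a b : X) :
    ∃ t : Setoid X, s ≤ t ∧ t a b ∧ (∀ t' : Setoid X, s ≤ t' → t' a b → t ≤ t') ∧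
      Nat.card (Quotient s) ≤ Nat.card (Quotient t) + 1 ∧
      (¬ s a b → Nat.card (Quotient t) + 1 ≤ Nat.card (Quotient s)) := by
  classical
  let f : X → Quotient s := fun x => if s x a then Quotient.mk s b else Quotient.mk s x
  have hfs : ∀ x y, s x y → f x = f y := by
    intro x y h
    have : s x a ↔ s y a := ⟨fun h' => s.trans (s.symm h) h', fun h' => s.trans h h'⟩
    by_cases hx : s x a
    · simp [f, hx, this.1 hx]
    · simp only [f, if_neg hx, if_neg (fun h' => hx (this.2 h'))]
      exact Quotient.sound h
  have hr : Nat.card (Quotient (Setoid.ker f)) = Nat.card (Set.range f) :=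
    Nat.card_congr (Setoid.quotientKerEquivRange f)
  refine ⟨Setoid.ker f, fun x y h => hfs x y h, ?_, ?_, ?_, ?_⟩
  · show f a = f b
    by_cases hb : s b a
    · exact hfs _ _ (s.symm hb)
    · simp only [f, if_neg hb, if_pos (s.refl a)]
  · intro t' hs hab x y (h : f x = f y)
    by_cases hx : s x a <;> by_cases hy : s y a <;> simp only [f, hx, hy, if_true, if_false] at h
    · exact hs (s.trans hx (s.symm hy))
    · exact t'.trans (hs hx) (t'.trans hab (hs (Quotient.exact h)))
    · exact t'.trans (hs (Quotient.exact h)) (t'.trans (t'.symm hab) (hs (s.symm hy)))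
    · exact hs (Quotient.exact h)
  · rw [hr]
    have : (Set.univ : Set (Quotient s)) ⊆ insert (Quotient.mk s a) (Set.range f) := by
      intro q _
      induction q using Quotient.inductionOn with
      | _ x =>
        by_cases hx : s x a
        · exact Or.inl (Quotient.sound hx)
        · exact Or.inr ⟨x, by simp only [f, if_neg hx]⟩
    have h1 := Set.ncard_le_ncard this (Set.toFinite _)
    rw [Set.ncard_univ] at h1
    exact h1.trans (Set.ncard_insert_le _ _)
  · intro hab
    rw [hr]
    have hn : Quotient.mk s a ∉ Set.range f := by
      rintro ⟨x, hx⟩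
      by_cases h : s x a <;> simp only [f, h, if_true, if_false] at hx
      · exact hab (s.symm (Quotient.exact hx))
      · exact h (Quotient.exact hx)
    have h1 := Set.ncard_insert_of_notMem hn (Set.toFinite _)
    have h2 := Set.ncard_le_ncard (Set.subset_univ (insert (Quotient.mk s a) (Set.range f)))
      (Set.toFinite _)
    rw [Set.ncard_univ, h1] at h2
    exact h2

theorem sameCycle_mul_swap_le [DecidableEq X] {f : Perm X} {a b : X} {s : Setoid X}
    (h : SameCycle.setoid f ≤ s) (hab : s a b) : SameCycle.setoid (f * swap a b) ≤ s := by
  rw [sameCycle_le_iff] at h ⊢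
  intro x
  rw [Perm.mul_apply]
  refine s.trans ?_ (h _)
  by_cases hxa : x = a
  · subst hxa; simpa using hab
  · by_cases hxb : x = b
    · subst hxb; simpa using s.symm hab
    · rw [swap_apply_of_ne_of_ne hxa hxb]

/-- Composing with a transposition joins two different cycles into one. -/
theorem sameCycle_mul_swap [Finite X] [DecidableEq X] {f : Perm X} {a b : X}
    (hab : ¬ f.SameCycle a b) : (f * swap a b).SameCycle a b := by
  by_contra hn
  -- otherwise the new cycle of `a` runs through the old cycle of `b` without ever leaving it
  have key : ∀ m : ℕ, (f * swap a b).SameCycle a ((f ^ (m + 1)) b) := by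
    intro m
    induction m with
    | zero => exact ⟨1, by simp⟩
    | succ m ih =>
      refine ih.trans ⟨1, ?_⟩
      have h1 : (f ^ (m + 1)) b ≠ a := fun h => hab (SameCycle.symm ⟨((m + 1 : ℕ) : ℤ), by
        rw [zpow_natCast]; exact h⟩)
      have h2 : (f ^ (m + 1)) b ≠ b := fun h => hn (by rwa [h] at ih)
      rw [zpow_one, Perm.mul_apply, swap_apply_of_ne_of_ne h1 h2, pow_succ' f (m + 1),
        Perm.mul_apply]
  obtain ⟨m, hm⟩ : ∃ m, orderOf f = m + 1 := ⟨orderOf f - 1, by have := orderOf_pos f; omega⟩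
  have := key m
  rw [← hm, pow_orderOf_eq_one] at this
  exact hn this

theorem card_cycles_mul_swap_le [Finite X] [DecidableEq X] (f : Perm X) (a b : X) :
    Nat.card (Quotient (SameCycle.setoid (f * swap a b))) ≤
      Nat.card (Quotient (SameCycle.setoid f)) + 1 := by
  obtain ⟨t, h1, h2, -, h3, -⟩ := exists_merge (SameCycle.setoid (f * swap a b)) a b
  have : SameCycle.setoid f ≤ t := by
    have := sameCycle_mul_swap_le h1 h2
    rwa [mul_assoc, swap_mul_self, mul_one] at this
  exact h3.trans (Nat.add_le_add_right (card_quotient_le_of_le this) 1)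

theorem card_cycles_mul_swap_of_not_sameCycle [Finite X] [DecidableEq X] {f : Perm X} {a b : X}
    (hab : ¬ f.SameCycle a b) :
    Nat.card (Quotient (SameCycle.setoid (f * swap a b))) + 1 ≤
      Nat.card (Quotient (SameCycle.setoid f)) := by
  obtain ⟨t, h1, h2, h4, -, h3⟩ := exists_merge (SameCycle.setoid f) a b
  refine le_trans (Nat.add_le_add_right (card_quotient_le_of_le (h4 _ ?_ ?_)) 1) (h3 hab)
  · have := sameCycle_mul_swap_le (f := f * swap a b) le_rfl (sameCycle_mul_swap hab)
    rwa [mul_assoc, swap_mul_self, mul_one] at this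
  · exact sameCycle_mul_swap hab

/-- The genus of a combinatorial map is nonnegative: for a permutation `σ` and an involution `α`
the numbers of vertices, edges, faces and components satisfy Euler's inequality.  The involution
is built up from transpositions; each of them splits or joins one cycle of the product, and has to
join if it connects two components. -/
theorem card_cycles_add_le [Finite X] (σ α : Perm X) (hα : ∀ x, α (α x) = x) :
    Nat.card (Quotient (SameCycle.setoid (σ * α))) + Nat.card (Quotient (SameCycle.setoid σ)) +
      Nat.card (Quotient (SameCycle.setoid α)) ≤
    Nat.card X + 2 * Nat.card (Quotient (SameCycle.setoid σ ⊔ SameCycle.setoid α)) := by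
  classical
  induction hn : {x | α x ≠ x}.ncard using Nat.strong_induction_on generalizing α with
  | _ n ih =>
  by_cases h1 : ∀ x, α x = x
  · obtain rfl : α = 1 := Perm.ext h1
    have hb : SameCycle.setoid (1 : Perm X) = ⊥ := by
      refine le_antisymm (sameCycle_le_iff.2 fun x => rfl) bot_le
    rw [hb, sup_bot_eq, mul_one]
    have : Nat.card (Quotient (⊥ : Setoid X)) ≤ Nat.card X :=
      Nat.card_le_card_of_surjective (Quotient.mk _) Quotient.mk_surjective
    omega
  · push Not at h1
    obtain ⟨a, ha⟩ := h1
    set b := α a with hb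
    have hba : α b = a := hα a
    -- `α'` is `α` without the transposition of `a` and `b`
    set α' := α * swap a b with hα'
    have hαeq : α = α' * swap a b := by rw [hα', mul_assoc, swap_mul_self, mul_one]
    have ha' : α' a = a := by simp [hα', hba]
    have hb' : α' b = b := by simp [hα', ← hb]
    have hx' : ∀ x, x ≠ a → x ≠ b → α' x = α x := fun x h1 h2 => by
      simp [hα', swap_apply_of_ne_of_ne h1 h2]
    have hinv : ∀ x, α' (α' x) = x := by
      intro x
      by_cases hxa : x = a
      · rw [hxa, ha', ha']
      by_cases hxb : x = b
      · rw [hxb, hb', hb']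
      rw [hx' x hxa hxb, hx', hα]
      · intro h; apply hxb; rw [hb, ← h, hα]
      · intro h; apply hxa; apply α.injective; rw [h]
    have hlt : {x | α' x ≠ x}.ncard < n := by
      rw [← hn]
      refine Set.ncard_lt_ncard ⟨fun x hx => ?_, fun h => ?_⟩ (Set.toFinite _)
      · by_cases hxa : x = a
        · exact absurd (hxa ▸ ha') hx
        by_cases hxb : x = b
        · exact absurd (hxb ▸ hb') hx
        rwa [Set.mem_ofPred_eq, hx' x hxa hxb] at hx
      · exact (h (show a ∈ {x | α x ≠ x} from ha)) ha'
    have IH := ih _ hlt α' hinv rfl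
    have hab' : ¬ α'.SameCycle a b := by
      intro h
      have h2 : ∀ i : ℤ, (α' ^ i) a = a := fun i => zpow_apply_eq_self_of_apply_eq_self ha' i
      obtain ⟨i, hi⟩ := h
      rw [h2] at hi
      exact ha hi.symm
    have hα1 := card_cycles_mul_swap_of_not_sameCycle hab'
    rw [← hαeq] at hα1
    have hρ : σ * α = σ * α' * swap a b := by rw [mul_assoc, ← hαeq]
    -- if `a` and `b` are connected without the edge between them, the number of components is the
    -- same for `α'`; otherwise the edge joins two cycles of `σ * α'` and two components
    by_cases hK : (SameCycle.setoid σ ⊔ SameCycle.setoid α') a b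
    · have h3 := card_cycles_mul_swap_le (σ * α') a b
      rw [← hρ] at h3
      have h4 : SameCycle.setoid σ ⊔ SameCycle.setoid α ≤
          SameCycle.setoid σ ⊔ SameCycle.setoid α' := by
        refine sup_le le_sup_left ?_
        rw [hαeq]
        exact sameCycle_mul_swap_le le_sup_right hK
      have h5 := card_quotient_le_of_le h4
      omega
    · have h2 : ¬ (σ * α').SameCycle a b := fun h => hK <| by
        refine sameCycle_le_iff.2 ?_ h
        intro x
        refine Setoid.trans' _ (le_sup_right (a := SameCycle.setoid σ) (b := SameCycle.setoid α')
          (⟨1, rfl⟩ : α'.SameCycle x (α' x))) ?_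
        exact le_sup_left (a := SameCycle.setoid σ) (b := SameCycle.setoid α')
          (⟨1, rfl⟩ : σ.SameCycle (α' x) (σ (α' x)))
      have h3 := card_cycles_mul_swap_of_not_sameCycle h2
      rw [← hρ] at h3
      obtain ⟨t, k1, k2, -, k3, -⟩ := exists_merge (SameCycle.setoid σ ⊔ SameCycle.setoid α') a b
      have h4 : SameCycle.setoid σ ⊔ SameCycle.setoid α ≤ t := by
        refine sup_le (le_sup_left.trans k1) ?_
        rw [hαeq]
        exact sameCycle_mul_swap_le (le_sup_right.trans k1) k2
      have h5 := card_quotient_le_of_le h4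
      omega

open Classical in
/-- If the weights of every class of a setoid add up to at least `1`, there are at most as many
classes as the total weight. -/
theorem card_quotient_le_sum [Fintype X] (s : Setoid X) (w : X → ℚ)
    (h : ∀ x, 1 ≤ ∑ y with s x y, w y) : (Nat.card (Quotient s) : ℚ) ≤ ∑ x, w x := by
  rw [← Finset.sum_fiberwise Finset.univ (fun x => Quotient.mk s x) w, Nat.card_eq_fintype_card,
    ← Finset.card_univ, Finset.cast_card]
  refine Finset.sum_le_sum fun q _ => ?_
  induction q using Quotient.inductionOn with
  | _ x =>
    refine (h x).trans (le_of_eq (Finset.sum_congr ?_ fun _ _ => rfl))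
    ext y
    simp only [Finset.mem_filter, Finset.mem_univ, true_and]
    exact ⟨fun h => Quotient.sound (s.symm h), fun h => s.symm (Quotient.exact h)⟩

open Classical in
theorem sum_quotient_eq [Fintype X] {M : Type*} [AddCommMonoid M] (s : Setoid X) (w : X → M) :
    ∑ q : Quotient s, ∑ y with s q.out y, w y = ∑ x, w x := by
  rw [← Finset.sum_fiberwise Finset.univ (fun x => Quotient.mk s x) w]
  refine Finset.sum_congr rfl fun q _ => Finset.sum_congr ?_ fun _ _ => rfl
  ext y
  simp only [Finset.mem_filter, Finset.mem_univ, true_and]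
  exact ⟨fun h => by rw [← q.out_eq]; exact Quotient.sound (s.symm h),
    fun h => by subst h; exact Quotient.mk_out y⟩

/-- Every class of a setoid has total weight `1` if its elements share it equally. -/
theorem sum_inv_card_class [Fintype X] (s : Setoid X) :
    ∑ x, (1 : ℚ) / Nat.card {y // s x y} = Nat.card (Quotient s) := by
  classical
  rw [← Finset.sum_fiberwise Finset.univ (fun x => Quotient.mk s x), Nat.card_eq_fintype_card,
    ← Finset.card_univ, Finset.cast_card]
  refine Finset.sum_congr rfl fun q _ => ?_
  induction q using Quotient.inductionOn with
  | _ x =>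
    have h1 : ∀ y ∈ ({y | Quotient.mk s y = Quotient.mk s x} : Finset X),
        (1 : ℚ) / Nat.card {z // s y z} = 1 / Nat.card {z // s x z} := by
      intro y hy
      simp only [Finset.mem_filter, Finset.mem_univ, true_and] at hy
      have hy' : s y x := Quotient.exact hy
      have : ∀ z, s y z ↔ s x z := fun z => ⟨s.trans (s.symm hy'), s.trans hy'⟩
      simp only [this]
    rw [Finset.sum_congr rfl h1, Finset.sum_const, nsmul_eq_mul]
    have h2 : Finset.card ({y | Quotient.mk s y = Quotient.mk s x} : Finset X) =
        Nat.card {z // s x z} := by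
      rw [Nat.card_eq_fintype_card, Fintype.card_subtype]
      congr 1
      ext y
      simp only [Finset.mem_filter, Finset.mem_univ, true_and]
      exact ⟨fun h => s.symm (Quotient.exact h), fun h => Quotient.sound (s.symm h)⟩
    rw [h2]
    have h3 : Nat.card {z // s x z} ≠ 0 := by
      have : Nonempty {z // s x z} := ⟨⟨x, s.refl x⟩⟩
      exact Nat.card_pos.ne'
    field_simp

end Counting

/-! ### Orbits of permutations -/

section Orbits

open Equiv Equiv.Perm

variable {X : Type*}

theorem sameCycle_iff_exists_lt [Finite X] {f : Perm X} {x y : X} :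
    f.SameCycle x y ↔ ∃ j < Function.minimalPeriod f x, (f ^ j) x = y := by
  constructor
  · intro h
    obtain ⟨i, hi⟩ := h.exists_nat_pow_eq
    have hp : 0 < Function.minimalPeriod f x :=
      Function.minimalPeriod_pos_of_mem_periodicPts
        (f.injective.mem_periodicPts x)
    refine ⟨i % Function.minimalPeriod f x, Nat.mod_lt _ hp, ?_⟩
    rw [← hi, ← iterate_eq_pow, ← iterate_eq_pow, Function.iterate_mod_minimalPeriod_eq]
  · rintro ⟨j, -, rfl⟩
    exact ⟨j, by simp⟩

theorem card_sameCycle [Finite X] (f : Perm X) (x : X) :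
    Nat.card {y // f.SameCycle x y} = Function.minimalPeriod f x := by
  rw [← Nat.card_fin (Function.minimalPeriod f x)]
  symm
  refine Nat.card_congr (Equiv.ofBijective
    (fun j : Fin (Function.minimalPeriod f x) => ⟨(f ^ (j : ℕ)) x, ⟨j, by simp⟩⟩) ⟨?_, ?_⟩)
  · intro i j hij
    have := congrArg Subtype.val hij
    simp only [← iterate_eq_pow] at this
    exact Fin.ext (Function.iterate_injOn_Iio_minimalPeriod i.2 j.2 this)
  · rintro ⟨y, hy⟩
    obtain ⟨j, hj, rfl⟩ := sameCycle_iff_exists_lt.1 hy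
    exact ⟨⟨j, hj⟩, rfl⟩

theorem card_sameCycle_two [Finite X] {f : Perm X} {x : X} (h1 : f x ≠ x) (h2 : f (f x) = x) :
    Nat.card {y // f.SameCycle x y} = 2 := by
  have : Fact (Nat.Prime 2) := ⟨Nat.prime_two⟩
  rw [card_sameCycle]
  exact Function.minimalPeriod_eq_prime h2 h1

theorem card_sameCycle_three [Finite X] {f : Perm X} {x : X} (h1 : f x ≠ x)
    (h2 : f (f (f x)) = x) : Nat.card {y // f.SameCycle x y} = 3 := by
  have : Fact (Nat.Prime 3) := ⟨Nat.prime_three⟩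
  rw [card_sameCycle]
  exact Function.minimalPeriod_eq_prime h2 h1

open Classical in
/-- The number of classes contained in a set that is a union of classes. -/
theorem card_quotient_comap [Fintype X] (s : Setoid X) (p : X → Prop)
    (h : ∀ x y, s x y → p x → p y) :
    (Nat.card (Quotient (s.comap (Subtype.val : Subtype p → X))) : ℚ) =
      ∑ x with p x, (1 : ℚ) / Nat.card {y // s x y} := by
  rw [← sum_inv_card_class, Finset.sum_subtype (p := p) _ (by simp)]
  refine Finset.sum_congr rfl fun x _ => ?_
  congr 2
  refine Nat.card_congr
    { toFun := fun y => ⟨y.1.1, y.2⟩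
      invFun := fun y => ⟨⟨y.1, h _ _ y.2 x.2⟩, y.2⟩
      left_inv := fun y => rfl
      right_inv := fun y => rfl }

/-- Euler's inequality for one component, in terms of the sizes of the cycles. -/
theorem euler_component [Fintype X] (σ α : Perm X) (hα : ∀ x, α (α x) = x) (p : X → Prop)
    [DecidablePred p]
    (hσ : ∀ x, p (σ x) ↔ p x) (hαp : ∀ x, p (α x) ↔ p x)
    (hp : ∀ s : Setoid X, (∀ x, s x (σ x)) → (∀ x, s x (α x)) → ∀ x y, p x → p y → s x y) :
    ∑ x with p x, ((1 : ℚ) / Nat.card {y // (σ * α).SameCycle x y} +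
      1 / Nat.card {y // σ.SameCycle x y} + 1 / Nat.card {y // α.SameCycle x y}) ≤
    ∑ x with p x, (1 : ℚ) + 2 := by
  classical
  have key : ∀ (f : Perm X) (hf : ∀ x, p (f x) ↔ p x),
      ((Nat.card (Quotient (SameCycle.setoid (f.subtypePerm hf)))) : ℚ) =
        ∑ x with p x, (1 : ℚ) / Nat.card {y // f.SameCycle x y} := by
    intro f hf
    have h1 := card_quotient_comap (SameCycle.setoid f) p ?_
    · have h2 : SameCycle.setoid (f.subtypePerm hf) =
          (SameCycle.setoid f).comap (Subtype.val : Subtype p → X) := by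
        ext x y
        exact sameCycle_subtypePerm
      rw [h2, h1]
      refine Finset.sum_congr (by congr) fun x _ => rfl
    · intro x y hxy hx
      let t : Setoid X := Setoid.ker p
      have : SameCycle.setoid f ≤ t := sameCycle_le_iff.2 fun x => propext (hf x).symm
      exact (this hxy : p x = p y) ▸ hx
  have hm : ∀ x, p ((σ * α) x) ↔ p x := fun x => by rw [Perm.mul_apply, hσ, hαp]
  have hR := card_cycles_add_le (σ.subtypePerm hσ) (α.subtypePerm hαp)
    (fun x => Subtype.ext (hα x))
  have hmul : σ.subtypePerm hσ * α.subtypePerm hαp = (σ * α).subtypePerm hm := by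
    ext x; rfl
  have hK : Nat.card (Quotient (SameCycle.setoid (σ.subtypePerm hσ) ⊔
      SameCycle.setoid (α.subtypePerm hαp))) ≤ 1 := by
    set s := SameCycle.setoid (σ.subtypePerm hσ) ⊔ SameCycle.setoid (α.subtypePerm hαp) with hs
    let t : Setoid X :=
      { r := fun x y => (p x ↔ p y) ∧ ∀ (hx : p x) (hy : p y), s ⟨x, hx⟩ ⟨y, hy⟩
        iseqv := ⟨fun x => ⟨Iff.rfl, fun _ _ => s.refl _⟩,
          fun h => ⟨h.1.symm, fun hx hy => s.symm (h.2 hy hx)⟩,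
          fun h h' => ⟨h.1.trans h'.1, fun hx hy =>
            s.trans (h.2 hx (h.1.1 hx)) (h'.2 (h.1.1 hx) hy)⟩⟩ }
    have ht := hp t (fun x => ⟨(hσ x).symm, fun hx hy =>
        le_sup_left (a := SameCycle.setoid (σ.subtypePerm hσ)) (⟨1, rfl⟩ :
          (σ.subtypePerm hσ).SameCycle ⟨x, hx⟩ ⟨σ x, hy⟩)⟩)
      (fun x => ⟨(hαp x).symm, fun hx hy =>
        le_sup_right (b := SameCycle.setoid (α.subtypePerm hαp)) (⟨1, rfl⟩ :
          (α.subtypePerm hαp).SameCycle ⟨x, hx⟩ ⟨α x, hy⟩)⟩)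
    refine Finite.card_le_one_iff_subsingleton.2 ⟨fun a b => ?_⟩
    induction a using Quotient.inductionOn with
    | _ x =>
    induction b using Quotient.inductionOn with
    | _ y => exact Quotient.sound ((ht x y x.2 y.2).2 x.2 y.2)
  rw [hmul] at hR
  have hR' : ((Nat.card (Quotient (SameCycle.setoid ((σ * α).subtypePerm hm))) : ℚ) +
      Nat.card (Quotient (SameCycle.setoid (σ.subtypePerm hσ))) +
      Nat.card (Quotient (SameCycle.setoid (α.subtypePerm hαp)))) ≤
      Nat.card (Subtype p) + 2 := by
    exact_mod_cast hR.trans (Nat.add_le_add_left (Nat.mul_le_mul_left 2 hK) _)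
  rw [key, key, key] at hR'
  rw [Finset.sum_add_distrib, Finset.sum_add_distrib]
  refine hR'.trans (le_of_eq ?_)
  rw [Finset.sum_const, nsmul_eq_mul, mul_one, Nat.card_eq_fintype_card, Fintype.card_subtype]

end Orbits

/-! ### Planar maps without axioms, and connected webs -/

/-- The data of a `Web`, without the axioms. -/
structure Raw where
  /-- half-edges -/
  Dart : Type
  next : Equiv.Perm Dart
  opp : Equiv.Perm Dart
  base : Dart
  out : Dart → Bool
  region : Setoid Dart

/-- Forget the axioms of a web. -/
abbrev Web.raw (W : Web) : Raw := ⟨W.Dart, W.next, W.opp, W.base, W.out, W.region⟩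

namespace Raw

/-- The `k`-th half-edge at `∞`, counted from the stub. -/
def pt (R : Raw) (k : ℕ) : R.Dart := (R.next ^ k) R.base

/-- The number of half-edges at `∞`: the stub and the endpoints. -/
noncomputable def period (R : Raw) : ℕ := Function.minimalPeriod R.next R.base

/-- Every region that does not touch the boundary of the disk has at least six sides. -/
def NonElliptic (R : Raw) : Prop :=
  ∀ d, (∀ k, ¬ R.region d (R.pt k)) → 6 ≤ Nat.card {d' // R.region d d'}

/-- The axioms of a web whose graph, including the vertex `∞`, is connected.  Closed loops
are then impossible.  Transitivity of `next` and `opp` is stated as an induction principle, and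
Euler's formula is brought into the form that it takes for a trivalent graph. -/
structure Good (R : Raw) : Prop where
  finite : Finite R.Dart
  opp_opp : ∀ d, R.opp (R.opp d) = d
  opp_eq_self : ∀ d, R.opp d = d ↔ d = R.base
  out_opp : ∀ d, d ≠ R.base → R.out (R.opp d) = !R.out d
  out_base : R.out R.base = false
  vertex : ∀ d, ¬ R.next.SameCycle R.base d →
    R.next d ≠ d ∧ R.next (R.next (R.next d)) = d ∧ R.out (R.next d) = R.out d
  keep : ∀ d, R.region d (R.opp (R.next d))
  conn : ∀ s : Setoid R.Dart, (∀ d, s d (R.next d)) → (∀ d, s d (R.opp d)) → ∀ d d', s d d'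
  count : 6 * Nat.card (Quotient R.region) = Nat.card R.Dart + 2 * R.period + 3

theorem pt_zero (R : Raw) : R.pt 0 = R.base := rfl

theorem next_pt (R : Raw) (k : ℕ) : R.next (R.pt k) = R.pt (k + 1) := by
  rw [pt, pt, pow_succ', Equiv.Perm.mul_apply]

theorem sameCycle_pt (R : Raw) (k : ℕ) : R.next.SameCycle R.base (R.pt k) := ⟨k, by simp [pt]⟩

theorem sameCycle_iff (R : Raw) [Finite R.Dart] {d : R.Dart} :
    R.next.SameCycle R.base d ↔ ∃ j < R.period, R.pt j = d := sameCycle_iff_exists_lt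

theorem period_pos (R : Raw) [Finite R.Dart] : 0 < R.period :=
  Function.minimalPeriod_pos_of_mem_periodicPts (R.next.injective.mem_periodicPts _)

theorem pt_period (R : Raw) : R.pt R.period = R.base := by
  rw [pt, ← Equiv.Perm.iterate_eq_pow]
  exact Function.isPeriodicPt_minimalPeriod R.next R.base

theorem pt_inj (R : Raw) {i j : ℕ} (hi : i < R.period) (hj : j < R.period)
    (h : R.pt i = R.pt j) : i = j := by
  simp only [pt, ← Equiv.Perm.iterate_eq_pow] at h
  exact Function.iterate_injOn_Iio_minimalPeriod hi hj h

end Raw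

namespace Web

theorem keep (W : Web) (d : W.Dart) : W.region d (W.opp (W.next d)) := by
  have := W.region_keep_left (W.opp (W.next d))
  rw [W.opp_opp, Equiv.symm_apply_apply] at this
  exact W.region.symm this

theorem card_opp_class (W : Web) {d : W.Dart} (hd : d ≠ W.base) :
    Nat.card {y // W.opp.SameCycle d y} = 2 := by
  have := W.finite
  exact card_sameCycle_two (fun h => hd ((W.opp_eq_self d).1 h)) (W.opp_opp d)

theorem card_opp_class_base (W : Web) : Nat.card {y // W.opp.SameCycle W.base y} = 1 := by
  have := W.finite
  rw [card_sameCycle, Function.minimalPeriod_eq_one_iff_isFixedPt]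
  exact (W.opp_eq_self _).2 rfl

/-- In a non-elliptic web every component of the graph contains `∞`.  Otherwise compare Euler's
formula with Euler's inequality for the component of `∞`: a half-edge outside of this component
contributes `1/3 - 1/2` to the number of vertices minus edges and, as its region has at
least six sides or touches the component of `∞`, at most `1/6` to the number of the other
regions. -/
theorem connected_of_nonElliptic (W : Web) (hW : W.NonElliptic) :
    Equiv.Perm.SameCycle.setoid W.next ⊔ Equiv.Perm.SameCycle.setoid W.opp = ⊤ := by
  classical
  have := W.finite
  have := Fintype.ofFinite W.Dart
  set c := Equiv.Perm.SameCycle.setoid W.next ⊔ Equiv.Perm.SameCycle.setoid W.opp with hc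
  have cnext : ∀ d, c d (W.next d) := fun d =>
    le_sup_left (a := Equiv.Perm.SameCycle.setoid W.next) (⟨1, rfl⟩ : W.next.SameCycle _ _)
  have copp : ∀ d, c d (W.opp d) := fun d =>
    le_sup_right (b := Equiv.Perm.SameCycle.setoid W.opp) (⟨1, rfl⟩ : W.opp.SameCycle _ _)
  let p : W.Dart → Prop := fun d => c W.base d
  have cpt : ∀ k, p (W.pt k) := fun k =>
    le_sup_left (a := Equiv.Perm.SameCycle.setoid W.next) (W.raw.sameCycle_pt k)
  -- the orbits of `φ` are the boundary components of the regions
  set φ := W.next⁻¹ * W.opp with hφ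
  have hφr : ∀ d d', φ.SameCycle d d' → W.region d d' := fun d d' h =>
    sameCycle_le_iff.2 (fun x => W.region_keep_left x) h
  have hnextinv : ∀ x, p (W.next⁻¹ x) ↔ p x := fun x => by
    have := cnext (W.next⁻¹ x)
    rw [show W.next (W.next⁻¹ x) = x from W.next.apply_symm_apply x] at this
    exact ⟨fun h => c.trans h this, fun h => c.trans h (c.symm this)⟩
  have hoppp : ∀ x, p (W.opp x) ↔ p x := fun x =>
    ⟨fun h => c.trans h (c.symm (copp x)), fun h => c.trans h (copp x)⟩
  -- Euler's inequality for the component `p` of `∞`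
  have E0 := euler_component W.next⁻¹ W.opp W.opp_opp p hnextinv hoppp (by
    intro s h1 h2 x y hx hy
    have : c ≤ s := by
      refine sup_le (sameCycle_le_iff.2 fun x => ?_) (sameCycle_le_iff.2 h2)
      have := h1 (W.next x)
      rw [show W.next⁻¹ (W.next x) = x from W.next.symm_apply_apply x] at this
      exact s.symm this
    exact this (c.trans (c.symm hx) hy))
  simp only [Equiv.Perm.sameCycle_inv] at E0
  rw [← hφ] at E0
  -- a region that meets `p` contains a whole face of `p`; another one has at least six sides
  have hF : (Nat.card (Quotient W.region) : ℚ) ≤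
      ∑ d, if p d then (1 : ℚ) / Nat.card {y // φ.SameCycle d y} else 1 / 6 := by
    refine card_quotient_le_sum _ _ fun x => ?_
    by_cases hx : ∃ y, W.region x y ∧ p y
    · obtain ⟨y, hxy, hy⟩ := hx
      have h1 : ∀ z, φ.SameCycle y z → p z := by
        intro z hz
        have : Equiv.Perm.SameCycle.setoid φ ≤ c := sameCycle_le_iff.2 fun u => by
          refine c.trans (copp u) (c.symm ?_)
          have := cnext (φ u)
          rwa [show W.next (φ u) = W.opp u from W.next.apply_symm_apply _] at this
        exact c.trans hy (this hz)
      have h2 : ∀ z, φ.SameCycle y z →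
          Nat.card {u // φ.SameCycle z u} = Nat.card {u // φ.SameCycle y u} := by
        intro z hz
        simp only [show ∀ u, φ.SameCycle z u ↔ φ.SameCycle y u from
          fun u => ⟨hz.trans, hz.symm.trans⟩]
      calc (1 : ℚ) = ∑ z with φ.SameCycle y z, (1 : ℚ) / Nat.card {u // φ.SameCycle y u} := by
            rw [Finset.sum_const, nsmul_eq_mul, Nat.card_eq_fintype_card, Fintype.card_subtype]
            have : (0 : ℚ) < Finset.card {z | φ.SameCycle y z} := by
              rw [Nat.cast_pos, Finset.card_pos]
              exact ⟨y, by simp [Equiv.Perm.SameCycle.refl]⟩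
            field_simp
        _ = ∑ z with φ.SameCycle y z, if p z then (1 : ℚ) / Nat.card {u // φ.SameCycle z u}
              else 1 / 6 := by
            refine Finset.sum_congr rfl fun z hz => ?_
            simp only [Finset.mem_filter, Finset.mem_univ, true_and] at hz
            rw [if_pos (h1 z hz), h2 z hz]
        _ ≤ _ := by
            refine Finset.sum_le_sum_of_subset_of_nonneg ?_ ?_
            · intro z hz
              simp only [Finset.mem_filter, Finset.mem_univ, true_and] at hz ⊢
              exact W.region.trans hxy (hφr _ _ hz)
            · intro z _ _
              split_ifs <;> positivity
    · push Not at hx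
      have h6 := hW x fun k hk => hx _ hk (cpt k)
      rw [Finset.sum_congr rfl (g := fun _ => (1 : ℚ) / 6) (by
        intro z hz
        simp only [Finset.mem_filter, Finset.mem_univ, true_and] at hz
        rw [if_neg (hx z hz)]), Finset.sum_const, nsmul_eq_mul]
      rw [Nat.card_eq_fintype_card, Fintype.card_subtype] at h6
      have : (6 : ℚ) ≤ Finset.card {z | W.region x z} := by exact_mod_cast h6
      linarith
  have hEu : (Nat.card (Quotient (Equiv.Perm.SameCycle.setoid W.next)) : ℚ) +
      Nat.card (Quotient W.region) =
      Nat.card (Quotient (Equiv.Perm.SameCycle.setoid W.opp)) + Nat.card (Quotient c) := by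
    exact_mod_cast W.euler
  rw [← sum_inv_card_class (Equiv.Perm.SameCycle.setoid W.next),
    ← sum_inv_card_class (Equiv.Perm.SameCycle.setoid W.opp), ← sum_inv_card_class c] at hEu
  have hsplit : ∀ f : W.Dart → ℚ, ∑ d, f d = ∑ d with p d, f d + ∑ d with ¬ p d, f d := fun f =>
    (Finset.sum_filter_add_sum_filter_not _ _ _).symm
  rw [hsplit, hsplit, hsplit] at hEu
  rw [hsplit] at hF
  have hF1 : (∑ d with p d, if p d then (1 : ℚ) / Nat.card {y // φ.SameCycle d y} else 1 / 6) =
      ∑ d with p d, (1 : ℚ) / Nat.card {y // φ.SameCycle d y} :=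
    Finset.sum_congr rfl fun d hd => by
      simp only [Finset.mem_filter, Finset.mem_univ, true_and] at hd
      rw [if_pos hd]
  have hF2 : (∑ d with ¬ p d, if p d then (1 : ℚ) / Nat.card {y // φ.SameCycle d y} else 1 / 6) =
      ∑ d with ¬ p d, (1 : ℚ) / 6 :=
    Finset.sum_congr rfl fun d hd => by
      simp only [Finset.mem_filter, Finset.mem_univ, true_and] at hd
      rw [if_neg hd]
  rw [hF1, hF2] at hF
  have hE0 : ∑ d with p d, ((2 : ℚ) / Nat.card {y // W.opp.SameCycle d y} - 1) = 1 := by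
    rw [Finset.sum_eq_single W.base]
    · rw [card_opp_class_base]; norm_num
    · intro d _ hd
      rw [W.card_opp_class hd]; norm_num
    · intro h
      exact absurd (by simp [p]) h
  have hE0' : 2 * ∑ d with p d, (1 : ℚ) / Nat.card {y // W.opp.SameCycle d y} =
      ∑ d with p d, (1 : ℚ) + 1 := by
    rw [Finset.sum_sub_distrib] at hE0
    rw [Finset.mul_sum]
    simp only [mul_one_div]
    linarith
  have hC0 : ∑ d with p d, (1 : ℚ) / Nat.card {y // c d y} = 1 := by
    have h1 : ∀ d ∈ ({d | p d} : Finset W.Dart),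
        (1 : ℚ) / Nat.card {y // c d y} = 1 / Nat.card {y // c W.base y} := by
      intro d hd
      simp only [Finset.mem_filter, Finset.mem_univ, true_and] at hd
      simp only [show ∀ u, c d u ↔ c W.base u from
          fun u => ⟨c.trans hd, c.trans (c.symm hd)⟩]
    rw [Finset.sum_congr rfl h1, Finset.sum_const, nsmul_eq_mul, Nat.card_eq_fintype_card,
      Fintype.card_subtype]
    have : (0 : ℚ) < Finset.card {z | c W.base z} := by
      rw [Nat.cast_pos, Finset.card_pos]
      exact ⟨W.base, by simp⟩
    simp only [p]
    field_simp
  simp only [Finset.sum_add_distrib] at E0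
  change _ + ∑ d with ¬ p d, (1 : ℚ) / Nat.card {y // W.next.SameCycle d y} + _ =
    _ + ∑ d with ¬ p d, (1 : ℚ) / Nat.card {y // W.opp.SameCycle d y} + _ at hEu
  -- what remains of Euler's formula outside of `p`; each summand violates this inequality
  have hoff : ∑ d with ¬ p d, (1 : ℚ) / Nat.card {y // W.opp.SameCycle d y} +
      ∑ d with ¬ p d, (1 : ℚ) / Nat.card {y // c d y} ≤
      ∑ d with ¬ p d, (1 : ℚ) / Nat.card {y // W.next.SameCycle d y} +
        ∑ d with ¬ p d, (1 : ℚ) / 6 := by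
    change ∑ d with p d, (1 : ℚ) / Nat.card {y // W.next.SameCycle d y} + _ + _ =
      ∑ d with p d, (1 : ℚ) / Nat.card {y // W.opp.SameCycle d y} + _ + _ at hEu
    linarith
  rw [← Finset.sum_add_distrib, ← Finset.sum_add_distrib] at hoff
  have hall : ∀ d, p d := by
    by_contra hne
    push Not at hne
    obtain ⟨d₀, hd₀⟩ := hne
    refine absurd hoff (not_le.2 (Finset.sum_lt_sum_of_nonempty ⟨d₀, by simp [hd₀]⟩ ?_))
    intro d hd
    simp only [Finset.mem_filter, Finset.mem_univ, true_and] at hd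
    have hdb : d ≠ W.base := fun h => hd (h ▸ c.refl _)
    rw [W.card_opp_class hdb]
    have hcpos : (0 : ℚ) < Nat.card {y // c d y} := by
      have : Nonempty {y // c d y} := ⟨⟨d, c.refl d⟩⟩
      exact_mod_cast Nat.card_pos
    have hninf : ¬ W.next.SameCycle W.base d := fun h => hd
      (le_sup_left (a := Equiv.Perm.SameCycle.setoid W.next) h)
    rcases W.vertex d hninf with ⟨h1, h2, -⟩ | ⟨h1, h2⟩
    · rw [card_sameCycle_three h1 h2]
      have : (0 : ℚ) < 1 / Nat.card {y // c d y} := by positivity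
      norm_num at this ⊢
      linarith
    · -- a closed loop is a component with two half-edges
      have h3 : W.next d ≠ d := fun h => hdb ((W.opp_eq_self d).1 (h1 ▸ h))
      rw [card_sameCycle_two h3 (by rw [h1, h2])]
      have hle : Nat.card {y // c d y} ≤ 2 := by
        have hs : ∀ y, c d y → y = d ∨ y = W.opp d := by
          let t : Setoid W.Dart := Setoid.ker fun y => (y = d ∨ y = W.opp d)
          have ht : c ≤ t := by
            refine sup_le (sameCycle_le_iff.2 fun x => ?_) (sameCycle_le_iff.2 fun x => ?_)
            · refine propext ⟨?_, ?_⟩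
              · rintro (rfl | rfl)
                · exact Or.inr h1
                · exact Or.inl h2
              · rintro (h | h)
                · exact Or.inr (W.next.injective (h.trans h2.symm))
                · exact Or.inl (W.next.injective (h.trans h1.symm))
            · refine propext ⟨?_, ?_⟩
              · rintro (rfl | rfl)
                · exact Or.inr rfl
                · exact Or.inl (W.opp_opp _)
              · rintro (h | h)
                · exact Or.inr (by rw [← h, W.opp_opp])
                · exact Or.inl (W.opp.injective h)
          intro y hy
          have : (d = d ∨ d = W.opp d) = (y = d ∨ y = W.opp d) := ht hy
          exact this ▸ Or.inl rfl
        have hcard : Nat.card {y // c d y} = Set.ncard {y | c d y} := rfl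
        rw [hcard]
        refine (Set.ncard_le_ncard (t := {d, W.opp d}) (fun y hy => hs y hy) (Set.toFinite _)).trans
          ((Set.ncard_insert_le _ _).trans (by rw [Set.ncard_singleton]))
      have h2' : (Nat.card {y // c d y} : ℚ) ≤ 2 := by exact_mod_cast hle
      have : (1 : ℚ) / 2 ≤ 1 / Nat.card {y // c d y} := one_div_le_one_div_of_le hcpos h2'
      norm_num at this ⊢
      linarith
  refine top_le_iff.1 fun x y _ => ?_
  exact c.trans (c.symm (hall x)) (hall y)

end Web

/-! ### Curvature -/

theorem card_quotient_top {X : Type*} [Nonempty X] : Nat.card (Quotient (⊤ : Setoid X)) = 1 := by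
  have : Nonempty (Quotient (⊤ : Setoid X)) := ⟨Quotient.mk _ (Classical.arbitrary X)⟩
  have : Subsingleton (Quotient (⊤ : Setoid X)) := ⟨fun a b => by
    induction a using Quotient.inductionOn
    induction b using Quotient.inductionOn
    exact Quotient.sound trivial⟩
  exact Nat.card_unique
namespace Raw

open Classical in
/-- Three times the number of vertices other than `∞` is the number of
half-edges at them. -/
theorem card_vertices (R : Raw) [Finite R.Dart] (hv : ∀ d, ¬ R.next.SameCycle R.base d →
    R.next d ≠ d ∧ R.next (R.next (R.next d)) = d) :
    3 * Nat.card (Quotient (Equiv.Perm.SameCycle.setoid R.next)) + R.period =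
      3 + Nat.card R.Dart := by
  have := Fintype.ofFinite R.Dart
  have hper : Nat.card {y // R.next.SameCycle R.base y} = R.period := card_sameCycle _ _
  have hpcard : Finset.card {y | R.next.SameCycle R.base y} = R.period := by
    rw [← hper, Nat.card_eq_fintype_card, Fintype.card_subtype]
  have hppos : (0 : ℚ) < R.period := by exact_mod_cast R.period_pos
  have hV : 3 * ∑ d, (1 : ℚ) / Nat.card {y // R.next.SameCycle d y} =
      3 + (Nat.card R.Dart - R.period) := by
    rw [← Finset.sum_filter_add_sum_filter_not _ (fun d => R.next.SameCycle R.base d)]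
    have h1 : ∑ d with R.next.SameCycle R.base d, (1 : ℚ) / Nat.card {y // R.next.SameCycle d y}
        = 1 := by
      rw [Finset.sum_congr rfl (g := fun _ => (1 : ℚ) / R.period), Finset.sum_const, hpcard,
        nsmul_eq_mul]
      · field_simp
      · intro d hd
        simp only [Finset.mem_filter, Finset.mem_univ, true_and] at hd
        rw [← hper]
        simp only [show ∀ u, R.next.SameCycle d u ↔ R.next.SameCycle R.base u from
          fun u => ⟨hd.trans, hd.symm.trans⟩]
    have h2 : ∑ d with ¬ R.next.SameCycle R.base d,
        (1 : ℚ) / Nat.card {y // R.next.SameCycle d y} =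
        ∑ d with ¬ R.next.SameCycle R.base d, (1 : ℚ) / 3 := by
      refine Finset.sum_congr rfl fun d hd => ?_
      simp only [Finset.mem_filter, Finset.mem_univ, true_and] at hd
      rw [card_sameCycle_three (hv d hd).1 (hv d hd).2]
      norm_num
    have h3 : (Finset.card {d | ¬ R.next.SameCycle R.base d} : ℚ) =
        Nat.card R.Dart - R.period := by
      have := Finset.card_filter_add_card_filter_not (s := (Finset.univ : Finset R.Dart))
        (fun d => R.next.SameCycle R.base d)
      rw [hpcard, Finset.card_univ, ← Nat.card_eq_fintype_card] at this
      rw [← this]; push_cast; ring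
    rw [h1, h2, Finset.sum_const, nsmul_eq_mul, h3]
    ring
  have hs := sum_inv_card_class (Equiv.Perm.SameCycle.setoid R.next)
  change ∑ d, (1 : ℚ) / Nat.card {y // R.next.SameCycle d y} = _ at hs
  rw [hs] at hV
  have : (3 * Nat.card (Quotient (Equiv.Perm.SameCycle.setoid R.next)) + R.period : ℚ) =
      3 + Nat.card R.Dart := by linarith
  exact_mod_cast this

theorem card_edges (R : Raw) [Finite R.Dart] (h1 : ∀ d, R.opp (R.opp d) = d)
    (h2 : ∀ d, R.opp d = d ↔ d = R.base) :
    2 * Nat.card (Quotient (Equiv.Perm.SameCycle.setoid R.opp)) = Nat.card R.Dart + 1 := by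
  classical
  have := Fintype.ofFinite R.Dart
  have : ∑ d, ((2 : ℚ) / Nat.card {y // R.opp.SameCycle d y} - 1) = 1 := by
    rw [Finset.sum_eq_single R.base]
    · rw [card_sameCycle, Function.minimalPeriod_eq_one_iff_isFixedPt.2 ((h2 _).2 rfl)]
      norm_num
    · intro d _ hd
      rw [card_sameCycle_two (fun h => hd ((h2 d).1 h)) (h1 d)]; norm_num
    · intro h
      exact absurd (Finset.mem_univ _) h
  have hs := sum_inv_card_class (Equiv.Perm.SameCycle.setoid R.opp)
  change ∑ d, (1 : ℚ) / Nat.card {y // R.opp.SameCycle d y} = _ at hs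
  have hm : ∑ d, (2 : ℚ) / Nat.card {y // R.opp.SameCycle d y} =
      2 * ∑ d, (1 : ℚ) / Nat.card {y // R.opp.SameCycle d y} := by
    rw [Finset.mul_sum]
    simp only [mul_one_div]
  rw [Finset.sum_sub_distrib, Finset.sum_const, nsmul_eq_mul, Finset.card_univ,
    ← Nat.card_eq_fintype_card, hm, hs] at this
  have : (2 * Nat.card (Quotient (Equiv.Perm.SameCycle.setoid R.opp)) : ℚ) =
      Nat.card R.Dart + 1 := by linarith
  exact_mod_cast this

end Raw

namespace Web

/-- A non-elliptic web has no closed loops, and its graph is connected. -/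
theorem good_of_nonElliptic (W : Web) (hW : W.NonElliptic) : W.raw.Good := by
  have := W.finite
  have hc := W.connected_of_nonElliptic hW
  have hconn : ∀ s : Setoid W.Dart, (∀ d, s d (W.next d)) → (∀ d, s d (W.opp d)) →
      ∀ d d', s d d' := by
    intro s h1 h2 d d'
    have : Equiv.Perm.SameCycle.setoid W.next ⊔ Equiv.Perm.SameCycle.setoid W.opp ≤ s :=
      sup_le (sameCycle_le_iff.2 h1) (sameCycle_le_iff.2 h2)
    rw [hc] at this
    exact this trivial
  have hvert : ∀ d, ¬ W.next.SameCycle W.base d →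
      W.next d ≠ d ∧ W.next (W.next (W.next d)) = d ∧ W.out (W.next d) = W.out d := by
    intro d hd
    refine (W.vertex d hd).resolve_right fun ⟨h1, h2⟩ => ?_
    let t : Setoid W.Dart := Setoid.ker fun y => (y = d ∨ y = W.opp d)
    have ht := hconn t (fun x => propext ⟨?_, ?_⟩) (fun x => propext ⟨?_, ?_⟩) d W.base
    · have ht' : (d = d ∨ d = W.opp d) = (W.base = d ∨ W.base = W.opp d) := ht
      rcases ht' ▸ Or.inl rfl with h | h
      · exact hd (h ▸ Equiv.Perm.SameCycle.refl _ _)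
      · apply hd
        rw [← W.opp_opp d, ← h, (W.opp_eq_self W.base).2 rfl]
    · rintro (rfl | rfl)
      · exact Or.inr h1
      · exact Or.inl h2
    · rintro (h | h)
      · exact Or.inr (W.next.injective (h.trans h2.symm))
      · exact Or.inl (W.next.injective (h.trans h1.symm))
    · rintro (rfl | rfl)
      · exact Or.inr rfl
      · exact Or.inl (W.opp_opp _)
    · rintro (h | h)
      · exact Or.inr (by rw [← h, W.opp_opp])
      · exact Or.inl (W.opp.injective h)
  refine ⟨W.finite, W.opp_opp, W.opp_eq_self, W.out_opp, W.out_base, hvert, W.keep, hconn, ?_⟩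
  have hEu : Nat.card (Quotient (Equiv.Perm.SameCycle.setoid W.next)) +
      Nat.card (Quotient W.region) =
      Nat.card (Quotient (Equiv.Perm.SameCycle.setoid W.opp)) + 1 := by
    have : Nonempty W.Dart := ⟨W.base⟩
    have := W.euler
    rw [hc, card_quotient_top] at this
    exact this
  have hV := W.raw.card_vertices fun d hd => ⟨(hvert d hd).1, (hvert d hd).2.1⟩
  have hE := W.raw.card_edges W.opp_opp W.opp_eq_self
  change 6 * Nat.card (Quotient W.region) = Nat.card W.Dart + 2 * W.raw.period + 3
  change 3 * Nat.card (Quotient (Equiv.Perm.SameCycle.setoid W.next)) + W.raw.period =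
    3 + Nat.card W.Dart at hV
  change 2 * Nat.card (Quotient (Equiv.Perm.SameCycle.setoid W.opp)) = Nat.card W.Dart + 1 at hE
  omega

end Web

namespace Raw

variable {R : Raw}

theorem Good.next_ne (h : R.Good) {d : R.Dart} (hd : ¬ R.next.SameCycle R.base d) :
    R.next d ≠ d := (h.vertex d hd).1

theorem Good.opp_base (h : R.Good) : R.opp R.base = R.base := (h.opp_eq_self _).2 rfl

theorem Good.card_vertices (h : R.Good) :
    3 * Nat.card (Quotient (Equiv.Perm.SameCycle.setoid R.next)) + R.period =
      3 + Nat.card R.Dart := by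
  have := h.finite
  exact R.card_vertices fun d hd => ⟨(h.vertex d hd).1, (h.vertex d hd).2.1⟩

theorem Good.card_edges (h : R.Good) :
    2 * Nat.card (Quotient (Equiv.Perm.SameCycle.setoid R.opp)) = Nat.card R.Dart + 1 := by
  have := h.finite
  exact R.card_edges h.opp_opp h.opp_eq_self

theorem Good.sup_eq_top (h : R.Good) :
    Equiv.Perm.SameCycle.setoid R.next ⊔ Equiv.Perm.SameCycle.setoid R.opp = ⊤ :=
  top_le_iff.1 fun x y _ => h.conn _
    (fun _ => le_sup_left (a := Equiv.Perm.SameCycle.setoid R.next)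
      (⟨1, rfl⟩ : R.next.SameCycle _ _))
    (fun _ => le_sup_right (b := Equiv.Perm.SameCycle.setoid R.opp)
      (⟨1, rfl⟩ : R.opp.SameCycle _ _)) x y

/-- A connected map that satisfies the axioms is a web. -/
def Good.toWeb (h : R.Good) : Web where
  Dart := R.Dart
  finite := h.finite
  next := R.next
  opp := R.opp
  base := R.base
  out := R.out
  region := R.region
  opp_opp := h.opp_opp
  opp_eq_self := h.opp_eq_self
  out_opp := h.out_opp
  out_base := h.out_base
  vertex := fun d hd => Or.inl (h.vertex d hd)
  region_keep_left := fun d => by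
    have := h.keep (R.next.symm (R.opp d))
    rw [Equiv.apply_symm_apply, h.opp_opp] at this
    exact R.region.symm this
  connected := by rw [h.sup_eq_top, top_sup_eq]
  euler := by
    have : Nonempty R.Dart := ⟨R.base⟩
    have h1 := h.card_vertices
    have h2 := h.card_edges
    have h3 := h.count
    rw [h.sup_eq_top, card_quotient_top]
    omega

/-- The permutation whose orbits are the closed walks along the sides of the regions: from the
corner to the left of `d`, walk along the edge of `next d`, keeping it on the right, to the next
corner. -/
def turn (R : Raw) : Equiv.Perm R.Dart := R.opp * R.next

theorem turn_apply (d : R.Dart) : R.turn d = R.opp (R.next d) := rfl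

/-- In a connected web every region is bounded by a single closed walk: it is bounded by at least
one, and by Euler's formula and Euler's inequality there are at least as many regions as closed
walks. -/
theorem Good.region_iff (h : R.Good) {d d' : R.Dart} :
    R.region d d' ↔ R.turn.SameCycle d d' := by
  have := h.finite
  have : Nonempty R.Dart := ⟨R.base⟩
  have hle : Equiv.Perm.SameCycle.setoid R.turn ≤ R.region := sameCycle_le_iff.2 h.keep
  have hR := card_cycles_add_le R.next⁻¹ R.opp h.opp_opp
  have hinv : ∀ f : Equiv.Perm R.Dart,
      Equiv.Perm.SameCycle.setoid f⁻¹ = Equiv.Perm.SameCycle.setoid f := fun f => by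
    ext x y
    exact Equiv.Perm.sameCycle_inv
  have ho : R.opp⁻¹ = R.opp := by
    ext x
    exact R.opp.injective ((R.opp.apply_symm_apply x).trans (h.opp_opp x).symm)
  have ht : R.next⁻¹ * R.opp = R.turn⁻¹ := by
    rw [turn, mul_inv_rev, ho]
  rw [ht, hinv, hinv, h.sup_eq_top, card_quotient_top] at hR
  have h1 := h.card_vertices
  have h2 := h.card_edges
  have h3 := h.count
  have := setoid_eq_of_le_of_card_le hle (by omega)
  rw [← this]
  rfl

theorem Good.region_pt_zero (h : R.Good) : R.region R.base (R.pt (R.period - 1)) := by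
  have := h.finite
  have h1 := h.keep (R.pt (R.period - 1))
  rw [next_pt, Nat.sub_add_cancel R.period_pos, pt_period, h.opp_base] at h1
  exact R.region.symm h1

/-- The region of the corner at `pt (k + 1)` has `b + 1` sides and touches the boundary of the disk
only between the strands `k + 1` and `k + 2`.  For `b = 0, 1, 2` this says that these strands end
in an arc, at a common vertex, or at the ends of a common edge. -/
def Cap (R : Raw) (b k : ℕ) : Prop :=
  k + 2 < R.period ∧ Nat.card {d // R.region (R.pt (k + 1)) d} = b + 1 ∧
    ∀ j < R.period, R.region (R.pt (k + 1)) (R.pt j) → j = k + 1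

open Classical in
/-- A non-elliptic web with endpoints has an arc, a `Y` or an `H` at its boundary.  The sum over all
regions of `6` minus the number of sides minus twice the number of corners at the boundary is `3`,
so some region has a positive contribution. -/
theorem Good.exists_cap (h : R.Good) (hR : R.NonElliptic) (hn : 1 < R.period) :
    ∃ b k, b ≤ 2 ∧ R.Cap b k := by
  have := h.finite
  have := Fintype.ofFinite R.Dart
  let t : R.Dart → ℤ := fun d => if R.next.SameCycle R.base d then 1 else 0
  have hpcard : Finset.card {y | R.next.SameCycle R.base y} = R.period := by
    rw [period, ← card_sameCycle R.next R.base, Nat.card_eq_fintype_card, Fintype.card_subtype]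
  have htot : ∑ q : Quotient R.region, (6 - ∑ d with R.region q.out d, (1 + 2 * t d)) = 3 := by
    rw [Finset.sum_sub_distrib, sum_quotient_eq, Finset.sum_const, Finset.sum_add_distrib,
      ← Finset.mul_sum, Finset.sum_boole, hpcard, Finset.sum_const, nsmul_eq_mul, nsmul_eq_mul,
      Finset.card_univ, Finset.card_univ, ← Nat.card_eq_fintype_card, ← Nat.card_eq_fintype_card]
    have := h.count
    omega
  obtain ⟨q, -, hq⟩ : ∃ q ∈ Finset.univ (α := Quotient R.region),
      0 < 6 - ∑ d with R.region q.out d, (1 + 2 * t d) := by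
    by_contra! hle
    have := Finset.sum_nonpos hle
    rw [htot] at this
    omega
  set d₀ := q.out
  rw [Finset.sum_add_distrib, ← Finset.mul_sum, Finset.sum_const, nsmul_eq_mul, mul_one] at hq
  have ht : ∑ d with R.region d₀ d, t d =
      Finset.card {d | R.region d₀ d ∧ R.next.SameCycle R.base d} := by
    rw [Finset.sum_boole, Finset.filter_filter]
  rw [ht] at hq
  set T : Finset R.Dart := {d | R.region d₀ d ∧ R.next.SameCycle R.base d} with hT
  have hsub : T ⊆ ({d | R.region d₀ d} : Finset R.Dart) := fun d hd => by
    simp only [hT, Finset.mem_filter, Finset.mem_univ, true_and] at hd ⊢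
    exact hd.1
  have hcard : Nat.card {d // R.region d₀ d} = Finset.card {d | R.region d₀ d} := by
    rw [Nat.card_eq_fintype_card, Fintype.card_subtype]
  have hTle := Finset.card_le_card hsub
  have hT1 : T.card = 1 := by
    by_contra hne
    have : T.card = 0 ∨ 2 ≤ T.card := by omega
    rcases this with h0 | h2
    · have h6 := hR d₀ fun k hk => by
        rw [Finset.card_eq_zero] at h0
        have : R.pt k ∈ T := by
          simp only [hT, Finset.mem_filter, Finset.mem_univ, true_and]
          exact ⟨hk, R.sameCycle_pt k⟩
        rw [h0] at this
        simp at this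
      omega
    · omega
  obtain ⟨p, hp⟩ := Finset.card_eq_one.1 hT1
  have hpT : p ∈ T := by rw [hp]; simp
  simp only [hT, Finset.mem_filter, Finset.mem_univ, true_and] at hpT
  have huniq : ∀ j, R.region p (R.pt j) → R.pt j = p := by
    intro j hj
    have : R.pt j ∈ T := by
      simp only [hT, Finset.mem_filter, Finset.mem_univ, true_and]
      exact ⟨R.region.trans hpT.1 hj, R.sameCycle_pt j⟩
    rw [hp] at this
    simpa using this
  obtain ⟨m, hm, rfl⟩ := R.sameCycle_iff.1 hpT.2
  have hr : ∀ d, R.region d₀ d ↔ R.region (R.pt m) d :=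
    fun d => ⟨R.region.trans (R.region.symm hpT.1), R.region.trans hpT.1⟩
  have hm0 : m ≠ 0 := by
    rintro rfl
    have := R.pt_inj (by omega) (by omega) (huniq _ h.region_pt_zero)
    omega
  have hmn : m ≠ R.period - 1 := by
    rintro rfl
    have := R.pt_inj (by omega) (by omega) (huniq 0 (R.region.symm h.region_pt_zero))
    omega
  obtain ⟨k, rfl⟩ : ∃ k, m = k + 1 := ⟨m - 1, by omega⟩
  have hpos : 0 < Nat.card {d // R.region (R.pt (k + 1)) d} := by
    have : Nonempty {d // R.region (R.pt (k + 1)) d} := ⟨⟨_, R.region.refl _⟩⟩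
    exact Nat.card_pos
  simp only [hr] at hcard hq
  refine ⟨Nat.card {d // R.region (R.pt (k + 1)) d} - 1, k, by omega, by omega, by omega, ?_⟩
  intro j hj hjr
  exact R.pt_inj hj hm (huniq j hjr)

end Raw

/-! ### Attaching a strip with legs -/

/-- `R` arises from `R₁` by gluing on top of the strands `k + 1, …, k + b` a horizontal strip: a
path between two new neighbouring endpoints through `b` trivalent vertices, each of which has
one of the strands as its leg.  For `b = 0, 1, 2` the strip is an arc, a `Y`, and an `H`.  The
half-edges `u j` and `v j` are the left and the right end of the `j`-th edge of the path, and the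
`u j` bound the new region above the strip. -/
structure Glue (b k : ℕ) (R₁ R : Raw) where
  i : R₁.Dart → R.Dart
  u : ℕ → R.Dart
  v : ℕ → R.Dart
  lt : k + b < R₁.period
  i_inj : Function.Injective i
  cover : ∀ d, (∃ d₁, i d₁ = d) ∨ (∃ j ≤ b, u j = d) ∨ ∃ j ≤ b, v j = d
  u_ne : ∀ j ≤ b, ∀ d, u j ≠ i d
  v_ne : ∀ j ≤ b, ∀ d, v j ≠ i d
  u_inj : ∀ j ≤ b, ∀ l ≤ b, u j = u l → j = l
  v_inj : ∀ j ≤ b, ∀ l ≤ b, v j = v l → j = l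
  u_ne_v : ∀ j ≤ b, ∀ l ≤ b, u j ≠ v l
  base : R.base = i R₁.base
  opp_i : ∀ d, R.opp (i d) = i (R₁.opp d)
  opp_u : ∀ j ≤ b, R.opp (u j) = v j
  opp_v : ∀ j ≤ b, R.opp (v j) = u j
  next_i : ∀ d, (∀ j ≤ b, d ≠ R₁.pt (k + j)) → R.next (i d) = i (R₁.next d)
  next_pt : ∀ j ≤ b, R.next (i (R₁.pt (k + j))) = u j
  next_v : ∀ j ≤ b, R.next (v j) = i (R₁.pt (k + j + 1))
  next_u : ∀ j < b, R.next (u (j + 1)) = v j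
  next_u_zero : R.next (u 0) = v b
  out_i : ∀ d, R.out (i d) = R₁.out d
  out_v : ∀ j < b, R.out (v j) = R₁.out (R₁.pt (k + j + 1))
  out_u : ∀ j < b, R.out (u (j + 1)) = R₁.out (R₁.pt (k + j + 1))
  out_uv : ∀ j ≤ b, R.out (v j) = !R.out (u j)
  region_i : ∀ d d', R.region (i d) (i d') ↔ R₁.region d d'
  region_u : ∀ j ≤ b, R.region (u j) (u 0)
  region_v : ∀ j ≤ b, R.region (v j) (i (R₁.pt (k + j)))
  region_ne : ∀ d, ¬ R.region (u 0) (i d)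

theorem Raw.period_eq {R : Raw} {N : ℕ} (hN : 0 < N) (h1 : R.pt N = R.base)
    (h2 : ∀ j, 0 < j → j < N → R.pt j ≠ R.base) : R.period = N := by
  have hp : Function.IsPeriodicPt R.next N R.base := by
    rw [Raw.pt, ← Equiv.Perm.iterate_eq_pow] at h1
    exact h1
  refine le_antisymm (hp.minimalPeriod_le hN) (not_lt.1 fun hlt => ?_)
  exact h2 _ (hp.minimalPeriod_pos hN) hlt R.pt_period

theorem Raw.pt_ne_base {R : Raw} {j : ℕ} (h0 : 0 < j) (h : j < R.period) : R.pt j ≠ R.base :=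
  fun he => by
    have := R.pt_inj h (by omega : 0 < R.period) he
    omega

namespace Glue

variable {b k : ℕ} {R₁ R : Raw} (g : Glue b k R₁ R)

include g

theorem pt_of_le {j : ℕ} (hj : j ≤ k) : R.pt j = g.i (R₁.pt j) := by
  induction j with
  | zero => exact g.base
  | succ j ih =>
    rw [← R.next_pt, ih (by omega), ← R₁.next_pt]
    refine g.next_i _ fun l hl h => ?_
    have := R₁.pt_inj (by have := g.lt; omega) (by have := g.lt; omega) h
    omega

theorem pt_u : R.pt (k + 1) = g.u 0 := by
  rw [← R.next_pt, g.pt_of_le le_rfl]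
  exact g.next_pt 0 (by omega)

theorem pt_v : R.pt (k + 2) = g.v b := by
  rw [← R.next_pt, g.pt_u, g.next_u_zero]

theorem pt_of_gt {m : ℕ} (hm : k + b + 1 + m ≤ R₁.period) :
    R.pt (k + 3 + m) = g.i (R₁.pt (k + b + 1 + m)) := by
  induction m with
  | zero => rw [add_zero, ← R.next_pt, g.pt_v, g.next_v b le_rfl]
  | succ m ih =>
    rw [← add_assoc, ← R.next_pt, ih (by omega), ← add_assoc, ← R₁.next_pt]
    refine g.next_i _ fun l hl h => ?_
    have := R₁.pt_inj (by have := g.lt; omega) (by have := g.lt; omega) h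
    omega

theorem period : R.period + b = R₁.period + 2 := by
  have hlt := g.lt
  obtain ⟨m, hm⟩ : ∃ m, R₁.period = k + b + 1 + m := ⟨R₁.period - (k + b + 1), by omega⟩
  have : R.period = k + 3 + m := by
    refine Raw.period_eq (by omega) ?_ ?_
    · rw [g.pt_of_gt hm.ge, ← hm, R₁.pt_period, g.base]
    · intro j h0 hj
      rw [g.base]
      rcases Nat.lt_or_ge k j with h | h
      · obtain rfl | rfl | h : j = k + 1 ∨ j = k + 2 ∨ k + 3 ≤ j := by omega
        · rw [g.pt_u]; exact g.u_ne _ (by omega) _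
        · rw [g.pt_v]; exact g.v_ne _ le_rfl _
        · obtain ⟨l, rfl⟩ : ∃ l, j = k + 3 + l := ⟨j - (k + 3), by omega⟩
          rw [g.pt_of_gt (by omega)]
          exact fun he => R₁.pt_ne_base (by omega) (by omega) (g.i_inj he)
      · rw [g.pt_of_le h]
        exact fun he => R₁.pt_ne_base h0 (by omega) (g.i_inj he)
  omega

/-- The half-edges at `∞` of the new web. -/
theorem pt_cases {m : ℕ} (hm : m ≤ R.period) :
    (m ≤ k ∧ R.pt m = g.i (R₁.pt m)) ∨ (m = k + 1 ∧ R.pt m = g.u 0) ∨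
      (m = k + 2 ∧ R.pt m = g.v b) ∨
      ∃ l, m + b = l + 2 ∧ k + b < l ∧ l ≤ R₁.period ∧ R.pt m = g.i (R₁.pt l) := by
  have := g.period
  rcases Nat.lt_or_ge k m with h | h
  · obtain rfl | rfl | h : m = k + 1 ∨ m = k + 2 ∨ k + 3 ≤ m := by omega
    · exact Or.inr (Or.inl ⟨rfl, g.pt_u⟩)
    · exact Or.inr (Or.inr (Or.inl ⟨rfl, g.pt_v⟩))
    · obtain ⟨l, rfl⟩ : ∃ l, m = k + 3 + l := ⟨m - (k + 3), by omega⟩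
      exact Or.inr (Or.inr (Or.inr ⟨k + b + 1 + l, by omega, by omega, by omega,
        g.pt_of_gt (by omega)⟩))
  · exact Or.inl ⟨h, g.pt_of_le h⟩

theorem pt_of_gt' {l : ℕ} (h1 : k + b < l) (h2 : l ≤ R₁.period) :
    R.pt (l + 2 - b) = g.i (R₁.pt l) := by
  obtain ⟨m, rfl⟩ : ∃ m, l = k + b + 1 + m := ⟨l - (k + b + 1), by omega⟩
  rw [← g.pt_of_gt h2]
  congr 1
  omega

/-- The new half-edges. -/
noncomputable def equiv : R₁.Dart ⊕ (Fin (b + 1) ⊕ Fin (b + 1)) ≃ R.Dart :=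
  Equiv.ofBijective (Sum.elim g.i (Sum.elim (fun j => g.u j) fun j => g.v j)) <| by
    constructor
    · rintro (x | x | x) (y | y | y) h <;> simp only [Sum.elim_inl, Sum.elim_inr] at h
      · rw [g.i_inj h]
      · exact absurd h.symm (g.u_ne _ (by omega) _)
      · exact absurd h.symm (g.v_ne _ (by omega) _)
      · exact absurd h (g.u_ne _ (by omega) _)
      · rw [Fin.ext (g.u_inj _ (by omega) _ (by omega) h)]
      · exact absurd h (g.u_ne_v _ (by omega) _ (by omega))
      · exact absurd h (g.v_ne _ (by omega) _)
      · exact absurd h.symm (g.u_ne_v _ (by omega) _ (by omega))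
      · rw [Fin.ext (g.v_inj _ (by omega) _ (by omega) h)]
    · intro d
      rcases g.cover d with ⟨d₁, rfl⟩ | ⟨j, hj, rfl⟩ | ⟨j, hj, rfl⟩
      · exact ⟨.inl d₁, rfl⟩
      · exact ⟨.inr (.inl ⟨j, by omega⟩), rfl⟩
      · exact ⟨.inr (.inr ⟨j, by omega⟩), rfl⟩

theorem finite [Finite R₁.Dart] : Finite R.Dart := Finite.of_equiv _ g.equiv

theorem finite_left [Finite R.Dart] : Finite R₁.Dart := Finite.of_injective _ g.i_inj

theorem card [Finite R₁.Dart] : Nat.card R.Dart = Nat.card R₁.Dart + 2 * (b + 1) := by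
  rw [← Nat.card_congr g.equiv, Nat.card_sum, Nat.card_sum, Nat.card_fin]
  ring

theorem region_u_i {j : ℕ} (hj : j ≤ b) (d : R₁.Dart) : ¬ R.region (g.u j) (g.i d) := fun h =>
  g.region_ne d (R.region.trans (R.region.symm (g.region_u j hj)) h)

theorem region_i_u {j : ℕ} (hj : j ≤ b) (d : R₁.Dart) : ¬ R.region (g.i d) (g.u j) := fun h =>
  g.region_u_i hj d (R.region.symm h)

theorem region_i_v {j : ℕ} (hj : j ≤ b) (d : R₁.Dart) :
    R.region (g.i d) (g.v j) ↔ R₁.region d (R₁.pt (k + j)) := by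
  rw [← g.region_i]
  exact ⟨fun h => R.region.trans h (g.region_v j hj),
    fun h => R.region.trans h (R.region.symm (g.region_v j hj))⟩

theorem card_regions [Finite R₁.Dart] :
    Nat.card (Quotient R.region) = Nat.card (Quotient R₁.region) + 1 := by
  have := g.finite
  rw [← Finite.card_option]
  symm
  refine Nat.card_congr (Equiv.ofBijective (fun o : Option (Quotient R₁.region) => o.elim
    (Quotient.mk R.region (g.u 0))
    (Quotient.map' (s₁ := R₁.region) (s₂ := R.region) g.i fun _ _ h => (g.region_i _ _).2 h))
    ⟨?_, ?_⟩)
  · rintro (_ | q) (_ | q') h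
    · rfl
    · induction q' using Quotient.inductionOn with
      | _ x => exact absurd (Quotient.exact h) (g.region_ne x)
    · induction q using Quotient.inductionOn with
      | _ x => exact absurd (Quotient.exact h.symm) (g.region_ne x)
    · induction q using Quotient.inductionOn with
      | _ x =>
      induction q' using Quotient.inductionOn with
      | _ y =>
        congr 1
        exact Quotient.sound ((g.region_i _ _).1 (Quotient.exact h))
  · intro q
    induction q using Quotient.inductionOn with
    | _ d =>
      rcases g.cover d with ⟨d₁, rfl⟩ | ⟨j, hj, rfl⟩ | ⟨j, hj, rfl⟩
      · exact ⟨some (Quotient.mk _ d₁), rfl⟩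
      · exact ⟨none, Quotient.sound (R.region.symm (g.region_u j hj))⟩
      · exact ⟨some (Quotient.mk _ (R₁.pt (k + j))),
          Quotient.sound (R.region.symm (g.region_v j hj))⟩

theorem not_infty_i [Finite R.Dart] {d : R₁.Dart} (hd : ¬ R₁.next.SameCycle R₁.base d) :
    ¬ R.next.SameCycle R.base (g.i d) := by
  intro h
  obtain ⟨m, hm, he⟩ := R.sameCycle_iff.1 h
  rcases g.pt_cases hm.le with ⟨-, h'⟩ | ⟨-, h'⟩ | ⟨-, h'⟩ | ⟨l, -, -, -, h'⟩ <;>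
    rw [h'] at he
  · exact hd (g.i_inj he ▸ R₁.sameCycle_pt _)
  · exact g.u_ne _ (by omega) _ he
  · exact g.v_ne _ le_rfl _ he
  · exact hd (g.i_inj he ▸ R₁.sameCycle_pt _)

theorem infty_i [Finite R₁.Dart] {d : R₁.Dart} (hd : R₁.next.SameCycle R₁.base d)
    (hne : ∀ j < b, d ≠ R₁.pt (k + j + 1)) : R.next.SameCycle R.base (g.i d) := by
  obtain ⟨m, hm, rfl⟩ := R₁.sameCycle_iff.1 hd
  rcases Nat.lt_or_ge k m with h | h
  · have : k + b < m := by
      by_contra hc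
      exact hne (m - k - 1) (by omega) (by congr 1; omega)
    rw [← g.pt_of_gt' this hm.le]
    exact R.sameCycle_pt _
  · rw [← g.pt_of_le h]
    exact R.sameCycle_pt _

theorem infty_u : R.next.SameCycle R.base (g.u 0) := g.pt_u ▸ R.sameCycle_pt _

theorem infty_v : R.next.SameCycle R.base (g.v b) := g.pt_v ▸ R.sameCycle_pt _

theorem vertex_leg {j : ℕ} (hj : j < b) : R.next (g.i (R₁.pt (k + j + 1))) = g.u (j + 1) :=
  g.next_pt (j + 1) hj

/-- Attaching a strip preserves the axioms. -/
theorem good (h : R₁.Good) : R.Good := by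
  have := h.finite
  have hfin := g.finite
  have hlt := g.lt
  refine ⟨hfin, ?_, ?_, ?_, ?_, ?_, ?_, ?_, ?_⟩
  · intro d
    rcases g.cover d with ⟨d₁, rfl⟩ | ⟨j, hj, rfl⟩ | ⟨j, hj, rfl⟩
    · rw [g.opp_i, g.opp_i, h.opp_opp]
    · rw [g.opp_u j hj, g.opp_v j hj]
    · rw [g.opp_v j hj, g.opp_u j hj]
  · intro d
    rw [g.base]
    rcases g.cover d with ⟨d₁, rfl⟩ | ⟨j, hj, rfl⟩ | ⟨j, hj, rfl⟩
    · rw [g.opp_i, g.i_inj.eq_iff, g.i_inj.eq_iff, h.opp_eq_self]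
    · rw [g.opp_u j hj]
      exact iff_of_false (fun h => g.u_ne_v _ hj _ hj h.symm) (g.u_ne _ hj _)
    · rw [g.opp_v j hj]
      exact iff_of_false (fun h => g.u_ne_v _ hj _ hj h) (g.v_ne _ hj _)
  · intro d hd
    rcases g.cover d with ⟨d₁, rfl⟩ | ⟨j, hj, rfl⟩ | ⟨j, hj, rfl⟩
    · rw [g.opp_i, g.out_i, g.out_i, h.out_opp]
      rintro rfl
      exact hd g.base.symm
    · rw [g.opp_u j hj, g.out_uv j hj]
    · rw [g.opp_v j hj, g.out_uv j hj, Bool.not_not]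
  · rw [g.base, g.out_i, h.out_base]
  · intro d hd
    rcases g.cover d with ⟨d₁, rfl⟩ | ⟨j, hj, rfl⟩ | ⟨j, hj, rfl⟩
    · by_cases hl : ∃ j < b, d₁ = R₁.pt (k + j + 1)
      · obtain ⟨j, hj, rfl⟩ := hl
        rw [g.vertex_leg hj, g.next_u j hj, g.next_v j hj.le]
        exact ⟨g.u_ne _ hj _, rfl, by rw [g.out_u j hj, g.out_i]⟩
      · push Not at hl
        have h0 : ¬ R₁.next.SameCycle R₁.base d₁ := fun h' => hd (g.infty_i h' hl)
        have hne : ∀ d', ¬ R₁.next.SameCycle R₁.base d' → R.next (g.i d') = g.i (R₁.next d') :=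
          fun d' hd' => g.next_i d' fun j _ he => hd' (he ▸ R₁.sameCycle_pt _)
        have h1 : ¬ R₁.next.SameCycle R₁.base (R₁.next d₁) := by
          rwa [Equiv.Perm.sameCycle_apply_right]
        have h2 : ¬ R₁.next.SameCycle R₁.base (R₁.next (R₁.next d₁)) := by
          rwa [Equiv.Perm.sameCycle_apply_right]
        rw [hne _ h0, hne _ h1, hne _ h2, g.out_i, g.out_i]
        obtain ⟨k1, k2, k3⟩ := h.vertex _ h0
        exact ⟨fun he => k1 (g.i_inj he), by rw [k2], k3⟩
    · cases j with
      | zero => exact absurd g.infty_u hd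
      | succ j =>
        rw [g.next_u j hj, g.next_v j (by omega), g.vertex_leg hj]
        exact ⟨fun he => g.u_ne_v _ hj _ (by omega) he.symm, rfl,
          by rw [g.out_u j hj, g.out_v j hj]⟩
    · rcases hj.eq_or_lt with rfl | hj'
      · exact absurd g.infty_v hd
      · rw [g.next_v j hj, g.vertex_leg hj', g.next_u j hj']
        exact ⟨fun he => g.v_ne _ hj _ he.symm, rfl, by rw [g.out_i, g.out_v j hj']⟩
  · intro d
    rcases g.cover d with ⟨d₁, rfl⟩ | ⟨j, hj, rfl⟩ | ⟨j, hj, rfl⟩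
    · by_cases hl : ∃ j ≤ b, d₁ = R₁.pt (k + j)
      · obtain ⟨j, hj, rfl⟩ := hl
        rw [g.next_pt j hj, g.opp_u j hj]
        exact R.region.symm (g.region_v j hj)
      · push Not at hl
        rw [g.next_i _ hl, g.opp_i, g.region_i]
        exact h.keep _
    · cases j with
      | zero =>
        rw [g.next_u_zero, g.opp_v b le_rfl]
        exact R.region.symm (g.region_u b le_rfl)
      | succ j =>
        rw [g.next_u j hj, g.opp_v j (by omega)]
        exact R.region.trans (g.region_u _ hj) (R.region.symm (g.region_u _ (by omega)))
    · rw [g.next_v j hj, g.opp_i]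
      refine R.region.trans (g.region_v j hj) ?_
      refine (g.region_i _ _).2 ?_
      rw [← R₁.next_pt]
      exact h.keep _
  · intro s hs1 hs2
    have hi : ∀ d d', s (g.i d) (g.i d') := by
      intro d d'
      refine h.conn (s.comap g.i) (fun d => ?_) (fun d => ?_) d d'
      · show s (g.i d) (g.i (R₁.next d))
        by_cases hl : ∃ j ≤ b, d = R₁.pt (k + j)
        · obtain ⟨j, hj, rfl⟩ := hl
          have h1 := hs1 (g.i (R₁.pt (k + j)))
          have h2 := hs2 (g.u j)
          have h3 := hs1 (g.v j)
          rw [g.next_pt j hj] at h1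
          rw [g.opp_u j hj] at h2
          rw [g.next_v j hj, ← R₁.next_pt] at h3
          exact s.trans h1 (s.trans h2 h3)
        · push Not at hl
          rw [← g.next_i _ hl]
          exact hs1 _
      · show s (g.i d) (g.i (R₁.opp d))
        rw [← g.opp_i]
        exact hs2 _
    have hb : ∀ d, s d (g.i R₁.base) := by
      intro d
      rcases g.cover d with ⟨d₁, rfl⟩ | ⟨j, hj, rfl⟩ | ⟨j, hj, rfl⟩
      · exact hi _ _
      · have h1 := hs1 (g.i (R₁.pt (k + j)))
        rw [g.next_pt j hj] at h1
        exact s.trans (s.symm h1) (hi _ _)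
      · have h3 := hs1 (g.v j)
        rw [g.next_v j hj] at h3
        exact s.trans h3 (hi _ _)
    exact fun d d' => s.trans (hb d) (s.symm (hb d'))
  · have h1 := g.card
    have h2 := g.card_regions
    have h3 := g.period
    have h4 := h.count
    omega

/-- Removing a strip preserves the axioms. -/
theorem good_left (h : R.Good) : R₁.Good := by
  have hfin := h.finite
  have := g.finite_left
  have hlt := g.lt
  have hgen : ∀ d, ¬ R₁.next.SameCycle R₁.base d → R.next (g.i d) = g.i (R₁.next d) :=
    fun d hd => g.next_i d fun j _ he => hd (he ▸ R₁.sameCycle_pt _)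
  refine ⟨inferInstance, ?_, ?_, ?_, ?_, ?_, ?_, ?_, ?_⟩
  · intro d
    apply g.i_inj
    rw [← g.opp_i, ← g.opp_i, h.opp_opp]
  · intro d
    rw [← g.i_inj.eq_iff, ← g.opp_i, h.opp_eq_self, g.base, g.i_inj.eq_iff]
  · intro d hd
    rw [← g.out_i, ← g.opp_i, h.out_opp, g.out_i]
    rw [g.base]
    exact fun he => hd (g.i_inj he)
  · rw [← g.out_i, ← g.base, h.out_base]
  · intro d hd
    have h1 : ¬ R₁.next.SameCycle R₁.base (R₁.next d) := by
      rwa [Equiv.Perm.sameCycle_apply_right]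
    have h2 : ¬ R₁.next.SameCycle R₁.base (R₁.next (R₁.next d)) := by
      rwa [Equiv.Perm.sameCycle_apply_right]
    have := h.vertex _ (g.not_infty_i hd)
    rw [hgen _ hd, hgen _ h1, hgen _ h2, g.out_i, g.out_i] at this
    exact ⟨fun he => this.1 (by rw [he]), g.i_inj this.2.1, this.2.2⟩
  · intro d
    rw [← g.region_i, ← g.opp_i]
    by_cases hl : ∃ j ≤ b, d = R₁.pt (k + j)
    · obtain ⟨j, hj, rfl⟩ := hl
      rw [R₁.next_pt, ← g.next_v j hj]
      exact R.region.trans (R.region.symm (g.region_v j hj)) (h.keep _)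
    · push Not at hl
      rw [← g.next_i _ hl]
      exact h.keep _
  · intro s hs1 hs2
    classical
    have hpt : ∀ m, s (R₁.pt m) R₁.base := by
      intro m
      induction m with
      | zero => exact s.refl _
      | succ m ih => rw [← R₁.next_pt]; exact s.trans (s.symm (hs1 _)) ih
    -- at `∞` are related anyway
    let r : R.Dart → R₁.Dart := fun d => if hd : ∃ d₁, g.i d₁ = d then hd.choose else R₁.base
    have ri : ∀ d, r (g.i d) = d := fun d => by
      have hd : ∃ d₁, g.i d₁ = g.i d := ⟨d, rfl⟩
      simp only [r, dif_pos hd]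
      exact g.i_inj hd.choose_spec
    have ru : ∀ j ≤ b, r (g.u j) = R₁.base := fun j hj => by
      have hd : ¬ ∃ d₁, g.i d₁ = g.u j := fun ⟨d, hd⟩ => g.u_ne j hj d hd.symm
      simp only [r, dif_neg hd]
    have rv : ∀ j ≤ b, r (g.v j) = R₁.base := fun j hj => by
      have hd : ¬ ∃ d₁, g.i d₁ = g.v j := fun ⟨d, hd⟩ => g.v_ne j hj d hd.symm
      simp only [r, dif_neg hd]
    have key := h.conn (s.comap r) ?_ ?_
    · intro d d'
      have : s (r (g.i d)) (r (g.i d')) := key (g.i d) (g.i d')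
      rwa [ri, ri] at this
    · intro d
      show s (r d) (r (R.next d))
      rcases g.cover d with ⟨d₁, rfl⟩ | ⟨j, hj, rfl⟩ | ⟨j, hj, rfl⟩
      · by_cases hl : ∃ j ≤ b, d₁ = R₁.pt (k + j)
        · obtain ⟨j, hj, rfl⟩ := hl
          rw [g.next_pt j hj, ri, ru j hj]
          exact hpt _
        · push Not at hl
          rw [g.next_i _ hl, ri, ri]
          exact hs1 _
      · cases j with
        | zero => rw [g.next_u_zero, ru _ hj, rv _ le_rfl]
        | succ j => rw [g.next_u j hj, ru _ hj, rv _ (by omega)]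
      · rw [g.next_v j hj, rv _ hj, ri]
        exact s.symm (hpt _)
    · intro d
      show s (r d) (r (R.opp d))
      rcases g.cover d with ⟨d₁, rfl⟩ | ⟨j, hj, rfl⟩ | ⟨j, hj, rfl⟩
      · rw [g.opp_i, ri, ri]
        exact hs2 _
      · rw [g.opp_u j hj, ru _ hj, rv _ hj]
      · rw [g.opp_v j hj, ru _ hj, rv _ hj]
  · have h1 := g.card
    have h2 := g.card_regions
    have h3 := g.period
    have h4 := h.count
    omega

end Glue

/-! ### Existence and removal of strips -/

namespace Raw

variable {b k : ℕ}

/-- A strip can be attached whenever the orientations at its vertices agree; `σ j` is the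
orientation of the left half-edge of the `j`-th edge. -/
theorem exists_glue (R₁ : Raw) [Finite R₁.Dart] (hlt : k + b < R₁.period) (σ : ℕ → Bool)
    (h1 : ∀ j < b, (!σ j) = R₁.out (R₁.pt (k + j + 1)))
    (h2 : ∀ j < b, σ (j + 1) = R₁.out (R₁.pt (k + j + 1))) :
    ∃ (R : Raw) (g : Glue b k R₁ R), R.out (g.u 0) = σ 0 := by
  classical
  let D := R₁.Dart ⊕ (Fin (b + 1) ⊕ Fin (b + 1))
  let u : ℕ → D := fun j => .inr (.inl (Fin.ofNat (b + 1) j))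
  let v : ℕ → D := fun j => .inr (.inr (Fin.ofNat (b + 1) j))
  have hval : ∀ j ≤ b, (Fin.ofNat (b + 1) j : ℕ) = j := fun j hj => Nat.mod_eq_of_lt (by omega)
  let f : D → D := fun x => match x with
    | .inl d => if h : ∃ j ≤ b, d = R₁.pt (k + j) then u h.choose else .inl (R₁.next d)
    | .inr (.inl j) => if (j : ℕ) = 0 then v b else v (j - 1)
    | .inr (.inr j) => .inl (R₁.pt (k + j + 1))
  have fpt : ∀ j ≤ b, f (.inl (R₁.pt (k + j))) = u j := by
    intro j hj
    have h : ∃ l ≤ b, R₁.pt (k + j) = R₁.pt (k + l) := ⟨j, hj, rfl⟩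
    have hc : h.choose = j := by
      have := R₁.pt_inj (by have := h.choose_spec.1; omega) (by omega) h.choose_spec.2.symm
      omega
    simp only [f, dif_pos h, hc]
  have fi : ∀ d, (∀ j ≤ b, d ≠ R₁.pt (k + j)) → f (.inl d) = .inl (R₁.next d) := by
    intro d hd
    have h : ¬ ∃ j ≤ b, d = R₁.pt (k + j) := by push Not; exact hd
    simp only [f, dif_neg h]
  have fu : ∀ j < b, f (u (j + 1)) = v j := by
    intro j hj
    simp only [f, u, hval _ (show j + 1 ≤ b from hj)]
    simp
  have fu0 : f (u 0) = v b := by simp [f, u]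
  have fv : ∀ j ≤ b, f (v j) = .inl (R₁.pt (k + j + 1)) := by
    intro j hj
    simp only [f, v, hval _ hj]
  have hu : ∀ j : Fin (b + 1), (.inr (.inl j) : D) = u j := fun j => by
    simp only [u]; congr 2; exact Fin.ext (hval j (by omega)).symm
  have hv : ∀ j : Fin (b + 1), (.inr (.inr j) : D) = v j := fun j => by
    simp only [v]; congr 2; exact Fin.ext (hval j (by omega)).symm
  have hsurj : Function.Surjective f := by
    rintro (d | j | j)
    · obtain ⟨d', rfl⟩ := R₁.next.surjective d
      by_cases h : ∃ j ≤ b, d' = R₁.pt (k + j)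
      · obtain ⟨j, hj, rfl⟩ := h
        exact ⟨v j, by rw [fv j hj, next_pt]⟩
      · push Not at h
        exact ⟨.inl d', fi d' h⟩
    · exact ⟨.inl (R₁.pt (k + j)), (fpt j (by omega)).trans (hu j).symm⟩
    · rw [hv]
      rcases Nat.lt_or_ge j b with h | h
      · exact ⟨u (j + 1), fu j h⟩
      · obtain h : (j : ℕ) = b := by omega
        rw [h]
        exact ⟨u 0, fu0⟩
  have hD : Finite D := inferInstanceAs (Finite (R₁.Dart ⊕ (Fin (b + 1) ⊕ Fin (b + 1))))
  -- the region of a half-edge, `none` for the new region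
  let ρ : D → Option (Quotient R₁.region) := fun x => match x with
    | .inl d => some (Quotient.mk _ d)
    | .inr (.inl _) => none
    | .inr (.inr j) => some (Quotient.mk _ (R₁.pt (k + j)))
  let o : D → Bool := fun x => match x with
    | .inl d => R₁.out d
    | .inr (.inl j) => σ j
    | .inr (.inr j) => !σ j
  let R : Raw :=
    { Dart := D
      next := Equiv.ofBijective f ⟨Finite.injective_iff_surjective.2 hsurj, hsurj⟩
      opp := Equiv.sumCongr R₁.opp (Equiv.sumComm _ _)
      base := .inl R₁.base
      out := o
      region := Setoid.ker ρ }
  refine ⟨R,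
    { i := Sum.inl
      u := u
      v := v
      lt := hlt
      i_inj := Sum.inl_injective
      cover := ?_
      u_ne := fun j _ d h => by cases h
      v_ne := fun j _ d h => by cases h
      u_inj := ?_
      v_inj := ?_
      u_ne_v := fun j _ l _ h => by cases h
      base := rfl
      opp_i := fun d => rfl
      opp_u := fun j _ => rfl
      opp_v := fun j _ => rfl
      next_i := fi
      next_pt := fpt
      next_v := fv
      next_u := fu
      next_u_zero := fu0
      out_i := fun d => rfl
      out_v := ?_
      out_u := ?_
      out_uv := fun j _ => rfl
      region_i := fun d d' => ?_
      region_u := fun j _ => rfl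
      region_v := ?_
      region_ne := fun d h => by cases h }, ?_⟩
  · rintro (d | j | j)
    · exact Or.inl ⟨d, rfl⟩
    · exact Or.inr (Or.inl ⟨j, by omega, (hu j).symm⟩)
    · exact Or.inr (Or.inr ⟨j, by omega, (hv j).symm⟩)
  · intro j hj l hl h
    have := congrArg Fin.val (Sum.inl_injective (Sum.inr_injective h))
    rwa [hval _ hj, hval _ hl] at this
  · intro j hj l hl h
    have := congrArg Fin.val (Sum.inr_injective (Sum.inr_injective h))
    rwa [hval _ hj, hval _ hl] at this
  · intro j hj
    rw [← h1 j hj]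
    simp only [R, o, v, hval _ hj.le]
  · intro j hj
    rw [← h2 j hj]
    simp only [R, o, u, hval _ (show j + 1 ≤ b from hj)]
  · show some (Quotient.mk R₁.region d) = some (Quotient.mk R₁.region d') ↔ _
    rw [Option.some_inj]
    exact ⟨fun h => Quotient.exact h, fun h => Quotient.sound h⟩
  · intro j hj
    show some (Quotient.mk R₁.region (R₁.pt (k + (Fin.ofNat (b + 1) j : ℕ)))) = _
    rw [hval j hj]
  · simp [R, o, u]

theorem Good.next_ne_self {R : Raw} (h : R.Good) (hp : 1 < R.period) (d : R.Dart) :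
    R.next d ≠ d := by
  have := h.finite
  by_cases hd : R.next.SameCycle R.base d
  · obtain ⟨j, hj, rfl⟩ := R.sameCycle_iff.1 hd
    rw [next_pt]
    intro he
    rcases Nat.lt_or_ge (j + 1) R.period with h1 | h1
    · have := R.pt_inj h1 hj he
      omega
    · obtain h2 : j + 1 = R.period := by omega
      rw [h2, pt_period] at he
      have := R.pt_inj (i := 0) (by omega) hj he
      omega
  · exact h.next_ne hd

/-- A cap is the region above a strip, and this strip can be removed: its edges are those of the
sides `u j` of the cap, and the half-edges at the legs become endpoints. -/
theorem Good.exists_glue_of_cap {R : Raw} (h : R.Good) (hb : b ≤ 2) (hc : R.Cap b k) :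
    ∃ R₁, Nonempty (Glue b k R₁ R) := by
  classical
  have hfin := h.finite
  obtain ⟨hk, hcard, huniq⟩ := hc
  set P := R.pt (k + 1) with hP
  have hper : Function.minimalPeriod R.turn P = b + 1 := by
    rw [← card_sameCycle, ← hcard]
    simp only [h.region_iff]
  let N : R.Dart → Prop := fun d => R.region P d
  -- the walk along the sides of the cap runs through `u 0 = P`, `u b`, …, `u 1`
  let u : ℕ → R.Dart := fun j => R.turn ((R.turn ^ (b - j)) P)
  have u0 : u 0 = P := by
    have := Function.isPeriodicPt_minimalPeriod R.turn P
    rw [hper] at this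
    simp only [u, Nat.sub_zero]
    rw [← Equiv.Perm.mul_apply, ← pow_succ', ← Equiv.Perm.iterate_eq_pow]
    exact this
  have turn_u : ∀ j < b, R.turn (u (j + 1)) = u j := by
    intro j hj
    simp only [u]
    rw [← Equiv.Perm.mul_apply R.turn (R.turn ^ (b - (j + 1))), ← pow_succ']
    congr 3
    omega
  have turn_u0 : R.turn (u 0) = u b := by
    rw [u0]
    simp [u]
  have hNu : ∀ j, N (u j) := fun j => h.region_iff.2 ⟨(b - j + 1 : ℕ), by
    rw [zpow_natCast, pow_succ', Equiv.Perm.mul_apply]⟩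
  have hN : ∀ d, N d → ∃ j ≤ b, u j = d := by
    intro d hd
    obtain ⟨m, hm, rfl⟩ := sameCycle_iff_exists_lt.1 (h.region_iff.1 hd)
    rw [hper] at hm
    rcases Nat.eq_zero_or_pos m with rfl | hm0
    · exact ⟨0, by omega, u0⟩
    · obtain ⟨l, rfl⟩ : ∃ l, m = l + 1 := ⟨m - 1, by omega⟩
      refine ⟨b - l, by omega, ?_⟩
      simp only [u]
      rw [pow_succ', Equiv.Perm.mul_apply]
      congr 3
      omega
  have u_inj : ∀ j ≤ b, ∀ l ≤ b, u j = u l → j = l := by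
    intro j hj l hl he
    have he' := R.turn.injective he
    simp only [← Equiv.Perm.iterate_eq_pow] at he'
    have := Function.iterate_injOn_Iio_minimalPeriod (f := R.turn) (x := P)
      (show b - j < _ by omega) (show b - l < _ by omega) he'
    omega
  have hNbase : ¬ N R.base := fun hd => by
    have := huniq 0 (by omega) hd
    omega
  -- the new region lies on one side of each of its edges only
  have hdisj : ∀ d, N d → ¬ N (R.opp d) := by
    intro d hd hd'
    obtain ⟨m, hm, he⟩ := sameCycle_iff_exists_lt.1
      (h.region_iff.1 (R.region.trans (R.region.symm hd) hd'))
    have hper' : Function.minimalPeriod R.turn d = b + 1 := by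
      rw [← hper, ← card_sameCycle, ← card_sameCycle]
      have hd1 := h.region_iff.1 hd
      simp only [show ∀ y, R.turn.SameCycle d y ↔ R.turn.SameCycle P y from
        fun y => ⟨hd1.trans, hd1.symm.trans⟩]
    have hiter := Function.isPeriodicPt_minimalPeriod R.turn d
    rw [hper'] at hm hiter
    obtain rfl | rfl | rfl : m = 0 ∨ m = 1 ∨ m = 2 := by omega
    · exact hNbase ((h.opp_eq_self d).1 he.symm ▸ hd)
    · rw [pow_one, turn_apply] at he
      exact h.next_ne_self (by omega) _ (R.opp.injective he)
    · obtain rfl : b = 2 := by omega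
      have h3 : R.turn (R.opp d) = d := by rw [← he]; exact hiter
      rw [turn_apply] at h3
      apply h.next_ne_self (by omega) (R.opp d)
      apply R.opp.injective
      rw [h3, h.opp_opp]
  have hNturn : ∀ d, N (R.turn d) ↔ N d := fun d =>
    ⟨fun hd => R.region.trans hd (R.region.symm (h.keep d)), fun hd => R.region.trans hd (h.keep d)⟩
  have next_u : ∀ j < b, R.next (u (j + 1)) = R.opp (u j) := by
    intro j hj
    rw [← turn_u j hj, turn_apply, h.opp_opp]
  have next_u0 : R.next (u 0) = R.opp (u b) := by
    rw [← turn_u0, turn_apply, h.opp_opp]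
  have u_ninf : ∀ j < b, ¬ R.next.SameCycle R.base (u (j + 1)) := by
    intro j hj hs
    obtain ⟨m, hm, he⟩ := R.sameCycle_iff.1 hs
    have h1 := huniq m hm (he ▸ hNu _)
    rw [h1, ← hP, ← u0] at he
    have := u_inj _ (by omega) _ (by omega) he
    omega
  have v_ninf : ∀ j < b, ¬ R.next.SameCycle R.base (R.opp (u j)) := by
    intro j hj
    rw [← next_u j hj, Equiv.Perm.sameCycle_apply_right]
    exact u_ninf j hj
  have next_leg : ∀ j < b, R.next (R.next (R.opp (u j))) = u (j + 1) := by
    intro j hj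
    rw [← next_u j hj, (h.vertex _ (u_ninf j hj)).2.1]
  -- the half-edges of the remaining edges; `next` skips the strip
  let Old : R.Dart → Prop := fun d => ¬ N d ∧ ¬ N (R.opp d)
  have hfold : ∀ d : Subtype Old,
      Old (if N (R.next d) then R.next (R.opp (R.next d)) else R.next d) := by
    rintro ⟨d, hd1, hd2⟩
    split_ifs with hn
    · obtain ⟨l, hl, he⟩ := hN _ hn
      simp only at he
      simp only
      rw [← he]
      refine ⟨fun hw => ?_, fun hw => ?_⟩
      · rcases hl.eq_or_lt with rfl | hl
        · rw [← next_u0, u0, hP, next_pt, next_pt] at hw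
          rcases Nat.lt_or_ge (k + 1 + 1 + 1) R.period with h1 | h1
          · have := huniq _ h1 hw
            omega
          · obtain h2 : k + 1 + 1 + 1 = R.period := by omega
            rw [h2, pt_period] at hw
            exact hNbase hw
        · refine hdisj _ ((hNturn _).2 hw) ?_
          rw [turn_apply, h.opp_opp, next_leg l hl]
          exact hNu _
      · exact hdisj _ (hNu l) ((hNturn _).1 hw)
    · exact ⟨hn, fun hw => hd1 ((hNturn d).1 hw)⟩
  let f : Subtype Old → Subtype Old := fun d => ⟨_, hfold d⟩
  have hfinj : Function.Injective f := by
    rintro ⟨d, hd⟩ ⟨d', hd'⟩ he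
    have he := congrArg Subtype.val he
    simp only [f] at he
    apply Subtype.ext
    simp only
    split_ifs at he with h1 h2 h2
    · exact R.next.injective (R.opp.injective (R.next.injective he))
    · exact absurd (by rw [← R.next.injective he, h.opp_opp]; exact h1) hd'.2
    · exact absurd (by rw [R.next.injective he, h.opp_opp]; exact h2) hd.2
    · exact R.next.injective he
  have hOldopp : ∀ d, Old (R.opp d) ↔ Old d := fun d => by
    simp only [Old, h.opp_opp]
    exact and_comm
  have hOldbase : Old R.base := ⟨hNbase, by rw [h.opp_base]; exact hNbase⟩
  let R₁ : Raw :=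
    { Dart := Subtype Old
      next := Equiv.ofBijective f (Finite.injective_iff_bijective.1 hfinj)
      opp := R.opp.subtypePerm hOldopp
      base := ⟨R.base, hOldbase⟩
      out := fun d => R.out d
      region := R.region.comap Subtype.val }
  have hnext : ∀ d : Subtype Old, ((R₁.next d : Subtype Old) : R.Dart) =
      if N (R.next d) then R.next (R.opp (R.next d)) else R.next d := fun d => rfl
  have pt_le : ∀ j ≤ k, ((R₁.pt j : Subtype Old) : R.Dart) = R.pt j := by
    intro j hj
    induction j with
    | zero => rfl
    | succ j ih =>
      rw [← next_pt, hnext, ih (by omega), if_neg, next_pt]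
      rw [next_pt]
      intro hw
      have := huniq (j + 1) (by omega) hw
      omega
  have pt_leg : ∀ j ≤ b, ((R₁.pt (k + j + 1) : Subtype Old) : R.Dart) = R.next (R.opp (u j)) := by
    intro j hj
    induction j with
    | zero =>
      rw [← next_pt, hnext, pt_le k le_rfl, next_pt, if_pos (R.region.refl _), ← hP, u0]
    | succ j ih =>
      rw [← next_pt, hnext, ← add_assoc, ih (by omega), next_leg j hj, if_pos (hNu _)]
  have next_old : ∀ j ≤ b, R.next ((R₁.pt (k + j) : Subtype Old) : R.Dart) = u j := by
    intro j hj
    cases j with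
    | zero => rw [add_zero, pt_le k le_rfl, next_pt, u0]
    | succ j => rw [← add_assoc, pt_leg j (by omega), next_leg j hj]
  have hfin₁ : Finite R₁.Dart := inferInstanceAs (Finite (Subtype Old))
  refine ⟨R₁, ⟨
    { i := Subtype.val
      u := u
      v := fun j => R.opp (u j)
      lt := ?_
      i_inj := Subtype.val_injective
      cover := ?_
      u_ne := fun j _ d he => d.2.1 (he ▸ hNu j)
      v_ne := fun j _ d he => d.2.2 (he ▸ (h.opp_opp (u j)).symm ▸ hNu j)
      u_inj := u_inj
      v_inj := fun j hj l hl he => u_inj j hj l hl (R.opp.injective he)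
      u_ne_v := fun j _ l _ he => hdisj _ (hNu l) (he ▸ hNu j)
      base := rfl
      opp_i := fun d => rfl
      opp_u := fun j _ => rfl
      opp_v := fun j _ => h.opp_opp _
      next_i := ?_
      next_pt := next_old
      next_v := fun j hj => (pt_leg j hj).symm
      next_u := next_u
      next_u_zero := next_u0
      out_i := fun d => rfl
      out_v := ?_
      out_u := ?_
      out_uv := fun j _ => h.out_opp _ fun he => hNbase (he ▸ hNu j)
      region_i := fun d d' => Iff.rfl
      region_u := fun j _ => R.region.trans (R.region.symm (hNu j)) (hNu 0)
      region_v := ?_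
      region_ne := fun d hd => d.2.1 (R.region.trans (hNu 0) hd) }⟩⟩
  ·
    by_contra hle
    rw [not_lt] at hle
    have hpos := R₁.period_pos
    have hbase := congrArg Subtype.val R₁.pt_period
    change _ = R.base at hbase
    rcases Nat.lt_or_ge k R₁.period with h1 | h1
    · obtain ⟨j, hj⟩ : ∃ j, R₁.period = k + j + 1 := ⟨R₁.period - k - 1, by omega⟩
      rw [hj, pt_leg j (by omega)] at hbase
      refine u_ninf j (by omega) ?_
      rw [← next_leg j (by omega), hbase, Equiv.Perm.sameCycle_apply_right]
    · rw [pt_le _ h1] at hbase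
      exact pt_ne_base hpos (by omega) hbase
  · intro d
    by_cases h1 : N d
    · exact Or.inr (Or.inl (hN d h1))
    · by_cases h2 : N (R.opp d)
      · obtain ⟨j, hj, he⟩ := hN _ h2
        exact Or.inr (Or.inr ⟨j, hj, by rw [he, h.opp_opp]⟩)
      · exact Or.inl ⟨⟨d, h1, h2⟩, rfl⟩
  · intro d hd
    rw [hnext, if_neg]
    intro hn
    obtain ⟨j, hj, he⟩ := hN _ hn
    exact hd j hj (Subtype.ext (R.next.injective (he.symm.trans (next_old j hj).symm)))
  · intro j hj
    change _ = R.out ((R₁.pt (k + j + 1) : Subtype Old) : R.Dart)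
    rw [pt_leg j hj.le, (h.vertex _ (v_ninf j hj)).2.2]
  · intro j hj
    change _ = R.out ((R₁.pt (k + j + 1) : Subtype Old) : R.Dart)
    rw [pt_leg j hj.le, (h.vertex _ (v_ninf j hj)).2.2, ← next_u j hj,
      (h.vertex _ (u_ninf j hj)).2.2]
  · intro j hj
    have := h.keep (R₁.pt (k + j) : Subtype Old)
    rw [next_old j hj] at this
    exact R.region.symm this

end Raw

/-! ### Attached pieces as strips -/

/-- In a web the orientations and the regions at the new half-edges are determined by the rest. -/
def Web.glueOfCore {b k : ℕ} {W₁ W : Web} (i : W₁.Dart → W.Dart) (u v : ℕ → W.Dart)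
    (lt : k + b < W₁.raw.period) (i_inj : Function.Injective i)
    (cover : ∀ d, (∃ d₁, i d₁ = d) ∨ (∃ j ≤ b, u j = d) ∨ ∃ j ≤ b, v j = d)
    (u_ne : ∀ j ≤ b, ∀ d, u j ≠ i d) (v_ne : ∀ j ≤ b, ∀ d, v j ≠ i d)
    (u_inj : ∀ j ≤ b, ∀ l ≤ b, u j = u l → j = l) (v_inj : ∀ j ≤ b, ∀ l ≤ b, v j = v l → j = l)
    (u_ne_v : ∀ j ≤ b, ∀ l ≤ b, u j ≠ v l) (base : W.base = i W₁.base)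
    (opp_i : ∀ d, W.opp (i d) = i (W₁.opp d)) (opp_u : ∀ j ≤ b, W.opp (u j) = v j)
    (next_i : ∀ d, (∀ j ≤ b, d ≠ W₁.pt (k + j)) → W.next (i d) = i (W₁.next d))
    (next_pt : ∀ j ≤ b, W.next (i (W₁.pt (k + j))) = u j)
    (next_v : ∀ j ≤ b, W.next (v j) = i (W₁.pt (k + j + 1)))
    (next_u : ∀ j < b, W.next (u (j + 1)) = v j) (next_u_zero : W.next (u 0) = v b)
    (out_i : ∀ d, W.out (i d) = W₁.out d)
    (region_i : ∀ d d', W.region (i d) (i d') ↔ W₁.region d d')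
    (region_ne : ∀ d, ¬ W.region (u 0) (i d)) : Glue b k W₁.raw W.raw :=
  have key : ∀ j < b, W.out (W.next (u (j + 1))) = W.out (u (j + 1)) ∧
      W.out (W.next (v j)) = W.out (v j) := by
    intro j hj
    have h1 := next_u j hj
    have h2 := next_v j hj.le
    have h3 := next_pt (j + 1) hj
    rw [← add_assoc] at h3
    have hmem : ∀ y, W.next.SameCycle (u (j + 1)) y →
        y = u (j + 1) ∨ y = v j ∨ y = i (W₁.pt (k + j + 1)) := by
      rintro y hy
      have := W.finite
      have h4 : W.next (u (j + 1)) ≠ u (j + 1) := by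
        rw [h1]; exact fun h => u_ne_v _ hj _ hj.le h.symm
      have h5 := card_sameCycle_three h4 (by rw [h1, h2, h3])
      obtain ⟨m, hm, rfl⟩ := sameCycle_iff_exists_lt.1 hy
      rw [← card_sameCycle, h5] at hm
      obtain rfl | rfl | rfl : m = 0 ∨ m = 1 ∨ m = 2 := by omega
      · exact Or.inl rfl
      · exact Or.inr (Or.inl h1)
      · refine Or.inr (Or.inr ?_)
        rw [pow_two, Equiv.Perm.mul_apply, h1, h2]
    have hninf : ¬ W.next.SameCycle W.base (u (j + 1)) := by
      intro hs
      rcases hmem _ hs.symm with h | h | h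
      · exact u_ne _ hj _ (h.symm.trans base)
      · exact v_ne _ hj.le _ (h.symm.trans base)
      · rw [base] at h
        exact Raw.pt_ne_base (R := W₁.raw) (by omega) (by omega) (i_inj h).symm
    have hninf' : ¬ W.next.SameCycle W.base (v j) := by
      rwa [← h1, Equiv.Perm.sameCycle_apply_right]
    constructor
    · refine ((W.vertex _ hninf).resolve_right fun h => ?_).2.2
      rw [h1, opp_u _ hj] at h
      have := v_inj _ hj.le _ hj h.1
      omega
    · refine ((W.vertex _ hninf').resolve_right fun h => ?_).2.2
      rw [h2, ← opp_u _ hj.le, W.opp_opp] at h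
      exact u_ne _ hj.le _ h.1.symm
  have region_u : ∀ j ≤ b, W.region (u j) (u 0) := by
    intro j hj
    induction j with
    | zero => exact W.region.refl _
    | succ j ih =>
      refine W.region.trans ?_ (ih (by omega))
      have := W.keep (u (j + 1))
      rwa [next_u j hj, ← opp_u j (by omega), W.opp_opp] at this
  { i := i, u := u, v := v, lt := lt, i_inj := i_inj, cover := cover, u_ne := u_ne, v_ne := v_ne
    u_inj := u_inj, v_inj := v_inj, u_ne_v := u_ne_v, base := base, opp_i := opp_i
    opp_u := opp_u, opp_v := fun j hj => by rw [← opp_u j hj]; exact W.opp_opp _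
    next_i := next_i, next_pt := next_pt, next_v := next_v, next_u := next_u
    next_u_zero := next_u_zero, out_i := out_i
    out_v := fun j hj => by
      change W.out (v j) = _
      rw [← (key j hj).2, next_v j hj.le, out_i]; rfl
    out_u := fun j hj => by
      change W.out (u (j + 1)) = _
      rw [← (key j hj).1, next_u j hj, ← (key j hj).2, next_v j hj.le, out_i]; rfl
    out_uv := fun j hj => by
      change W.out (v j) = !W.out (u j)
      rw [← opp_u j hj, W.out_opp]
      exact fun h => u_ne j hj _ (h.trans base)
    region_i := region_i, region_u := region_u
    region_v := fun j hj => by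
      have := W.keep (i (W₁.pt (k + j)))
      rw [next_pt j hj, opp_u j hj] at this
      exact W.region.symm this
    region_ne := region_ne }

/-- The number of strands at the bottom of a piece. -/
def Piece.legs : Piece → ℕ
  | .H => 2
  | .Y => 1
  | .U _ => 0

theorem AttachU.glue {s : Bool} {k : ℕ} {W₁ W : Web} (h : AttachU s k W₁ W)
    (hlt : k < W₁.raw.period) :
    ∃ g : Glue 0 k W₁.raw W.raw, W.out (g.u 0) = !s := by
  obtain ⟨e, h1, h2, h3, h4, h5, h6, h7, h8, h9, h10, h11⟩ := h
  refine ⟨Web.glueOfCore (fun d => e (.inl d)) (fun _ => e (.inr 0)) (fun _ => e (.inr 1))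
    hlt ?_ ?_ ?_ ?_ ?_ ?_ ?_ h1 h2 ?_ ?_ ?_ ?_ ?_ h6 h8 h10 h11, h9⟩
  · exact e.injective.comp Sum.inl_injective
  · intro d
    obtain ⟨x | x, rfl⟩ := e.surjective d
    · exact Or.inl ⟨x, rfl⟩
    · fin_cases x
      · exact Or.inr (Or.inl ⟨0, le_rfl, rfl⟩)
      · exact Or.inr (Or.inr ⟨0, le_rfl, rfl⟩)
  · intro j _ d he; cases e.injective he
  · intro j _ d he; cases e.injective he
  · intro j hj l hl _; omega
  · intro j hj l hl _; omega
  · intro j _ l _ he; cases e.injective he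
  · intro j _; exact h3
  · intro d hd; exact h4 d (hd 0 le_rfl)
  · intro j hj; obtain rfl : j = 0 := by omega
    exact h5
  · intro j hj; obtain rfl : j = 0 := by omega
    exact h7
  · intro j hj; omega

theorem AttachY.glue {k : ℕ} {W₁ W : Web} (h : AttachY k W₁ W) (hlt : k + 1 < W₁.raw.period) :
    Nonempty (Glue 1 k W₁.raw W.raw) := by
  obtain ⟨e, h1, h2, h3, h4, h5, h6, h7, h8, h9, h10, h11, h12, h13, h14⟩ := h
  refine ⟨Web.glueOfCore (fun d => e (.inl d)) (fun j => if j = 0 then e (.inr 0) else e (.inr 3))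
    (fun j => if j = 0 then e (.inr 2) else e (.inr 1))
    hlt ?_ ?_ ?_ ?_ ?_ ?_ ?_ h1 h2 ?_ ?_ ?_ ?_ ?_ h7 h12 h13 h14⟩
  · exact e.injective.comp Sum.inl_injective
  · intro d
    obtain ⟨x | x, rfl⟩ := e.surjective d
    · exact Or.inl ⟨x, rfl⟩
    · fin_cases x
      · exact Or.inr (Or.inl ⟨0, by omega, rfl⟩)
      · exact Or.inr (Or.inr ⟨1, by omega, rfl⟩)
      · exact Or.inr (Or.inr ⟨0, by omega, rfl⟩)
      · exact Or.inr (Or.inl ⟨1, by omega, rfl⟩)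
  · intro j _ d he
    split_ifs at he <;> cases e.injective he
  · intro j _ d he
    split_ifs at he <;> cases e.injective he
  · intro j hj l hl he
    split_ifs at he <;> first | omega | cases e.injective he
  · intro j hj l hl he
    split_ifs at he <;> first | omega | cases e.injective he
  · intro j hj l hl he
    split_ifs at he <;> cases e.injective he
  · intro j hj
    interval_cases j
    · exact h3
    · exact (congrArg W.opp h4).symm.trans (W.opp_opp _)
  · intro d hd
    exact h5 d (hd 0 (by omega)) (hd 1 le_rfl)
  · intro j hj
    interval_cases j
    · exact h6
    · exact h11
  · intro j hj
    interval_cases j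
    · exact h10
    · exact h8
  · intro j hj
    obtain rfl : j = 0 := by omega
    exact h9

theorem AttachH.glue {k : ℕ} {W₁ W : Web} (h : AttachH k W₁ W) (hlt : k + 2 < W₁.raw.period) :
    Nonempty (Glue 2 k W₁.raw W.raw) := by
  obtain ⟨e, h1, h2, h3, h4, h5, h6, h7, h8, h9, h10, h11, h12, h13, h14, h15, h16, h17, h18⟩ := h
  refine ⟨Web.glueOfCore (fun d => e (.inl d))
    (fun j => if j = 0 then e (.inr 0) else if j = 1 then e (.inr 4) else e (.inr 3))
    (fun j => if j = 0 then e (.inr 2) else if j = 1 then e (.inr 5) else e (.inr 1))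
    hlt ?_ ?_ ?_ ?_ ?_ ?_ ?_ h1 h2 ?_ ?_ ?_ ?_ ?_ h8 h16 h17 h18⟩
  · exact e.injective.comp Sum.inl_injective
  · intro d
    obtain ⟨x | x, rfl⟩ := e.surjective d
    · exact Or.inl ⟨x, rfl⟩
    · fin_cases x
      · exact Or.inr (Or.inl ⟨0, by omega, rfl⟩)
      · exact Or.inr (Or.inr ⟨2, by omega, rfl⟩)
      · exact Or.inr (Or.inr ⟨0, by omega, rfl⟩)
      · exact Or.inr (Or.inl ⟨2, by omega, rfl⟩)
      · exact Or.inr (Or.inl ⟨1, by omega, rfl⟩)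
      · exact Or.inr (Or.inr ⟨1, by omega, rfl⟩)
  · intro j _ d he
    split_ifs at he <;> cases e.injective he
  · intro j _ d he
    split_ifs at he <;> cases e.injective he
  · intro j hj l hl he
    split_ifs at he <;> first | omega | cases e.injective he
  · intro j hj l hl he
    split_ifs at he <;> first | omega | cases e.injective he
  · intro j hj l hl he
    split_ifs at he <;> cases e.injective he
  · intro j hj
    interval_cases j
    · exact h3
    · exact h5
    · exact (congrArg W.opp h4).symm.trans (W.opp_opp _)
  · intro d hd
    exact h6 d (hd 0 (by omega)) (hd 1 (by omega)) (hd 2 le_rfl)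
  · intro j hj
    interval_cases j
    · exact h7
    · exact h11
    · exact h15
  · intro j hj
    interval_cases j
    · exact h10
    · exact h14
    · exact h9
  · intro j hj
    interval_cases j
    · exact h12
    · exact h13

/-- Enumerate the new half-edges of a strip in a prescribed order. -/
noncomputable def Glue.equivFin {b k m : ℕ} {R₁ R : Raw} (g : Glue b k R₁ R)
    (f : Fin m → Fin (b + 1) ⊕ Fin (b + 1)) (hf : Function.Bijective f) :
    R₁.Dart ⊕ Fin m ≃ R.Dart :=
  (Equiv.sumCongr (Equiv.refl _) (Equiv.ofBijective f hf)).trans g.equiv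

theorem Glue.attachU {k : ℕ} {W₁ W : Web} (g : Glue 0 k W₁.raw W.raw) :
    AttachU (!W.out (g.u 0)) k W₁ W := by
  refine ⟨g.equivFin ![.inl 0, .inr 0] (by decide), g.base, g.opp_i, g.opp_u 0 le_rfl, ?_,
    g.next_pt 0 le_rfl, g.next_u_zero, g.next_v 0 le_rfl, g.out_i, ?_, g.region_i, g.region_ne⟩
  · intro d hd
    refine g.next_i d fun j hj => ?_
    obtain rfl : j = 0 := by omega
    exact hd
  · rw [Bool.not_not]; rfl

theorem Glue.attachY {k : ℕ} {W₁ W : Web} (g : Glue 1 k W₁.raw W.raw) :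
    AttachY k W₁ W := by
  refine ⟨g.equivFin ![.inl 0, .inr 1, .inr 0, .inl 1] (by decide), g.base, g.opp_i,
    g.opp_u 0 (by omega), g.opp_v 1 le_rfl, ?_, g.next_pt 0 (by omega), g.next_u_zero,
    g.next_v 1 le_rfl, g.next_u 0 (by omega), g.next_v 0 (by omega), g.next_pt 1 le_rfl,
    g.out_i, g.region_i, g.region_ne⟩
  intro d hd hd'
  refine g.next_i d fun j hj => ?_
  interval_cases j
  · exact hd
  · exact hd'

theorem Glue.attachH {k : ℕ} {W₁ W : Web} (g : Glue 2 k W₁.raw W.raw) :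
    AttachH k W₁ W := by
  refine ⟨g.equivFin ![.inl 0, .inr 2, .inr 0, .inl 2, .inl 1, .inr 1] (by decide), g.base,
    g.opp_i, g.opp_u 0 (by omega), g.opp_v 2 le_rfl, g.opp_u 1 (by omega), ?_,
    g.next_pt 0 (by omega), g.next_u_zero, g.next_v 2 le_rfl, g.next_v 0 (by omega),
    g.next_pt 1 (by omega), g.next_u 0 (by omega), g.next_u 1 (by omega), g.next_v 1 (by omega),
    g.next_pt 2 le_rfl, g.out_i, g.region_i, g.region_ne⟩
  intro d hd hd' hd''
  refine g.next_i d fun j hj => ?_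
  interval_cases j
  · exact hd
  · exact hd'
  · exact hd''

theorem setoid_rel_congr {X : Type*} (r : Setoid X) {x y x' y' : X} (hx : r x x') (hy : r y y') :
    r x y ↔ r x' y' :=
  ⟨fun h => r.trans (r.symm hx) (r.trans h hy), fun h => r.trans hx (r.trans h (r.symm hy))⟩

/-- The result of attaching a strip is unique. -/
theorem Glue.iso {b k : ℕ} {W₁ W W₁' W' : Web} (g : Glue b k W₁.raw W.raw)
    (g' : Glue b k W₁'.raw W'.raw) (hW : W₁.Iso W₁') (ho : W'.out (g'.u 0) = W.out (g.u 0)) :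
    W.Iso W' := by
  obtain ⟨f, f1, f2, f3, f4, f5⟩ := hW
  have fpt : ∀ m, f (W₁.raw.pt m) = W₁'.raw.pt m := by
    intro m
    induction m with
    | zero => exact f3
    | succ m ih => rw [← Raw.next_pt, ← Raw.next_pt, ← ih]; exact f1 _
  let E : W.Dart ≃ W'.Dart := g.equiv.symm.trans ((Equiv.sumCongr f (Equiv.refl _)).trans g'.equiv)
  have Ei : ∀ d, E (g.i d) = g'.i (f d) := by
    intro d
    have : g.equiv.symm (g.i d) = .inl d := by rw [Equiv.symm_apply_eq]; rfl
    simp only [E, Equiv.trans_apply, this]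
    rfl
  have Eu : ∀ j ≤ b, E (g.u j) = g'.u j := by
    intro j hj
    have : g.equiv.symm (g.u j) = .inr (.inl ⟨j, by omega⟩) := by rw [Equiv.symm_apply_eq]; rfl
    simp only [E, Equiv.trans_apply, this]
    rfl
  have Ev : ∀ j ≤ b, E (g.v j) = g'.v j := by
    intro j hj
    have : g.equiv.symm (g.v j) = .inr (.inr ⟨j, by omega⟩) := by rw [Equiv.symm_apply_eq]; rfl
    simp only [E, Equiv.trans_apply, this]
    rfl
  have hou : ∀ j ≤ b, W'.out (g'.u j) = W.out (g.u j) := by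
    intro j hj
    cases j with
    | zero => exact ho
    | succ j =>
      refine (g'.out_u j hj).trans (Eq.trans ?_ (g.out_u j hj).symm)
      rw [← fpt]
      exact f4 _
  -- every region is represented by an old half-edge or by `u 0`, compatibly with `E`
  have hrep : ∀ x, (∃ d, W.region x (g.i d) ∧ W'.region (E x) (g'.i (f d))) ∨
      (W.region x (g.u 0) ∧ W'.region (E x) (g'.u 0)) := by
    intro x
    rcases g.cover x with ⟨d, rfl⟩ | ⟨j, hj, rfl⟩ | ⟨j, hj, rfl⟩
    · exact Or.inl ⟨d, W.region.refl _, by rw [Ei]⟩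
    · exact Or.inr ⟨g.region_u j hj, by rw [Eu j hj]; exact g'.region_u j hj⟩
    · exact Or.inl ⟨_, g.region_v j hj, by rw [Ev j hj, fpt]; exact g'.region_v j hj⟩
  refine ⟨E, ?_, ?_, ?_, ?_, ?_⟩
  · intro d
    rcases g.cover d with ⟨d, rfl⟩ | ⟨j, hj, rfl⟩ | ⟨j, hj, rfl⟩
    · by_cases hl : ∃ j ≤ b, d = W₁.raw.pt (k + j)
      · obtain ⟨j, hj, rfl⟩ := hl
        rw [g.next_pt j hj, Eu j hj, Ei, fpt, g'.next_pt j hj]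
      · push Not at hl
        rw [g.next_i d hl, Ei, Ei, g'.next_i]
        · congr 1; exact f1 d
        · intro j hj he
          exact hl j hj (f.injective (he.trans (fpt _).symm))
    · cases j with
      | zero => rw [g.next_u_zero, Ev _ le_rfl, Eu 0 hj, g'.next_u_zero]
      | succ j => rw [g.next_u j hj, Ev _ (by omega), Eu _ hj, g'.next_u j hj]
    · rw [g.next_v j hj, Ei, fpt, Ev j hj, g'.next_v j hj]
  · intro d
    rcases g.cover d with ⟨d, rfl⟩ | ⟨j, hj, rfl⟩ | ⟨j, hj, rfl⟩
    · rw [g.opp_i, Ei, Ei, g'.opp_i]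
      congr 1; exact f2 d
    · rw [g.opp_u j hj, Ev j hj, Eu j hj, g'.opp_u j hj]
    · rw [g.opp_v j hj, Ev j hj, Eu j hj, g'.opp_v j hj]
  · have := g.base
    change W.base = _ at this
    rw [this, Ei]
    exact (congrArg g'.i f3).trans g'.base.symm
  · intro d
    rcases g.cover d with ⟨d, rfl⟩ | ⟨j, hj, rfl⟩ | ⟨j, hj, rfl⟩
    · rw [Ei]
      exact (g'.out_i _).trans ((f4 d).trans (g.out_i d).symm)
    · rw [Eu j hj]; exact hou j hj
    · rw [Ev j hj]
      refine (g'.out_uv j hj).trans (Eq.trans ?_ (g.out_uv j hj).symm)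
      congr 1
      exact hou j hj
  · intro x y
    rcases hrep x with ⟨d, h1, h2⟩ | ⟨h1, h2⟩ <;> rcases hrep y with ⟨d', h3, h4⟩ | ⟨h3, h4⟩
    · rw [setoid_rel_congr _ h1 h3, setoid_rel_congr _ h2 h4]
      exact (g'.region_i _ _).trans ((f5 _ _).trans (g.region_i _ _).symm)
    · rw [setoid_rel_congr _ h1 h3, setoid_rel_congr _ h2 h4]
      exact iff_of_false (fun h => g'.region_ne _ (W'.region.symm h))
        (fun h => g.region_ne _ (W.region.symm h))
    · rw [setoid_rel_congr _ h1 h3, setoid_rel_congr _ h2 h4]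
      exact iff_of_false (g'.region_ne _) (g.region_ne _)
    · rw [setoid_rel_congr _ h1 h3, setoid_rel_congr _ h2 h4]
      exact iff_of_true (W'.region.refl _) (W.region.refl _)

/-! ### Dominant strings and growth rules -/

/-- The path with the steps of `x` that starts at `w` ends at `0` and stays in the chamber. -/
def DominantFrom (w : ℤ × ℤ) : SignStateString → Prop
  | [] => w = 0
  | a :: x => (0 ≤ w.1 ∧ 0 ≤ w.2) ∧ DominantFrom (w + stateWeight a) x

theorem latticePath_zero (x : SignStateString) : latticePath x 0 = 0 := by simp [latticePath]

theorem latticePath_cons (a : Bool × SignType) (x : SignStateString) (k : ℕ) :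
    latticePath (a :: x) (k + 1) = stateWeight a + latticePath x k := by simp [latticePath]

theorem latticePath_append_le {l : SignStateString} (r : SignStateString) {k : ℕ}
    (h : k ≤ l.length) : latticePath (l ++ r) k = latticePath l k := by
  simp [latticePath, List.take_append_of_le_length h]

theorem latticePath_append (l r : SignStateString) (k : ℕ) :
    latticePath (l ++ r) (l.length + k) = latticePath l l.length + latticePath r k := by
  simp [latticePath, List.take_length_add_append]

theorem dominantFrom_iff (w : ℤ × ℤ) (x : SignStateString) : DominantFrom w x ↔
    (∀ k ≤ x.length, 0 ≤ (w + latticePath x k).1 ∧ 0 ≤ (w + latticePath x k).2) ∧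
      w + latticePath x x.length = 0 := by
  induction x generalizing w with
  | nil =>
    simp only [DominantFrom, List.length_nil, Nat.le_zero, forall_eq, latticePath_zero, add_zero]
    exact ⟨fun h => by simp [h], fun h => h.2⟩
  | cons a x ih =>
    simp only [DominantFrom, ih, List.length_cons, latticePath_cons, ← add_assoc]
    constructor
    · rintro ⟨h1, h2, h3⟩
      refine ⟨fun k hk => ?_, h3⟩
      cases k with
      | zero => simpa [latticePath_zero] using h1
      | succ k => rw [latticePath_cons, ← add_assoc]; exact h2 k (by omega)
    · rintro ⟨h1, h2⟩
      refine ⟨by simpa [latticePath_zero] using h1 0 (by omega), fun k hk => ?_, h2⟩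
      have := h1 (k + 1) (by omega)
      rwa [latticePath_cons, ← add_assoc] at this

theorem isDominant_iff (x : SignStateString) : IsDominant x ↔ DominantFrom 0 x := by
  rw [dominantFrom_iff]
  simp only [zero_add]
  rfl

theorem DominantFrom.nonneg {w : ℤ × ℤ} {x : SignStateString} (h : DominantFrom w x) :
    0 ≤ w.1 ∧ 0 ≤ w.2 := by
  cases x with
  | nil => simp [show w = 0 from h]
  | cons a x => exact h.1

theorem GrowthRule.dominantFrom {c : Piece} {t b r : SignStateString} {w : ℤ × ℤ}
    (h : GrowthRule c t b) (hd : DominantFrom w (t ++ r)) : DominantFrom w (b ++ r) := by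
  obtain ⟨w1, w2⟩ := w
  cases h <;> rename_i s <;> cases s <;>
    simp only [List.cons_append, List.nil_append, DominantFrom, Bool.not_true, Bool.not_false]
      at hd ⊢ <;>
    obtain ⟨h1, h2, h3⟩ := hd <;>
    have h4 := h3.nonneg <;>
    simp only [stateWeight, Prod.mk_add_mk] at h1 h2 h3 h4 ⊢ <;>
    (try ring_nf at h1 h2 h3 h4 ⊢) <;>
    first
      | exact h3
      | simpa using h3
      | exact ⟨h1, h3⟩
      | exact ⟨h1, by omega, h3⟩

theorem GrowthStep.dominantFrom {x y : SignStateString} (h : GrowthStep x y) {w : ℤ × ℤ}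
    (hd : DominantFrom w x) : DominantFrom w y := by
  obtain ⟨c, k, l, r, t, b, hr, -, rfl, rfl⟩ := h
  rw [List.append_assoc] at hd ⊢
  induction l generalizing w with
  | nil => exact hr.dominantFrom hd
  | cons a l ih => exact ⟨hd.1, ih hd.2⟩

theorem GrowthStep.isDominant {x y : SignStateString} (h : GrowthStep x y) (hd : IsDominant x) :
    IsDominant y :=
  (isDominant_iff y).2 (h.dominantFrom ((isDominant_iff x).1 hd))

theorem GrowthStep.cons {x y : SignStateString} (a : Bool × SignType) (h : GrowthStep x y) :
    GrowthStep (a :: x) (a :: y) := by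
  obtain ⟨c, k, l, r, t, b, hr, rfl, rfl, rfl⟩ := h
  exact ⟨c, _, a :: l, r, t, b, hr, rfl, rfl, rfl⟩

/-- After a letter with state `1` the first letter with another state gives a growth step. -/
theorem exists_growthStep_of_pos (s : Bool) (x : SignStateString) (w : ℤ × ℤ)
    (h : DominantFrom w ((s, 1) :: x)) : ∃ y, GrowthStep ((s, 1) :: x) y := by
  induction x generalizing w s with
  | nil =>
    obtain ⟨w1, w2⟩ := w
    obtain ⟨h1, h2⟩ := h
    exfalso
    cases s <;> simp only [DominantFrom, stateWeight, Prod.mk_add_mk, Prod.mk_eq_zero] at h1 h2 <;>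
      omega
  | cons a x ih =>
    obtain ⟨s', j⟩ := a
    have mk : ∀ c b, GrowthRule c [(s, 1), (s', j)] b →
        ∃ y, GrowthStep ((s, 1) :: (s', j) :: x) y :=
      fun c b hr => ⟨b ++ x, c, 0, [], x, _, b, hr, rfl, rfl, rfl⟩
    obtain rfl | rfl : s' = s ∨ s' = !s := by cases s <;> cases s' <;> simp
    · cases j with
      | zero => exact mk _ _ (.Y₁ _)
      | neg => exact mk _ _ (.Y₃ _)
      | pos =>
        obtain ⟨y, hy⟩ := ih _ _ h.2
        exact ⟨_, hy.cons _⟩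
    · cases j with
      | zero => exact mk _ _ (.H₁ _)
      | neg => exact mk _ _ (.U₁ _)
      | pos =>
        obtain ⟨y, hy⟩ := ih _ _ h.2
        exact ⟨_, hy.cons _⟩

/-- The first letter of a dominant string has the state `1`. -/
theorem exists_growthStep {x : SignStateString} (h : IsDominant x) (hx : x ≠ []) :
    ∃ y, GrowthStep x y := by
  rw [isDominant_iff] at h
  cases x with
  | nil => exact absurd rfl hx
  | cons a x =>
    obtain ⟨s, j⟩ := a
    have h1 := h.2.nonneg
    cases j with
    | pos => exact exists_growthStep_of_pos s x 0 h
    | zero =>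
      exfalso
      cases s <;> simp only [stateWeight, zero_add] at h1 <;> omega
    | neg =>
      exfalso
      cases s <;> simp only [stateWeight, zero_add] at h1 <;> omega

/-- A quantity that every growth step decreases: the sum over the letters of the state plus `1`,
times the number of letters to the right. -/
def growthMeasure : SignStateString → ℕ
  | [] => 0
  | a :: x => (match a.2 with | .pos => 2 | .zero => 1 | .neg => 0) * x.length + growthMeasure x

theorem GrowthStep.growthMeasure_lt {x y : SignStateString} (h : GrowthStep x y) :
    growthMeasure y < growthMeasure x := by
  obtain ⟨c, k, l, r, t, b, hr, -, rfl, rfl⟩ := h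
  have hlen : b.length ≤ t.length := by cases hr <;> simp
  rw [List.append_assoc, List.append_assoc]
  induction l with
  | nil =>
    cases hr <;> simp only [List.nil_append, List.cons_append, growthMeasure, List.length_cons,
      show (1 : SignType) = .pos from rfl, show (0 : SignType) = .zero from rfl] <;> omega
  | cons a l ih =>
    simp only [List.cons_append, growthMeasure, List.length_append]
    refine Nat.add_lt_add_of_le_of_lt (Nat.mul_le_mul_left _ (by omega)) ih

theorem acc_growthStep (x : SignStateString) : Acc (fun y z => GrowthStep z y) x := by
  induction hn : growthMeasure x using Nat.strong_induction_on generalizing x with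
  | _ n ih =>
    exact ⟨x, fun y hy => ih _ (hn ▸ hy.growthMeasure_lt) y rfl⟩

/-- The growth rules, and two further ways to attach an `H`, to equal states `1` or `-1`. The latter
are no steps of the growth algorithm, but the pieces at the boundary of a non-elliptic web occur in
both ways. -/
inductive LocalRule : SignStateString → SignStateString → Prop
  | growth {c : Piece} {t b : SignStateString} (h : GrowthRule c t b) : LocalRule t b
  | pos (s : Bool) : LocalRule [(s, 1), (!s, 1)] [(!s, 1), (s, 1)]
  | neg (s : Bool) : LocalRule [(s, -1), (!s, -1)] [(!s, -1), (s, -1)]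

theorem GrowthRule.length {c : Piece} {t b : SignStateString} (h : GrowthRule c t b) :
    b.length = c.legs := by cases h <;> rfl

theorem GrowthRule.legs_le {c : Piece} {t b : SignStateString} (h : GrowthRule c t b) :
    c.legs ≤ 2 := by cases h <;> simp [Piece.legs]

/-- The piece and the bottom letters of a growth rule are determined by the top letters. -/
theorem GrowthRule.unique {c c' : Piece} {t b b' : SignStateString} (h : GrowthRule c t b)
    (h' : GrowthRule c' t b') : c = c' ∧ b = b' := by
  cases h <;> rename_i s <;> cases s <;> cases h' <;> exact ⟨rfl, rfl⟩

theorem GrowthRule.length_top {c : Piece} {t b : SignStateString} (h : GrowthRule c t b) :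
    t.length = 2 := by cases h <;> rfl

/-! ### Weights of minimal cut paths -/

/-- The contribution to the weight of a cut path of a strand with the given orientation. -/
def crossWeight (o : Bool) : ℤ × ℤ := if o then (1, 0) else (0, 1)

/-- The length of a weight: the number of strands crossed. -/
def height (w : ℤ × ℤ) : ℤ := w.1 + w.2

theorem height_add (w w' : ℤ × ℤ) : height (w + w') = height w + height w' := by
  simp only [height, Prod.fst_add, Prod.snd_add]; ring

/-- A local certificate for the weights of the minimal cut paths from the stub to all regions: the
height changes by at most one across an edge; where it goes up, the weight changes by
the weight of the edge; and every other region can be left by an edge across which it goes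
down. -/
structure Raw.IsPotential (R : Raw) (φ : R.Dart → ℤ × ℤ) : Prop where
  region : ∀ d d', R.region d d' → φ d = φ d'
  base : φ R.base = 0
  nonneg : ∀ d, 0 ≤ height (φ d)
  edge : ∀ d, d ≠ R.base → height (φ (R.opp d)) ≤ height (φ d) + 1 ∧
    (height (φ (R.opp d)) = height (φ d) + 1 → φ (R.opp d) = φ d + crossWeight (R.out d))
  descend : ∀ d, ¬ R.region R.base d → ∃ d', R.region d d' ∧ d' ≠ R.base ∧
    height (φ (R.opp d')) + 1 = height (φ d)

/-- The potential runs along the boundary through the lattice path of `x`. -/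
def Raw.Follows (R : Raw) (φ : R.Dart → ℤ × ℤ) (x : SignStateString) : Prop :=
  ∀ m ≤ x.length, φ (R.pt m) = latticePath x m

/-- The signs of `x` are those of the boundary. -/
def Raw.HasSigns (R : Raw) (x : SignStateString) : Prop :=
  x.length + 1 = R.period ∧ ∀ m a, x[m]? = some a → a.1 = !R.out (R.pt (m + 1))

namespace Web

variable {W : Web}

theorem cutWeight_cons (d : W.Dart) (l : List W.Dart) :
    W.cutWeight (d :: l) = crossWeight (W.out d) + W.cutWeight l := by
  simp [cutWeight, crossWeight]

/-- A cut path is at least as long as the difference of the heights at its ends, and if it is not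
longer, its weight is the difference of the weights. -/
theorem IsCutPath.bound {φ : W.Dart → ℤ × ℤ} (hφ : W.raw.IsPotential φ) {a b : W.Dart}
    {l : List W.Dart} (h : W.IsCutPath a l b) : height (φ b) ≤ height (φ a) + l.length ∧
      (height (φ b) = height (φ a) + l.length → φ b = φ a + W.cutWeight l) := by
  induction l generalizing a with
  | nil =>
    have : φ a = φ b := hφ.region _ _ h
    rw [this]
    simp [cutWeight]
  | cons d l ih =>
    obtain ⟨h1, h2, h3⟩ := h
    have ⟨e1, e2⟩ := hφ.edge d h2
    have ⟨i1, i2⟩ := ih h3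
    change height (φ (W.opp d)) ≤ height (φ d) + 1 at e1
    change height (φ (W.opp d)) = height (φ d) + 1 → φ (W.opp d) = φ d + crossWeight (W.out d) at e2
    have : φ a = φ d := hφ.region _ _ h1
    rw [this, List.length_cons, cutWeight_cons]
    push_cast
    refine ⟨by omega, fun he => ?_⟩
    rw [i2 (by omega), e2 (by omega), add_assoc]

theorem IsCutPath.snoc {a b d : W.Dart} {l : List W.Dart} (h : W.IsCutPath a l b)
    (hbd : W.region b d) (hd : d ≠ W.base) : W.IsCutPath a (l ++ [d]) (W.opp d) := by
  induction l generalizing a with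
  | nil => exact ⟨W.region.trans h hbd, hd, W.region.refl _⟩
  | cons e l ih => exact ⟨h.1, h.2.1, ih h.2.2⟩

theorem IsCutPath.congr_right {a b c : W.Dart} {l : List W.Dart} (h : W.IsCutPath a l b)
    (hbc : W.region b c) : W.IsCutPath a l c := by
  induction l generalizing a with
  | nil => exact W.region.trans h hbc
  | cons e l ih => exact ⟨h.1, h.2.1, ih h.2.2⟩

/-- Descending edges lead back to the region of the stub. -/
theorem exists_isCutPath {φ : W.Dart → ℤ × ℤ} (hφ : W.raw.IsPotential φ) (d : W.Dart) :
    ∃ l, W.IsCutPath W.base l d ∧ (l.length : ℤ) = height (φ d) := by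
  induction hn : (height (φ d)).toNat using Nat.strong_induction_on generalizing d with
  | _ n ih =>
  by_cases hd : W.region W.base d
  · refine ⟨[], hd, ?_⟩
    have h1 : φ W.base = φ d := hφ.region _ _ hd
    have h2 : φ W.base = 0 := hφ.base
    rw [← h1, h2]
    simp [height]
  · obtain ⟨d', h1, h2, h3⟩ := hφ.descend d hd
    change height (φ (W.opp d')) + 1 = _ at h3
    have h0 := hφ.nonneg (W.opp d')
    obtain ⟨l, hl, hlen⟩ := ih _ (by omega) (W.opp d') rfl
    have h4 : W.opp d' ≠ W.base := fun h => h2 (by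
      rw [← W.opp_opp d', h, (W.opp_eq_self _).2 rfl])
    have h5 := hl.snoc (W.region.refl _) h4
    rw [W.opp_opp] at h5
    refine ⟨l ++ [W.opp d'], h5.congr_right (W.region.symm h1), ?_⟩
    rw [List.length_append]
    simp
    omega

theorem isMinCutPath_weight {φ : W.Dart → ℤ × ℤ} (hφ : W.raw.IsPotential φ) (d : W.Dart) :
    (∃ l, W.IsMinCutPath W.base l d) ∧
      ∀ l, W.IsMinCutPath W.base l d → W.cutWeight l = φ d := by
  have h2 : φ W.base = 0 := hφ.base
  have h3 : height (φ W.base) = 0 := by rw [h2]; rfl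
  obtain ⟨l, hl, hlen⟩ := exists_isCutPath hφ d
  refine ⟨⟨l, hl, fun l' hl' => ?_⟩, fun l' hl' => ?_⟩
  · have := (hl'.bound hφ).1
    omega
  · have h4 := hl'.1.bound hφ
    have h5 := hl'.2 l hl
    rw [h4.2 (by omega), h2, zero_add]

theorem boundary_eq {x : SignStateString} (h : W.raw.HasSigns x) :
    x.map Prod.fst = W.boundary := by
  have hlen : x.length = W.numEndpoints := by
    have := h.1
    change _ = Function.minimalPeriod W.next W.base at this
    rw [numEndpoints]
    omega
  refine List.ext_getElem (by simp [boundary, hlen]) fun m h1 h2 => ?_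
  simp only [boundary, List.getElem_map, List.getElem_range]
  exact h.2 m _ (List.getElem?_eq_getElem _)

theorem hasSigns_of_boundary_eq {x : SignStateString} (h : x.map Prod.fst = W.boundary) :
    W.raw.HasSigns x := by
  have := W.finite
  have hlen : x.length = W.numEndpoints := by
    have := congrArg List.length h
    simpa [boundary] using this
  have hpos := W.raw.period_pos
  refine ⟨?_, fun m a ha => ?_⟩
  · change _ = Function.minimalPeriod W.next W.base
    change 0 < Function.minimalPeriod W.next W.base at hpos
    rw [numEndpoints] at hlen
    omega
  · have h1 := congrArg (fun y => y[m]?) h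
    simp only [List.getElem?_map, ha, Option.map_some, boundary] at h1
    have hm : m < W.numEndpoints := by
      rw [← hlen]
      exact (List.getElem?_eq_some_iff.1 ha).1
    rw [List.getElem?_range hm] at h1
    have h2 : a.1 = !W.out (W.pt (m + 1)) := by simpa using h1
    exact h2

theorem minCutString_of_potential {φ : W.Dart → ℤ × ℤ} {x : SignStateString}
    (hφ : W.raw.IsPotential φ) (hx : W.raw.Follows φ x) (hs : W.raw.HasSigns x) :
    W.MinCutString x := by
  refine ⟨boundary_eq hs, fun k hk => ?_⟩
  have := isMinCutPath_weight hφ (W.pt k)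
  rw [← hx k hk]
  exact this

theorem MinCutString.unique {x x' : SignStateString} (h : W.MinCutString x)
    (h' : W.MinCutString x') : x = x' := by
  have hlen : x.length = x'.length := by
    have := congrArg List.length (h.1.trans h'.1.symm)
    simpa using this
  have hpath : ∀ k ≤ x.length, latticePath x k = latticePath x' k := by
    intro k hk
    obtain ⟨⟨l, hl⟩, h1⟩ := h.2 k hk
    rw [← h1 l hl, (h'.2 k (hlen ▸ hk)).2 l hl]
  have hfst := h.1.trans h'.1.symm
  clear h h'
  induction x generalizing x' with
  | nil => exact (List.length_eq_zero_iff.1 hlen.symm).symm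
  | cons a x ih =>
    cases x' with
    | nil => simp at hlen
    | cons a' x' =>
      simp only [List.map_cons, List.cons.injEq] at hfst
      have h1 := hpath 1 (by simp)
      rw [latticePath_cons, latticePath_cons, latticePath_zero, latticePath_zero, add_zero,
        add_zero] at h1
      obtain rfl : a = a' := by
        obtain ⟨s, j⟩ := a
        obtain ⟨s', j'⟩ := a'
        obtain rfl : s = s' := hfst.1
        cases s <;> cases j <;> cases j' <;> first | rfl | (simp [stateWeight] at h1)
      congr 1
      refine ih (by simpa using hlen) (fun k hk => ?_) hfst.2
      have := hpath (k + 1) (by simpa using hk)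
      rw [latticePath_cons, latticePath_cons] at this
      exact add_left_cancel this

theorem cutWeight_nonneg (l : List W.Dart) : 0 ≤ (W.cutWeight l).1 ∧ 0 ≤ (W.cutWeight l).2 := by
  induction l with
  | nil => simp [cutWeight]
  | cons d l ih =>
    rw [cutWeight_cons]
    have : 0 ≤ (crossWeight (W.out d)).1 ∧ 0 ≤ (crossWeight (W.out d)).2 := by
      cases W.out d <;> simp [crossWeight]
    simp only [Prod.fst_add, Prod.snd_add]
    omega

/-- The stub lies in the same region as the last corner, so the lattice path returns to `0`. -/
theorem MinCutString.isDominant {x : SignStateString} (h : W.MinCutString x) : IsDominant x := by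
  constructor
  · intro k hk
    obtain ⟨⟨l, hl⟩, h1⟩ := h.2 k hk
    rw [← h1 l hl]
    exact cutWeight_nonneg l
  · obtain ⟨⟨l, hl⟩, h1⟩ := h.2 x.length le_rfl
    have hs := hasSigns_of_boundary_eq h.1
    have hpt : W.region W.base (W.pt x.length) := by
      have h2 := W.keep (W.pt x.length)
      have h3 : W.next (W.pt x.length) = W.base := by
        have := W.raw.pt_period
        rw [← hs.1, ← Raw.next_pt] at this
        exact this
      rw [h3, (W.opp_eq_self _).2 rfl] at h2
      exact W.region.symm h2
    have h4 := hl.2 [] hpt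
    obtain rfl : l = [] := List.length_eq_zero_iff.1 (by simpa using h4)
    rw [← h1 [] hl]
    rfl

end Web

/-- The orientation of the left half-edge of the `j`-th edge of a strip whose left endpoint has
the sign `s`. -/
def stripOut (s : Bool) (j : ℕ) : Bool := if j % 2 = 0 then !s else s

theorem stripOut_succ (s : Bool) (j : ℕ) : stripOut s (j + 1) = !stripOut s j := by
  unfold stripOut
  rcases Nat.mod_two_eq_zero_or_one j with h | h
  · have : (j + 1) % 2 = 1 := by omega
    simp [h, this]
  · have : (j + 1) % 2 = 0 := by omega
    simp [h, this]

/-- What the local rules say about weights; `latticePath b j` is the weight, relative to the left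
end, of the region below the `j`-th edge of the strip, and `stateWeight A` that of the new
region. -/
theorem LocalRule.spec {t b : SignStateString} (h : LocalRule t b) :
    ∃ A B, t = [A, B] ∧ B.1 = stripOut A.1 b.length ∧
      (∀ j a, b[j]? = some a → a.1 = stripOut A.1 j) ∧
      stateWeight A + stateWeight B = latticePath b b.length ∧
      (∀ j ≤ b.length,
        (height (latticePath b j) ≤ height (stateWeight A) + 1 ∧
          (height (latticePath b j) = height (stateWeight A) + 1 →
            latticePath b j = stateWeight A + crossWeight (stripOut A.1 j))) ∧
        (height (stateWeight A) ≤ height (latticePath b j) + 1 ∧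
          (height (stateWeight A) = height (latticePath b j) + 1 →
            stateWeight A = latticePath b j + crossWeight (!stripOut A.1 j)))) ∧
      ∃ j ≤ b.length, height (latticePath b j) + 1 = height (stateWeight A) := by
  suffices hk : ∃ A B, t = [A, B] ∧ B.1 = stripOut A.1 b.length ∧
      (∀ j < b.length, ∀ a ∈ b[j]?, a.1 = stripOut A.1 j) ∧
      stateWeight A + stateWeight B = latticePath b b.length ∧
      (∀ j < b.length + 1,
        (height (latticePath b j) ≤ height (stateWeight A) + 1 ∧
          (height (latticePath b j) = height (stateWeight A) + 1 →
            latticePath b j = stateWeight A + crossWeight (stripOut A.1 j))) ∧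
        (height (stateWeight A) ≤ height (latticePath b j) + 1 ∧
          (height (stateWeight A) = height (latticePath b j) + 1 →
            stateWeight A = latticePath b j + crossWeight (!stripOut A.1 j)))) ∧
      ∃ j < b.length + 1, height (latticePath b j) + 1 = height (stateWeight A) by
    obtain ⟨A, B, h1, h2, h3, h4, h5, j, h6, h7⟩ := hk
    exact ⟨A, B, h1, h2, fun j a ha => h3 j (List.getElem?_eq_some_iff.1 ha).1 a ha, h4,
      fun j hj => h5 j (by omega), j, by omega, h7⟩
  cases h with
  | growth h =>
    cases h <;> rename_i s <;> refine ⟨_, _, rfl, ?_⟩ <;> cases s <;> decide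
  | pos s => refine ⟨_, _, rfl, ?_⟩; cases s <;> decide
  | neg s => refine ⟨_, _, rfl, ?_⟩; cases s <;> decide

theorem LocalRule.fst_eq {A B : Bool × SignType} {bt : SignStateString}
    (h : LocalRule [A, B] bt) {j : ℕ} {a : Bool × SignType} (ha : bt[j]? = some a) :
    a.1 = stripOut A.1 j := by
  obtain ⟨A', B', ht', -, hs, -⟩ := h.spec
  obtain ⟨rfl, rfl⟩ : A = A' ∧ B = B' := by simpa using ht'
  exact hs j a ha

/-! ### Attaching a piece: weights and signs -/

section Append

variable {l t r : SignStateString} {k : ℕ}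

theorem getElem?_append_left' (hl : l.length = k) {j : ℕ} (hj : j < k) :
    (l ++ t ++ r)[j]? = l[j]? := by
  rw [List.append_assoc, List.getElem?_append_left (by omega)]

theorem getElem?_append_mid (hl : l.length = k) {j : ℕ} (hj : j < t.length) :
    (l ++ t ++ r)[k + j]? = t[j]? := by
  rw [List.append_assoc, List.getElem?_append_right (by omega),
    List.getElem?_append_left (by omega)]
  congr 1; omega

theorem getElem?_append_right' (hl : l.length = k) (j : ℕ) :
    (l ++ t ++ r)[k + t.length + j]? = r[j]? := by
  rw [List.append_assoc, List.getElem?_append_right (by omega),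
    List.getElem?_append_right (by omega)]
  congr 1; omega

theorem latticePath_append_left (hl : l.length = k) {j : ℕ} (hj : j ≤ k) :
    latticePath (l ++ t ++ r) j = latticePath l j := by
  rw [List.append_assoc, latticePath_append_le _ (by omega)]

theorem latticePath_append_mid (hl : l.length = k) {j : ℕ} (hj : j ≤ t.length) :
    latticePath (l ++ t ++ r) (k + j) = latticePath l k + latticePath t j := by
  subst hl
  rw [List.append_assoc, latticePath_append, latticePath_append_le _ hj]

theorem latticePath_append_right (hl : l.length = k) (j : ℕ) :
    latticePath (l ++ t ++ r) (k + t.length + j) =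
      latticePath l k + latticePath t t.length + latticePath r j := by
  subst hl
  rw [List.append_assoc, add_assoc, latticePath_append, latticePath_append, add_assoc]

end Append

namespace Glue

variable {b k : ℕ} {R₁ R : Raw} (g : Glue b k R₁ R)

include g

theorem out_u_eq {s : Bool} (hs : R.out (g.u 0) = !s) {j : ℕ} (hj : j ≤ b) :
    R.out (g.u j) = stripOut s j := by
  induction j with
  | zero => rw [hs]; simp [stripOut]
  | succ j ih =>
    rw [stripOut_succ, ← ih (by omega), ← g.out_uv j (by omega), g.out_u j hj, g.out_v j hj]

/-- For a strip with legs the orientation at the left new endpoint is determined by the old web. -/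
theorem out_u_zero (hb : 0 < b) : R.out (g.u 0) = !R₁.out (R₁.pt (k + 1)) := by
  rw [← g.out_v 0 hb, g.out_uv 0 hb.le, Bool.not_not]

theorem hasSigns {l t bt r : SignStateString} {A B : Bool × SignType} (ht : t = [A, B])
    (hb : bt.length = b) (hl : l.length = k) (hS : R₁.HasSigns (l ++ bt ++ r))
    (hA : R.out (g.u 0) = !A.1) (hB : B.1 = stripOut A.1 b) : R.HasSigns (l ++ t ++ r) := by
  subst ht
  have hper := g.period
  obtain ⟨h1, h2⟩ := hS
  simp only [List.length_append] at h1
  refine ⟨by simp only [List.length_append, List.length_cons, List.length_nil]; omega, ?_⟩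
  intro m a ha
  rcases Nat.lt_or_ge m k with hm | hm
  · rw [getElem?_append_left' hl hm] at ha
    rw [g.pt_of_le hm, g.out_i]
    exact h2 m a (by rw [getElem?_append_left' hl hm]; exact ha)
  obtain ⟨j, rfl⟩ : ∃ j, m = k + j := ⟨m - k, by omega⟩
  obtain rfl | rfl | hj : j = 0 ∨ j = 1 ∨ 2 ≤ j := by omega
  · rw [getElem?_append_mid hl (by simp)] at ha
    obtain rfl : A = a := by simpa using ha
    rw [add_zero, g.pt_u, hA, Bool.not_not]
  · rw [getElem?_append_mid hl (by simp)] at ha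
    obtain rfl : B = a := by simpa using ha
    rw [add_assoc, g.pt_v, g.out_uv b le_rfl, Bool.not_not, g.out_u_eq hA le_rfl, hB]
  · obtain ⟨i, rfl⟩ : ∃ i, j = 2 + i := ⟨j - 2, by omega⟩
    rw [← add_assoc] at ha
    have ha' := (getElem?_append_right' (t := [A, B]) hl i).symm.trans ha
    have hi : i < r.length := (List.getElem?_eq_some_iff.1 ha').1
    have h3 := g.pt_of_gt (m := i) (by omega)
    rw [show k + (2 + i) + 1 = k + 3 + i by omega, h3, g.out_i,
      show k + b + 1 + i = k + b + i + 1 by omega]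
    refine h2 _ a ?_
    rw [← hb, getElem?_append_right' hl]
    exact ha'

/-- A potential extends to the new region by the weight that the local rule prescribes, and then
follows the new string. -/
theorem exists_potential {l t bt r : SignStateString} {A B : Bool × SignType}
    (ht : t = [A, B]) (hr : LocalRule t bt) (hb : bt.length = b) (hl : l.length = k)
    {φ₁ : R₁.Dart → ℤ × ℤ} (hφ : R₁.IsPotential φ₁) (hF : R₁.Follows φ₁ (l ++ bt ++ r))
    (hS : R₁.HasSigns (l ++ bt ++ r)) (hA : R.out (g.u 0) = !A.1) :
    (∃ φ, R.IsPotential φ ∧ R.Follows φ (l ++ t ++ r)) ∧ R.HasSigns (l ++ t ++ r) := by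
  classical
  obtain ⟨A', B', ht', s1, s2, s3, s4, j₀, hj₀, s5⟩ := hr.spec
  obtain ⟨rfl, rfl⟩ : A = A' ∧ B = B' := by
    rw [ht] at ht'
    simpa using ht'
  rw [hb] at s1 s3 s4 hj₀
  refine ⟨?_, g.hasSigns ht hb hl hS hA s1⟩
  subst ht
  have hper := g.period
  have hlen := hS.1
  simp only [List.length_append] at hlen
  let N : ℤ × ℤ := latticePath l k + stateWeight A
  let φ : R.Dart → ℤ × ℤ := fun d =>
    if hd : ∃ d₁, R.region d (g.i d₁) then φ₁ hd.choose else N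
  have hφi : ∀ d, φ (g.i d) = φ₁ d := by
    intro d
    have hd : ∃ d₁, R.region (g.i d) (g.i d₁) := ⟨d, R.region.refl _⟩
    simp only [φ, dif_pos hd]
    exact (hφ.region _ _ ((g.region_i _ _).1 hd.choose_spec)).symm
  have hreg : ∀ d d', R.region d d' → φ d = φ d' := by
    intro d d' hdd
    have : ∀ d₁, R.region d (g.i d₁) ↔ R.region d' (g.i d₁) := fun d₁ =>
      ⟨R.region.trans (R.region.symm hdd), R.region.trans hdd⟩
    simp only [φ, this]
  have hφu : ∀ j ≤ b, φ (g.u j) = N := by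
    intro j hj
    have hd : ¬ ∃ d₁, R.region (g.u j) (g.i d₁) := fun ⟨d₁, hd⟩ => g.region_u_i hj d₁ hd
    simp only [φ, dif_neg hd]
  have hφv : ∀ j ≤ b, φ (g.v j) = latticePath l k + latticePath bt j := by
    intro j hj
    rw [hreg _ _ (g.region_v j hj), hφi, hF (k + j) (by simp only [List.length_append]; omega),
      latticePath_append_mid hl (by omega)]
  have hout : ∀ j ≤ b, R.out (g.u j) = stripOut A.1 j := fun j hj => g.out_u_eq hA hj
  have hN : height N = height (latticePath l k + latticePath bt j₀) + 1 := by
    simp only [N, height_add]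
    omega
  refine ⟨φ, ⟨hreg, ?_, ?_, ?_, ?_⟩, ?_⟩
  · rw [g.base, hφi, hφ.base]
  · intro d
    rcases g.cover d with ⟨d, rfl⟩ | ⟨j, hj, rfl⟩ | ⟨j, hj, rfl⟩
    · rw [hφi]; exact hφ.nonneg d
    · rw [hφu j hj, hN, ← hφv j₀ hj₀, hreg _ _ (g.region_v j₀ hj₀), hφi]
      have := hφ.nonneg (R₁.pt (k + j₀))
      omega
    · rw [hreg _ _ (g.region_v j hj), hφi]
      exact hφ.nonneg _
  · intro d hd
    rcases g.cover d with ⟨d, rfl⟩ | ⟨j, hj, rfl⟩ | ⟨j, hj, rfl⟩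
    · rw [g.opp_i, hφi, hφi, g.out_i]
      exact hφ.edge d fun he => hd (by rw [he, g.base])
    · rw [g.opp_u j hj, hφu j hj, hφv j hj, hout j hj]
      simp only [N, height_add]
      have := (s4 j hj).1
      exact ⟨by omega, fun he => by rw [this.2 (by omega), add_assoc]⟩
    · rw [g.opp_v j hj, hφu j hj, hφv j hj, g.out_uv j hj, hout j hj]
      simp only [N, height_add]
      have := (s4 j hj).2
      exact ⟨by omega, fun he => by rw [this.2 (by omega), add_assoc]⟩
  · have hold : ∀ d₁, ¬ R₁.region R₁.base d₁ → ∃ d', R.region (g.i d₁) d' ∧ d' ≠ R.base ∧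
        height (φ (R.opp d')) + 1 = height (φ (g.i d₁)) := by
      intro d₁ hd
      obtain ⟨d', h1, h2, h3⟩ := hφ.descend d₁ hd
      refine ⟨g.i d', (g.region_i _ _).2 h1, ?_, ?_⟩
      · rw [g.base]
        exact fun he => h2 (g.i_inj he)
      · rw [g.opp_i, hφi, hφi, h3]
    intro d hd
    rw [g.base] at hd
    rcases g.cover d with ⟨d, rfl⟩ | ⟨j, hj, rfl⟩ | ⟨j, hj, rfl⟩
    · exact hold d fun h' => hd ((g.region_i _ _).2 h')
    · refine ⟨g.u j₀, R.region.trans (g.region_u j hj) (R.region.symm (g.region_u j₀ hj₀)), ?_, ?_⟩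
      · rw [g.base]; exact g.u_ne j₀ hj₀ _
      · rw [g.opp_u j₀ hj₀, hφv j₀ hj₀, hφu j hj, hN]
    · have hv := g.region_v j hj
      obtain ⟨d', h1, h2, h3⟩ := hold (R₁.pt (k + j)) fun h' =>
        hd (R.region.trans ((g.region_i _ _).2 h') (R.region.symm hv))
      exact ⟨d', R.region.trans hv h1, h2, by rw [h3, hreg _ _ hv]⟩
  · intro m hm
    simp only [List.length_append, List.length_cons, List.length_nil] at hm
    rcases Nat.lt_or_ge k m with h1 | h1
    · obtain ⟨j, rfl⟩ : ∃ j, m = k + j := ⟨m - k, by omega⟩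
      obtain rfl | rfl | hj : j = 1 ∨ j = 2 ∨ 3 ≤ j := by omega
      · rw [g.pt_u, hφu 0 (by omega), latticePath_append_mid hl (by simp)]
        simp only [N, latticePath_cons, latticePath_zero, add_zero]
      · rw [g.pt_v, hφv b le_rfl, latticePath_append_mid hl (by simp), ← s3]
        simp only [latticePath_cons, latticePath_zero, add_zero]
      · obtain ⟨i, rfl⟩ : ∃ i, j = 3 + i := ⟨j - 3, by omega⟩
        rw [← add_assoc, g.pt_of_gt (by omega), hφi,
          hF _ (by simp only [List.length_append]; omega)]
        have e1 := latticePath_append_right (t := [A, B]) (r := r) hl (i + 1)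
        have e2 := latticePath_append_right (t := bt) (r := r) hl (i + 1)
        rw [hb] at e2
        have e3 : latticePath [A, B] 2 = stateWeight A + stateWeight B := by
          simp only [latticePath_cons, latticePath_zero, add_zero]
        simp only [List.length_cons, List.length_nil, zero_add, Nat.reduceAdd] at e1
        rw [e3, s3, show k + 2 + (i + 1) = k + 3 + i by omega] at e1
        rw [e1, ← e2]
        congr 1
        omega
    · rw [g.pt_of_le h1, hφi, hF _ (by simp only [List.length_append]; omega),
        latticePath_append_left hl h1, latticePath_append_left hl h1]

open Classical in
/-- An old region gains a side at each edge of the strip that it is adjacent to. -/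
theorem card_class (h₁ : R₁.Good) (d : R₁.Dart) :
    Nat.card {z // R.region (g.i d) z} = Nat.card {z // R₁.region d z} +
      ∑ j ∈ Finset.range (b + 1), if R₁.region d (R₁.pt (k + j)) then 1 else 0 := by
  have := h₁.finite
  have := g.finite
  have := Fintype.ofFinite R.Dart
  have := Fintype.ofFinite R₁.Dart
  have e1 : Nat.card {z // R.region (g.i d) z} =
      ∑ z : R.Dart, if R.region (g.i d) z then 1 else 0 := by
    rw [Finset.sum_boole, Nat.card_eq_fintype_card, Fintype.card_subtype]; rfl
  have e2 : Nat.card {z // R₁.region d z} = ∑ z : R₁.Dart, if R₁.region d z then 1 else 0 := by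
    rw [Finset.sum_boole, Nat.card_eq_fintype_card, Fintype.card_subtype]; rfl
  rw [e1, e2, ← Equiv.sum_comp g.equiv, Fintype.sum_sum_type, Fintype.sum_sum_type,
    Finset.sum_range]
  have e3 : ∀ z, R.region (g.i d) (g.equiv (.inl z)) ↔ R₁.region d z := g.region_i d
  have e4 : ∀ j, ¬ R.region (g.i d) (g.equiv (.inr (.inl j))) := fun j =>
    g.region_i_u (by omega) d
  have e5 : ∀ j : Fin (b + 1), R.region (g.i d) (g.equiv (.inr (.inr j))) ↔
      R₁.region d (R₁.pt (k + j)) := fun j => g.region_i_v (by omega) d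
  simp only [e3, e4, e5, if_false, Finset.sum_const_zero, zero_add]

theorem card_class_u (h₁ : R₁.Good) : Nat.card {z // R.region (g.u 0) z} = b + 1 := by
  classical
  have := h₁.finite
  have := g.finite
  have := Fintype.ofFinite R.Dart
  have := Fintype.ofFinite R₁.Dart
  have e1 : Nat.card {z // R.region (g.u 0) z} =
      ∑ z : R.Dart, if R.region (g.u 0) z then 1 else 0 := by
    rw [Finset.sum_boole, Nat.card_eq_fintype_card, Fintype.card_subtype]; rfl
  rw [e1, ← Equiv.sum_comp g.equiv, Fintype.sum_sum_type, Fintype.sum_sum_type]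
  have e3 : ∀ z, ¬ R.region (g.u 0) (g.equiv (.inl z)) := g.region_ne
  have e4 : ∀ j, R.region (g.u 0) (g.equiv (.inr (.inl j))) := fun j =>
    R.region.symm (g.region_u j (by omega))
  have e5 : ∀ j : Fin (b + 1), ¬ R.region (g.u 0) (g.equiv (.inr (.inr j))) := fun j hj =>
    g.region_ne _ (R.region.trans hj (g.region_v j (by omega)))
  simp only [e3, e4, e5, if_false, if_true, Finset.sum_const_zero, zero_add, add_zero]
  simp

/-- Every region is the new one or an old one. -/
theorem region_cases (d : R.Dart) : R.region d (g.u 0) ∨ ∃ d₁, R.region d (g.i d₁) := by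
  rcases g.cover d with ⟨d, rfl⟩ | ⟨j, hj, rfl⟩ | ⟨j, hj, rfl⟩
  · exact Or.inr ⟨d, R.region.refl _⟩
  · exact Or.inl (g.region_u j hj)
  · exact Or.inr ⟨_, g.region_v j hj⟩

end Glue

/-! ### Attaching a piece: the sides of the regions -/

/-- The state of the letter at a position, `0` outside of the string. -/
def stateAt (x : SignStateString) (m : ℕ) : ℤ := (x[m]?.map fun a => (a.2 : ℤ)).getD 0

open Classical in
/-- The sum over the corners of the region of `d` at the boundary of the disk of the increase
of the state across the corner, minus one. -/
noncomputable def Raw.cornerSum (R : Raw) (x : SignStateString) (d : R.Dart) : ℤ :=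
  ∑ m ∈ Finset.range R.period,
    if R.region d (R.pt m) then stateAt x m - stateAt x (m - 1) - 1 else 0

/-- The invariant that makes growth produce non-elliptic webs.  When a piece is attached by a growth
rule, the corner sum of an old region increases at most by the number of its new sides.  An `H`
closes a region between bottom states that increase, so the region then had at least
four sides. -/
def Raw.Balanced (R : Raw) (x : SignStateString) : Prop :=
  ∀ d, ¬ R.region R.base d → 4 + R.cornerSum x d ≤ Nat.card {z // R.region d z}

theorem Raw.cornerSum_congr {R : Raw} {x : SignStateString} {d d' : R.Dart} (h : R.region d d') :
    R.cornerSum x d = R.cornerSum x d' := by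
  have : ∀ z, R.region d z ↔ R.region d' z := fun z =>
    ⟨R.region.trans (R.region.symm h), R.region.trans h⟩
  unfold Raw.cornerSum
  classical exact Finset.sum_congr rfl fun m _ => if_congr (this _) rfl rfl

theorem Raw.card_region_congr {R : Raw} {d d' : R.Dart} (h : R.region d d') :
    Nat.card {z // R.region d z} = Nat.card {z // R.region d' z} := by
  have : ∀ z, R.region d z ↔ R.region d' z := fun z =>
    ⟨R.region.trans (R.region.symm h), R.region.trans h⟩
  simp only [this]

/-- The orientations alternate along the boundary of an internal region. -/
theorem Raw.Good.even_card {R : Raw} (h : R.Good) {d : R.Dart} (hd : ∀ m, ¬ R.region d (R.pt m)) :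
    Even (Nat.card {z // R.region d z}) := by
  classical
  have := h.finite
  have := Fintype.ofFinite R.Dart
  have hturn : ∀ z, R.region d z → R.region d (R.turn z) ∧ R.out (R.turn z) = !R.out z := by
    intro z hz
    have hinf : ¬ R.next.SameCycle R.base z := fun hs => by
      obtain ⟨j, -, rfl⟩ := R.sameCycle_iff.1 hs
      exact hd j hz
    refine ⟨R.region.trans hz (h.keep z), ?_⟩
    rw [R.turn_apply, h.out_opp, (h.vertex z hinf).2.2]
    intro he
    apply hinf
    rw [← he, Equiv.Perm.sameCycle_apply_right.symm, he]
  have hle : ∀ o : Bool, Finset.card {z | R.region d z ∧ R.out z = o} ≤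
      Finset.card {z | R.region d z ∧ R.out z = !o} := by
    intro o
    refine Finset.card_le_card_of_injOn R.turn ?_ R.turn.injective.injOn
    intro z hz
    simp only [Finset.coe_filter, Finset.mem_univ, true_and, Set.mem_ofPred_eq] at hz ⊢
    exact ⟨(hturn z hz.1).1, by rw [(hturn z hz.1).2, hz.2]⟩
  have h1 := hle true
  have h2 := hle false
  simp only [Bool.not_true, Bool.not_false] at h1 h2
  rw [Nat.card_eq_fintype_card, Fintype.card_subtype,
    ← Finset.card_filter_add_card_filter_not (fun z => R.out z = true), Finset.filter_filter,
    Finset.filter_filter]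
  simp only [Bool.not_eq_true]
  exact ⟨_, congrArg _ (le_antisymm h2 h1)⟩

section StateAt

variable {l t r : SignStateString} {k : ℕ}

theorem stateAt_append_left (hl : l.length = k) {j : ℕ} (hj : j < k) :
    stateAt (l ++ t ++ r) j = stateAt l j := by
  rw [stateAt, getElem?_append_left' hl hj, stateAt]

theorem stateAt_append_mid (hl : l.length = k) {j : ℕ} (hj : j < t.length) :
    stateAt (l ++ t ++ r) (k + j) = stateAt t j := by
  rw [stateAt, getElem?_append_mid hl hj, stateAt]

theorem stateAt_append_right (hl : l.length = k) (j : ℕ) :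
    stateAt (l ++ t ++ r) (k + t.length + j) = stateAt r j := by
  rw [stateAt, getElem?_append_right' hl, stateAt]

end StateAt

/-- How a growth rule changes the increase of the states across the corners next to its strands,
where `e j` says whether the region below the `j`-th edge of the strip is the one considered, `p` is
the state of the letter to the left, and `s` lists the states from `p` through the bottom letters to
the next one. -/
theorem GrowthRule.cornerSum_le {c : Piece} {t bt : SignStateString} (h : GrowthRule c t bt)
    {e : ℕ → ℤ} (he : ∀ j, 0 ≤ e j) {p : ℤ} {s : ℕ → ℤ}
    (hs : ∀ j < bt.length, s (j + 1) = stateAt bt j) (hp : e 0 * s 0 = e 0 * p) :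
    e 0 * (stateAt t 0 - p - 1) + e bt.length * (s (bt.length + 1) - stateAt t 1 - 1) ≤
      ∑ j ∈ Finset.range (bt.length + 1), e j * (s (j + 1) - s j - 1) +
        ∑ j ∈ Finset.range (bt.length + 1), e j := by
  have h0 := he 0
  have h1 := he 1
  have h2 := he 2
  have e1 := hs 0
  have e2 := hs 1
  cases h <;>
    simp [Finset.sum_range_succ, stateAt] at e1 e2 ⊢ <;>
    (try rw [e1]) <;> (try rw [e2]) <;> linarith

/-- The new region of a growth rule satisfies the bound of `Raw.Balanced`. -/
theorem GrowthRule.four_add_le {c : Piece} {t bt : SignStateString} (h : GrowthRule c t bt) :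
    4 + (stateAt t 1 - stateAt t 0 - 1) ≤ bt.length + 1 := by
  cases h <;> simp [stateAt]

/-- The states at the bottom of an `H` that is attached by a growth rule increase. -/
theorem GrowthRule.stateAt_lt {c : Piece} {t bt : SignStateString} (h : GrowthRule c t bt)
    (hb : bt.length = 2) : stateAt bt 0 < stateAt bt 1 := by
  cases h <;> simp [stateAt] at hb ⊢

namespace Glue

variable {b k : ℕ} {R₁ R : Raw} (g : Glue b k R₁ R)

include g

theorem region_i_u_zero (d : R₁.Dart) : ¬ R.region (g.i d) (g.u 0) := g.region_i_u (by omega) d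

/-- Attaching a piece by a growth rule preserves the invariant. -/
theorem balanced (h₁ : R₁.Good) {c : Piece} {l t bt r : SignStateString}
    (hr : GrowthRule c t bt) (hb : bt.length = b) (hl : l.length = k)
    (hS : R₁.HasSigns (l ++ bt ++ r)) (hB : R₁.Balanced (l ++ bt ++ r)) :
    R.Balanced (l ++ t ++ r) := by
  classical
  have ht : t.length = 2 := hr.length_top
  have hper := g.period
  have hlen := hS.1
  simp only [List.length_append] at hlen
  have p1 : R₁.period = k + (b + 1) + r.length := by omega
  have p2 : R.period = k + 3 + r.length := by omega
  have hold : ∀ d, ¬ R.region R.base (g.i d) → 4 + R.cornerSum (l ++ t ++ r) (g.i d) ≤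
      Nat.card {z // R.region (g.i d) z} := by
    intro d hd
    have hd₁ : ¬ R₁.region R₁.base d := fun h' => hd (by rw [g.base]; exact (g.region_i _ _).2 h')
    have hB₁ := hB d hd₁
    rw [g.card_class h₁ d]
    push_cast
    let e : ℕ → ℤ := fun j => if R₁.region d (R₁.pt (k + j)) then 1 else 0
    let s : ℕ → ℤ := fun j => if j = 0 then stateAt (l ++ bt ++ r) (k - 1) else
      stateAt (l ++ bt ++ r) (k + (j - 1))
    have hs : ∀ j < bt.length, s (j + 1) = stateAt bt j := fun j hj => by
      simp only [s, Nat.add_one_ne_zero, if_false, Nat.add_sub_cancel]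
      exact stateAt_append_mid hl hj
    have hp : e 0 * s 0 = e 0 * stateAt (l ++ t ++ r) (k - 1) := by
      rcases Nat.eq_zero_or_pos k with rfl | hk
      ·
        have : e 0 = 0 := if_neg fun h' => hd₁ (R₁.region.symm h')
        rw [this, zero_mul, zero_mul]
      · simp only [s, if_true]
        rw [stateAt_append_left hl (by omega), stateAt_append_left hl (by omega)]
    have key := hr.cornerSum_le (e := e) (fun j => by simp only [e]; split_ifs <;> simp) hs hp
    have e1 : R₁.cornerSum (l ++ bt ++ r) d =
        ∑ m ∈ Finset.range k,
          (if R₁.region d (R₁.pt m) then stateAt l m - stateAt l (m - 1) - 1 else 0)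
        + ∑ j ∈ Finset.range (b + 1), e j * (s (j + 1) - s j - 1)
        + ∑ m ∈ Finset.range r.length, (if R₁.region d (R₁.pt (k + b + 1 + m)) then
            stateAt r (m + 1) - stateAt r m - 1 else 0) := by
      rw [Raw.cornerSum, p1, Finset.sum_range_add, Finset.sum_range_add]
      refine congrArg₂ _ (congrArg₂ _ ?_ ?_) ?_
      · refine Finset.sum_congr rfl fun m hm => ?_
        rw [Finset.mem_range] at hm
        rw [stateAt_append_left hl hm, stateAt_append_left hl (by omega)]
      · refine Finset.sum_congr rfl fun j hj => ?_
        simp only [e, boole_mul]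
        refine if_congr Iff.rfl ?_ rfl
        rcases j with - | j
        · simp [s]
        · simp [s, ← add_assoc]
      · refine Finset.sum_congr rfl fun m hm => ?_
        rw [← add_assoc k b 1]
        refine if_congr Iff.rfl ?_ rfl
        have a1 := stateAt_append_right (t := bt) (r := r) hl (m + 1)
        have a2 := stateAt_append_right (t := bt) (r := r) hl m
        rw [hb] at a1 a2
        rw [show k + b + 1 + m = k + b + (m + 1) by omega, a1,
          show k + b + (m + 1) - 1 = k + b + m by omega, a2]
    have e2 : R.cornerSum (l ++ t ++ r) (g.i d) =
        ∑ m ∈ Finset.range k,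
          (if R₁.region d (R₁.pt m) then stateAt l m - stateAt l (m - 1) - 1 else 0)
        + (e 0 * (stateAt t 0 - stateAt (l ++ t ++ r) (k - 1) - 1) +
          e bt.length * (s (bt.length + 1) - stateAt t 1 - 1))
        + ∑ m ∈ Finset.range r.length, (if R₁.region d (R₁.pt (k + b + 1 + m)) then
            stateAt r (m + 1) - stateAt r m - 1 else 0) := by
      rw [Raw.cornerSum, p2, Finset.sum_range_add, Finset.sum_range_add]
      refine congrArg₂ _ (congrArg₂ _ ?_ ?_) ?_
      · refine Finset.sum_congr rfl fun m hm => ?_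
        rw [Finset.mem_range] at hm
        rw [stateAt_append_left hl hm, stateAt_append_left hl (by omega), g.pt_of_le hm.le]
        exact if_congr (g.region_i _ _) rfl rfl
      · simp only [Finset.sum_range_succ, Finset.sum_range_zero, zero_add, e, boole_mul, add_zero]
        rw [g.pt_of_le le_rfl, g.pt_u, g.pt_v, if_neg (g.region_i_u_zero d), add_zero]
        refine congrArg₂ _ (if_congr (g.region_i _ _) ?_ rfl)
          (if_congr ((g.region_i_v le_rfl d).trans (by rw [hb])) ?_ rfl)
        · have := stateAt_append_mid (t := t) (r := r) hl (j := 0) (by omega)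
          rw [add_zero] at this
          rw [this]
        · have a1 := stateAt_append_right (t := t) (r := r) hl 0
          have a2 := stateAt_append_right (t := bt) (r := r) hl 0
          have a3 := stateAt_append_mid (t := t) (r := r) hl (j := 1) (by omega)
          rw [ht] at a1
          simp only [s, Nat.add_one_ne_zero, if_false, Nat.add_sub_cancel]
          rw [show k + 2 - 1 = k + 1 by omega, a3, ← add_zero (k + 2), a1,
            ← add_zero (k + bt.length), a2]
      · refine Finset.sum_congr rfl fun m hm => ?_
        rw [Finset.mem_range] at hm
        rw [g.pt_of_gt (by omega)]
        refine if_congr (g.region_i _ _) ?_ rfl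
        have a1 := stateAt_append_right (t := t) (r := r) hl (m + 1)
        have a2 := stateAt_append_right (t := t) (r := r) hl m
        rw [ht] at a1 a2
        rw [show k + 3 + m = k + 2 + (m + 1) by omega, a1,
          show k + 2 + (m + 1) - 1 = k + 2 + m by omega, a2]
    rw [hb] at key e2
    have e3 : ∑ j ∈ Finset.range (b + 1), e j =
      ∑ j ∈ Finset.range (b + 1), if R₁.region d (R₁.pt (k + j)) then 1 else 0 := rfl
    rw [← e3]
    linarith
  intro d hd
  rcases g.region_cases d with hu | ⟨d₁, h'⟩
  · rw [Raw.cornerSum_congr hu, Raw.card_region_congr hu, g.card_class_u h₁]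
    have : R.cornerSum (l ++ t ++ r) (g.u 0) = stateAt t 1 - stateAt t 0 - 1 := by
      rw [Raw.cornerSum, Finset.sum_eq_single (k + 1)]
      · rw [g.pt_u, if_pos (R.region.refl _), Nat.add_sub_cancel,
          stateAt_append_mid hl (by omega), ← add_zero k, stateAt_append_mid hl (by omega)]
      · intro m hm hne
        rw [Finset.mem_range] at hm
        refine if_neg fun h' => hne ?_
        rcases lt_trichotomy m (k + 1) with h2 | h2 | h2
        · rw [g.pt_of_le (by omega)] at h'
          exact absurd h' (g.region_ne _)
        · exact h2
        · obtain ⟨i, rfl⟩ : ∃ i, m = k + 2 + i := ⟨m - (k + 2), by omega⟩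
          rcases i with - | i
          · rw [add_zero, g.pt_v] at h'
            exact absurd (R.region.trans h' (g.region_v b le_rfl)) (g.region_ne _)
          · rw [show k + 2 + (i + 1) = k + 3 + i by omega, g.pt_of_gt (by omega)] at h'
            exact absurd h' (g.region_ne _)
      · intro h'
        exact absurd (Finset.mem_range.2 (by omega)) h'
    rw [this, ← hb]
    exact_mod_cast hr.four_add_le
  · rw [Raw.cornerSum_congr h', Raw.card_region_congr h']
    exact hold d₁ fun h2 => hd (R.region.trans h2 (R.region.symm h'))

/-- Attaching a piece by a growth rule preserves non-ellipticity. Only an `H` closes a region; it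
had at least four sides and gets one more, and the number of sides of an internal region is even. -/
theorem nonElliptic (h₁ : R₁.Good) {c : Piece} {l t bt r : SignStateString}
    (hr : GrowthRule c t bt) (hb : bt.length = b) (hl : l.length = k)
    (hB : R₁.Balanced (l ++ bt ++ r)) (hN : R₁.NonElliptic) :
    R.NonElliptic := by
  classical
  have := h₁.finite
  intro d hd
  rcases g.region_cases d with hu | ⟨d₁, h'⟩
  · exact absurd (g.pt_u ▸ hu) (hd (k + 1))
  rw [Raw.card_region_congr h']
  have hd' : ∀ m, ¬ R.region (g.i d₁) (R.pt m) := fun m h2 => hd m (R.region.trans h' h2)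
  have hcard := g.card_class h₁ d₁
  -- a region that becomes internal touched the boundary only between the legs of the strip
  have htouch : ∀ m < R₁.period, R₁.region d₁ (R₁.pt m) → k < m ∧ m < k + b := by
    intro m hm h2
    have h3 := (g.region_i _ _).2 h2
    refine ⟨not_le.1 fun h4 => hd' m (by rw [g.pt_of_le h4]; exact h3), not_le.1 fun h4 => ?_⟩
    rcases h4.eq_or_lt with rfl | h4
    · refine hd' (k + 2) ?_
      rw [g.pt_v]
      exact (g.region_i_v le_rfl _).2 h2
    · refine hd' (m + 2 - b) ?_
      rw [g.pt_of_gt' h4 hm.le]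
      exact h3
  by_cases hint : ∀ m, ¬ R₁.region d₁ (R₁.pt m)
  · have := hN d₁ hint
    omega
  · push Not at hint
    obtain ⟨m, hm⟩ := hint
    obtain ⟨m, hlt, he⟩ := R₁.sameCycle_iff.1 (R₁.sameCycle_pt m)
    rw [← he] at hm
    have hb2 : b ≤ 2 := by rw [← hb, hr.length]; exact hr.legs_le
    obtain ⟨rfl, rfl⟩ : b = 2 ∧ m = k + 1 := by have := htouch m hlt hm; omega
    have h1 : 1 ≤ ∑ j ∈ Finset.range (2 + 1), if R₁.region d₁ (R₁.pt (k + j)) then 1 else 0 := by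
      refine le_trans ?_ (Finset.single_le_sum (fun _ _ => Nat.zero_le _)
        (Finset.mem_range.2 (by omega : 1 < 2 + 1)))
      rw [if_pos hm]
    have h2 := hB d₁ fun h2 => by
      have := htouch 0 R₁.period_pos (R₁.region.symm h2)
      omega
    have h3 : 0 ≤ R₁.cornerSum (l ++ bt ++ r) d₁ := by
      refine Finset.sum_nonneg fun m hm => ?_
      split_ifs with h4
      · obtain rfl : m = k + 1 := by
          have := htouch m (Finset.mem_range.1 hm) h4
          omega
        have a1 := stateAt_append_mid (l := l) (t := bt) (r := r) hl (j := 0) (by omega)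
        rw [add_zero] at a1
        rw [Nat.add_sub_cancel, a1, stateAt_append_mid hl (by omega)]
        have := hr.stateAt_lt hb
        omega
      · exact le_rfl
    obtain ⟨n, hn⟩ := (g.good h₁).even_card hd'
    omega

end Glue

/-! ### Webs produced by the growth algorithm -/

theorem GrowthStepAt.split {c : Piece} {k : ℕ} {x y : SignStateString} (h : GrowthStepAt c k x y) :
    ∃ l A B bt r, GrowthRule c [A, B] bt ∧ l.length = k ∧ x = l ++ [A, B] ++ r ∧
      y = l ++ bt ++ r := by
  obtain ⟨l, r, t, bt, hr, hl, hx, hy⟩ := h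
  obtain ⟨A, B, rfl⟩ := List.length_eq_two.1 hr.length_top
  exact ⟨l, A, B, bt, r, hr, hl, hx, hy⟩

/-- The orientations along a strip agree with the signs in the rule by which it is attached. -/
theorem Glue.out_u_zero_of_rule {b k : ℕ} {R₁ R : Raw} (g : Glue b k R₁ R) (hpos : 0 < b)
    {l bt r : SignStateString} {A B : Bool × SignType} (hr : LocalRule [A, B] bt)
    (hb : bt.length = b) (hl : l.length = k) (hS : R₁.HasSigns (l ++ bt ++ r)) :
    R.out (g.u 0) = !A.1 := by
  have h1 := getElem?_append_mid (l := l) (t := bt) (r := r) hl (j := 0) (by omega)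
  obtain ⟨a, ha⟩ : ∃ a, bt[0]? = some a := ⟨_, List.getElem?_eq_getElem (by omega)⟩
  have h2 := hS.2 _ a (h1.trans ha)
  rw [add_zero] at h2
  rw [g.out_u_zero hpos]
  exact h2.symm.trans (hr.fst_eq ha)

theorem Attach.glue {c : Piece} {k : ℕ} {W₁ W : Web} (h : Attach c k W₁ W)
    {l bt r : SignStateString} {A B : Bool × SignType} (hr : GrowthRule c [A, B] bt)
    (hl : l.length = k) (hS : W₁.raw.HasSigns (l ++ bt ++ r)) :
    ∃ g : Glue c.legs k W₁.raw W.raw, W.out (g.u 0) = !A.1 := by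
  have hb := hr.length
  have hlt : k + c.legs < W₁.raw.period := by
    have := hS.1
    simp only [List.length_append] at this
    omega
  match c, h with
  | .H, h =>
    obtain ⟨g⟩ := AttachH.glue h hlt
    exact ⟨g, g.out_u_zero_of_rule (by omega) (.growth hr) hb hl hS⟩
  | .Y, h =>
    obtain ⟨g⟩ := AttachY.glue h hlt
    exact ⟨g, g.out_u_zero_of_rule (by omega) (.growth hr) hb hl hS⟩
  | .U s, h =>
    obtain ⟨g, hg⟩ := AttachU.glue h hlt
    refine ⟨g, hg.trans ?_⟩
    cases hr
    rfl

theorem Glue.attach {c : Piece} {k : ℕ} {W₁ W : Web} (g : Glue c.legs k W₁.raw W.raw)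
    {bt : SignStateString} {A B : Bool × SignType} (hr : GrowthRule c [A, B] bt)
    (hA : W.out (g.u 0) = !A.1) : Attach c k W₁ W := by
  match c, g, hA with
  | .H, g, _ => exact g.attachH
  | .Y, g, _ => exact g.attachY
  | .U s, g, hA =>
    have h := g.attachU
    have hs : A.1 = s := by cases hr; rfl
    rw [hA, Bool.not_not, hs] at h
    exact h

theorem Raw.eq_base_of_period {R : Raw} (h : R.Good) (hp : R.period = 1) (d : R.Dart) :
    d = R.base := by
  have hnext : R.next R.base = R.base := by
    have := R.pt_period
    rw [hp, ← R.next_pt, R.pt_zero] at this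
    exact this
  have hs := h.conn (Setoid.ker fun d => d = R.base) ?_ ?_ d R.base
  · exact (Setoid.ker_def.1 hs).mpr rfl
  · intro d
    rw [Setoid.ker_def, eq_iff_iff]
    exact ⟨fun h => by rw [h, hnext], fun h => R.next.injective (h.trans hnext.symm)⟩
  · intro d
    rw [Setoid.ker_def, eq_iff_iff]
    exact ⟨fun he => by rw [he, h.opp_base], fun he => R.opp.injective (he.trans h.opp_base.symm)⟩

/-- The signs of `x` are those of the boundary of `W`, and a potential certifies that the minimal
cut paths have the weights given by `x`. -/
structure Web.Reads (W : Web) (x : SignStateString) : Prop where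
  hasSigns : W.raw.HasSigns x
  potential : ∃ φ, W.raw.IsPotential φ ∧ W.raw.Follows φ x

theorem Web.Reads.minCutString {W : Web} {x : SignStateString} (h : W.Reads x) :
    W.MinCutString x := by
  obtain ⟨φ, h1, h2⟩ := h.potential
  exact Web.minCutString_of_potential h1 h2 h.hasSigns

/-- The growth algorithm produces non-elliptic webs, and minimal cut paths recover the string. -/
theorem Grows.sound {x : SignStateString} {W : Web} (h : Grows x W) :
    W.NonElliptic ∧ W.Reads x ∧ W.raw.Balanced x := by
  induction h with
  | empty W h =>
    have hp : W.raw.period = 1 := Raw.period_eq (by omega) (h _) (by omega)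
    refine ⟨fun d hd => ?_, ⟨⟨by simp [hp], by simp⟩, fun _ => 0, ⟨?_, ?_, ?_, ?_, ?_⟩, ?_⟩, ?_⟩
    · exact absurd (by rw [h d, h (W.pt 0)]) (hd 0)
    · exact fun _ _ _ => rfl
    · rfl
    · simp [height]
    · exact fun d hd => absurd (h d) hd
    · exact fun d hd => absurd (by rw [h d]) hd
    · intro m hm
      obtain rfl : m = 0 := by simpa using hm
      rw [latticePath_zero]
    · exact fun d hd => absurd (by rw [h d]) hd
  | step hxy h₁ ha ih =>
    obtain ⟨i1, ⟨i2, φ₁, i3, i4⟩, i5⟩ := ih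
    obtain ⟨l, A, B, bt, r, hr, hl, rfl, rfl⟩ := hxy.split
    obtain ⟨g, hg⟩ := ha.glue hr hl i2
    have hgood := Web.good_of_nonElliptic _ i1
    have hp := g.exists_potential rfl (.growth hr) hr.length hl i3 i4 i2 hg
    exact ⟨g.nonElliptic hgood hr hr.length hl i5 i1, ⟨hp.2, hp.1⟩,
      g.balanced hgood hr hr.length hl i2 i5⟩

theorem Grows.good {x : SignStateString} {W : Web} (h : Grows x W) : W.raw.Good :=
  Web.good_of_nonElliptic W h.sound.1

/-- The web without endpoints and vertices. -/
def emptyWeb : Web where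
  Dart := Unit
  finite := inferInstance
  next := 1
  opp := 1
  base := ()
  out _ := false
  region := ⊤
  opp_opp _ := rfl
  opp_eq_self _ := by simp
  out_opp _ h := absurd rfl h
  out_base := rfl
  vertex _ h := absurd (Equiv.Perm.SameCycle.refl _ _) h
  region_keep_left _ := trivial
  connected := by ext; simp
  euler := by
    have h : ∀ s : Setoid Unit, Nat.card (Quotient s) = 1 := fun s =>
      Nat.card_eq_one_iff_unique.2 ⟨⟨fun a b => by
        induction a using Quotient.ind; induction b using Quotient.ind; rfl⟩, ⟨⟦()⟧⟩⟩
    simp only [h]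

/-- The pieces of any run of the growth algorithm fit together. -/
theorem exists_grows {x : SignStateString} (hx : IsDominant x) : ∃ W, Grows x W := by
  induction hn : growthMeasure x using Nat.strong_induction_on generalizing x with
  | _ n ih =>
    by_cases h0 : x = []
    · exact ⟨emptyWeb, h0 ▸ .empty _ fun _ => rfl⟩
    obtain ⟨y, hy⟩ := exists_growthStep hx h0
    obtain ⟨W₁, h₁⟩ := ih _ (hn ▸ hy.growthMeasure_lt) (hy.isDominant hx) rfl
    obtain ⟨c, k, hxy⟩ := hy
    obtain ⟨l, A, B, bt, r, hr, hl, rfl, rfl⟩ := hxy.split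
    have hS := h₁.sound.2.1.hasSigns
    have hgood := h₁.good
    have hlt : k + c.legs < W₁.raw.period := by
      have := hS.1
      have := hr.length
      simp only [List.length_append] at *
      omega
    have hout : ∀ j < c.legs, stripOut A.1 j = !W₁.raw.out (W₁.raw.pt (k + j + 1)) := by
      intro j hj
      rw [← hr.length] at hj
      have ha := List.getElem?_eq_getElem hj
      rw [← (LocalRule.growth hr).fst_eq ha]
      exact hS.2 _ _ ((getElem?_append_mid hl hj).trans ha)
    have := hgood.finite
    obtain ⟨R, g, hg⟩ := Raw.exists_glue W₁.raw hlt (stripOut A.1)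
      (fun j hj => by rw [hout j hj, Bool.not_not])
      (fun j hj => by rw [stripOut_succ, hout j hj, Bool.not_not])
    exact ⟨(g.good hgood).toWeb, .step hxy h₁ (Glue.attach (W := (g.good hgood).toWeb) g hr hg)⟩

/-! ### Caps of a web with a strip on top -/

namespace Glue

variable {b k : ℕ} {R₁ R : Raw} (g : Glue b k R₁ R)

include g

/-- The new region is a cap. -/
theorem cap (h₁ : R₁.Good) : R.Cap b k := by
  have hper := g.period
  have hlt := g.lt
  refine ⟨by omega, by rw [g.pt_u]; exact g.card_class_u h₁, fun m hm h' => ?_⟩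
  rw [g.pt_u] at h'
  rcases g.pt_cases hm.le with ⟨-, e⟩ | ⟨e, -⟩ | ⟨-, e⟩ | ⟨l, -, -, -, e⟩
  · exact absurd (e ▸ h') (g.region_ne _)
  · exact e
  · exact absurd (R.region.trans (e ▸ h') (g.region_v b le_rfl)) (g.region_ne _)
  · exact absurd (e ▸ h') (g.region_ne _)

/-- The corners at the boundary of an old region after a strip has been attached. -/
theorem exists_of_region_i_pt {d : R₁.Dart} {m : ℕ} (hm : m < R.period)
    (h : R.region (g.i d) (R.pt m)) : ∃ l < R₁.period, R₁.region d (R₁.pt l) ∧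
      (l ≤ k ∧ m = l ∨ k + b ≤ l ∧ m + b = l + 2) := by
  have hper := g.period
  have hlt := g.lt
  rcases g.pt_cases hm.le with ⟨h1, e⟩ | ⟨-, e⟩ | ⟨h1, e⟩ | ⟨l, h1, h2, h3, e⟩ <;> rw [e] at h
  · exact ⟨m, by omega, (g.region_i _ _).1 h, Or.inl ⟨h1, rfl⟩⟩
  · exact absurd h (g.region_i_u_zero d)
  · exact ⟨k + b, hlt, (g.region_i_v le_rfl _).1 h, Or.inr ⟨le_rfl, by omega⟩⟩
  · exact ⟨l, by omega, (g.region_i _ _).1 h, Or.inr ⟨h2.le, h1⟩⟩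

theorem card_cap (h₁ : R₁.Good) {c k' : ℕ} (hc : R₁.Cap c k') :
    Nat.card {z // R.region (g.i (R₁.pt (k' + 1))) z} =
      c + 1 + if k ≤ k' + 1 ∧ k' + 1 ≤ k + b then 1 else 0 := by
  classical
  obtain ⟨-, h2, h3⟩ := hc
  have hlt := g.lt
  rw [g.card_class h₁, h2]
  congr 1
  have h4 : ∀ j ∈ Finset.range (b + 1),
      (if R₁.region (R₁.pt (k' + 1)) (R₁.pt (k + j)) then 1 else 0) =
        if k + j = k' + 1 then 1 else 0 := fun j hj => by
    rw [Finset.mem_range] at hj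
    exact if_congr ⟨h3 _ (by omega), fun h => by rw [h]⟩ rfl rfl
  rw [Finset.sum_congr rfl h4]
  split_ifs with h
  · rw [Finset.sum_eq_single (k' + 1 - k)]
    · exact if_pos (by omega)
    · exact fun j _ hne => if_neg (by omega)
    · exact fun h' => absurd (Finset.mem_range.2 (by omega)) h'
  · refine Finset.sum_eq_zero fun j hj => if_neg ?_
    rw [Finset.mem_range] at hj
    omega

theorem cap_left (h₁ : R₁.Good) {c k' : ℕ} (hc : R₁.Cap c k') (hk : k' + 1 < k) : R.Cap c k' := by
  have hper := g.period
  have hlt := g.lt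
  refine ⟨by omega, ?_, fun m hm h' => ?_⟩ <;> rw [g.pt_of_le hk.le] at *
  · rw [g.card_cap h₁ hc, if_neg (by omega)]
  · obtain ⟨l, h1, h2, h3⟩ := g.exists_of_region_i_pt hm h'
    have := hc.2.2 l h1 h2
    omega

theorem cap_adjacent_left (h₁ : R₁.Good) {c k' : ℕ} (hc : R₁.Cap c k') (hk : k' + 1 = k)
    (hb : 0 < b) : R.Cap (c + 1) k' := by
  have hper := g.period
  have hlt := g.lt
  refine ⟨by omega, ?_, fun m hm h' => ?_⟩ <;> rw [g.pt_of_le hk.le] at *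
  · rw [g.card_cap h₁ hc, if_pos (by omega)]
  · obtain ⟨l, h1, h2, h3⟩ := g.exists_of_region_i_pt hm h'
    have := hc.2.2 l h1 h2
    omega

theorem cap_right (h₁ : R₁.Good) {c k' : ℕ} (hc : R₁.Cap c k') (hk : k + b ≤ k') :
    R.Cap c (k' + 2 - b) := by
  have hper := g.period
  have hlt := hc.1
  have hpt : R.pt (k' + 2 - b + 1) = g.i (R₁.pt (k' + 1)) := by
    rw [← g.pt_of_gt' (by omega) (by omega)]
    congr 1
    omega
  refine ⟨by omega, ?_, fun m hm h' => ?_⟩ <;> rw [hpt] at *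
  · rw [g.card_cap h₁ hc, if_neg (by omega)]
  · obtain ⟨l, h1, h2, h3⟩ := g.exists_of_region_i_pt hm h'
    have := hc.2.2 l h1 h2
    omega

theorem cap_adjacent_right (h₁ : R₁.Good) {c k' : ℕ} (hc : R₁.Cap c k') (hk : k + b = k' + 1)
    (hb : 0 < b) : R.Cap (c + 1) (k + 1) := by
  have hper := g.period
  have hlt := hc.1
  have hv : ∀ z, R.region (R.pt (k + 1 + 1)) z ↔ R.region (g.i (R₁.pt (k' + 1))) z := by
    have h := g.region_v b le_rfl
    rw [hk, ← g.pt_v] at h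
    exact fun z => ⟨R.region.trans (R.region.symm h), R.region.trans h⟩
  refine ⟨by omega, ?_, fun m hm h' => ?_⟩ <;> simp only [hv] at *
  · rw [g.card_cap h₁ hc, if_pos (by omega)]
  · obtain ⟨l, h1, h2, h3⟩ := g.exists_of_region_i_pt hm h'
    have := hc.2.2 l h1 h2
    omega

/-- An `H` that is attached on top of a cap closes its region, which gets one more side. -/
theorem le_of_cap (h₁ : R₁.Good) {c k' : ℕ} (hc : R₁.Cap c k') (hk : k ≤ k') (hk' : k' + 1 < k + b)
    (hR : R.NonElliptic) : 4 ≤ c := by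
  have := hR (g.i (R₁.pt (k' + 1))) ?_
  · rw [g.card_cap h₁ hc, if_pos (by omega)] at this
    omega
  intro m hm
  have := (g.good h₁).finite
  obtain ⟨m, hlt, he⟩ := R.sameCycle_iff.1 (R.sameCycle_pt m)
  rw [← he] at hm
  obtain ⟨l, h1, h2, h3⟩ := g.exists_of_region_i_pt hlt hm
  have := hc.2.2 l h1 h2
  omega

/-- Removing a strip from a non-elliptic web does not create internal regions. -/
theorem nonElliptic_left (h : R.Good) (hR : R.NonElliptic) : R₁.NonElliptic := by
  classical
  have h₁ := g.good_left h
  intro d hd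
  have := hR (g.i d) fun m hm => by
    have := h.finite
    obtain ⟨m, hlt, he⟩ := R.sameCycle_iff.1 (R.sameCycle_pt m)
    rw [← he] at hm
    obtain ⟨l, -, h2, -⟩ := g.exists_of_region_i_pt hlt hm
    exact hd l h2
  rw [g.card_class h₁, Finset.sum_eq_zero fun j _ => if_neg (hd _), add_zero] at this
  exact this

end Glue

/-! ### Confluence -/

/-- If a growth rule applies to the right top strand of a strip and the next strand, then a growth
rule applies to the right bottom strand and the next strand. Either its piece has one leg less, or a
`Y` can be attached next, to the other bottom strand of the strip. -/
theorem LocalRule.exchange_right {A B E : Bool × SignType} {bt z : SignStateString} {c : Piece}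
    (h : LocalRule [A, B] bt) (h' : GrowthRule c [B, E] z) :
    ∃ b₀ D c' z', bt = b₀ ++ [D] ∧ GrowthRule c' [D, E] z' ∧
      (c'.legs + 1 = c.legs ∨
        ∃ C F z₀ z₁, b₀ = [C] ∧ z' = F :: z₀ ∧ GrowthRule .Y [C, F] z₁) := by
  cases h with
  | growth h =>
    cases h <;> cases h' <;> rename_i s <;> cases s <;> first
      | exact ⟨[], _, _, _, rfl, .Y₁ _, .inl rfl⟩
      | exact ⟨[], _, _, _, rfl, .Y₃ _, .inl rfl⟩
      | exact ⟨[], _, _, _, rfl, .U₁ _, .inl rfl⟩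
      | exact ⟨[_], _, _, _, rfl, .Y₁ _, .inl rfl⟩
      | exact ⟨[_], _, _, _, rfl, .Y₃ _, .inl rfl⟩
      | exact ⟨[_], _, _, _, rfl, .U₁ _, .inl rfl⟩
  | pos s =>
    cases h' <;> cases s <;> first
      | exact ⟨[_], _, _, _, rfl, .Y₁ _, .inl rfl⟩
      | exact ⟨[_], _, _, _, rfl, .U₁ _, .inl rfl⟩
      | exact ⟨[_], _, _, _, rfl, .Y₃ _, .inr ⟨_, _, _, _, rfl, rfl, .Y₁ _⟩⟩
      | exact ⟨[_], _, _, _, rfl, .H₁ _, .inr ⟨_, _, _, _, rfl, rfl, .Y₁ _⟩⟩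
  | neg s => cases h'

/-- The mirror image of `LocalRule.exchange_right`. -/
theorem LocalRule.exchange_left {A B E : Bool × SignType} {bt z : SignStateString} {c : Piece}
    (h : LocalRule [A, B] bt) (h' : GrowthRule c [E, A] z) :
    ∃ C b₀ c' z', bt = C :: b₀ ∧ GrowthRule c' [E, C] z' ∧
      (c'.legs + 1 = c.legs ∨
        ∃ D F z₀ z₁, b₀ = [D] ∧ z' = z₀ ++ [F] ∧ GrowthRule .Y [F, D] z₁) := by
  cases h with
  | growth h =>
    cases h <;> cases h' <;> rename_i s <;> cases s <;> first
      | exact ⟨_, _, _, _, rfl, .Y₂ _, .inl rfl⟩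
      | exact ⟨_, _, _, _, rfl, .Y₃ _, .inl rfl⟩
      | exact ⟨_, _, _, _, rfl, .U₁ _, .inl rfl⟩
  | pos s => cases h'
  | neg =>
    cases h' <;> rename_i s <;> cases s <;> first
      | exact ⟨_, _, _, _, rfl, .Y₂ _, .inl rfl⟩
      | exact ⟨_, _, _, _, rfl, .U₁ _, .inl rfl⟩
      | exact ⟨_, _, _, _, rfl, .Y₃ _, .inr ⟨_, _, [], _, rfl, rfl, .Y₂ _⟩⟩
      | exact ⟨_, _, _, _, rfl, .H₃ _, .inr ⟨_, _, [_], _, rfl, rfl, .Y₂ _⟩⟩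

/-- Any string at the bottom of an arc, a `Y`, or an `H` is the bottom of a local rule, unless it
has two letters to which a growth rule applies. In this case an `H` closes a region with too few
sides. -/
theorem exists_localRule (s : Bool) (bt : SignStateString) (hb : bt.length ≤ 2)
    (hs : ∀ j a, bt[j]? = some a → a.1 = stripOut s j) :
    (∃ A B, A.1 = s ∧ LocalRule [A, B] bt) ∨
      ∃ c z, bt.length = 2 ∧ GrowthRule c bt z := by
  match bt, hb, hs with
  | [], _, _ => exact .inl ⟨_, _, rfl, .growth (.U₁ s)⟩
  | [(e, j)], _, hs =>
    obtain rfl : e = !s := hs 0 _ rfl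
    cases j
    · exact .inl ⟨_, _, rfl, .growth (.Y₃ s)⟩
    · exact .inl ⟨_, _, rfl, .growth (.Y₂ s)⟩
    · exact .inl ⟨_, _, rfl, .growth (.Y₁ s)⟩
  | [(e, j), (f, i)], _, hs =>
    obtain rfl : e = !s := hs 0 _ rfl
    obtain rfl : f = s := hs 1 _ rfl
    have h : ∀ {c z}, GrowthRule c [(!f, j), (!!f, i)] z → GrowthRule c [(!f, j), (f, i)] z :=
      fun h => by rwa [Bool.not_not] at h
    cases j <;> cases i
    · exact .inr ⟨_, _, rfl, h (.H₂ _)⟩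
    · exact .inr ⟨_, _, rfl, h (.H₃ _)⟩
    · exact .inl ⟨_, _, rfl, .growth (.H₁ f)⟩
    · exact .inl ⟨_, _, rfl, .growth (.H₃ f)⟩
    · exact .inl ⟨_, _, rfl, .neg f⟩
    · exact .inl ⟨_, _, rfl, .growth (.H₂ f)⟩
    · exact .inr ⟨_, _, rfl, h (.H₁ _)⟩
    · exact .inr ⟨_, _, rfl, h (.U₁ _)⟩
    · exact .inl ⟨_, _, rfl, .pos f⟩

/-- Every growth step applicable to a string that produces `W` can be taken as the first step of a
run that produces `W`. -/
def Web.Confluent (W : Web) : Prop :=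
  ∀ x, Grows x W → ∀ c k y, GrowthStepAt c k x y → ∃ W₁, Attach c k W₁ W ∧ Grows y W₁

theorem Web.Confluent.exists_glue {W : Web} (hW : W.Confluent) {x y : SignStateString}
    (hx : Grows x W) {c : Piece} {k : ℕ} (hxy : GrowthStepAt c k x y) :
    ∃ W₁, Nonempty (Glue c.legs k W₁.raw W.raw) ∧ Grows y W₁ := by
  obtain ⟨W₁, h₁, h₂⟩ := hW x hx c k y hxy
  obtain ⟨l, A, B, bt, r, hr, hl, rfl, rfl⟩ := hxy.split
  exact ⟨W₁, ⟨(h₁.glue hr hl h₂.sound.2.1.hasSigns).choose⟩, h₂⟩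

theorem Web.Confluent.cap {W : Web} (hW : W.Confluent) {x y : SignStateString}
    (hx : Grows x W) {c : Piece} {k : ℕ} (hxy : GrowthStepAt c k x y) : W.raw.Cap c.legs k := by
  obtain ⟨W₁, ⟨g⟩, h₂⟩ := hW.exists_glue hx hxy
  exact g.cap h₂.good

/-- If an arc, a `Y` or an `H` on top of a web that is produced from a string makes a non-elliptic
web, it is an instance of a local rule. -/
theorem Glue.exists_localRule {b k : ℕ} {W₁ W : Web} (g : Glue b k W₁.raw W.raw) (hb : b ≤ 2)
    (hW : W.NonElliptic) (hc : W₁.Confluent) {y : SignStateString} (hy : Grows y W₁) :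
    ∃ l A B bt r, LocalRule [A, B] bt ∧ bt.length = b ∧ l.length = k ∧ y = l ++ bt ++ r ∧
      W.out (g.u 0) = !A.1 := by
  have hS := hy.sound.2.1.hasSigns
  have hlt := g.lt
  have hlen := hS.1
  obtain ⟨l, bt, r, rfl, hl, hbt⟩ : ∃ l bt r, y = l ++ bt ++ r ∧ l.length = k ∧ bt.length = b :=
    ⟨y.take k, (y.drop k).take b, (y.drop k).drop b, by simp, by simp; omega, by simp; omega⟩
  have hs : ∀ j a, bt[j]? = some a → a.1 = stripOut (!W.out (g.u 0)) j := by
    intro j a ha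
    have hj : j < b := hbt ▸ (List.getElem?_eq_some_iff.1 ha).1
    rw [hS.2 _ a ((getElem?_append_mid hl (hbt ▸ hj)).trans ha)]
    have h1 := g.out_v j hj
    have h2 := g.out_uv j hj.le
    have h3 := g.out_u_eq (s := !W.out (g.u 0)) (by rw [Bool.not_not]) hj.le
    rw [← h1, h2, h3, Bool.not_not]
  rcases _root_.exists_localRule _ bt (by omega) hs with ⟨A, B, hA, hr⟩ | ⟨c, z, hz, hr⟩
  · exact ⟨l, A, B, bt, r, hr, hbt, hl, rfl, by rw [hA, Bool.not_not]⟩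
  · have hcap := hc.cap hy (c := c) (k := k) ⟨l, r, bt, z, hr, hl, rfl, rfl⟩
    have := g.le_of_cap hy.good hcap le_rfl (by omega) hW
    have := hr.legs_le
    omega

theorem LocalRule.eq_of_growthRule {c : Piece} {t b b' : SignStateString} (h : LocalRule t b)
    (h' : GrowthRule c t b') : b = b' := by
  cases h with
  | growth h => exact (h.unique h').2
  | pos s => cases s <;> cases h'
  | neg s => cases s <;> cases h'

/-- Let a non-elliptic web have a strip on top that is an instance of a local rule. Wherever a
growth rule applies to its string, the web has a cap with the same number of legs: away from the
strip the cap is one of the web below; next to the strip it is a cap of the web below with one leg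
less, or else there would be an internal region with four sides. -/
theorem Glue.cap_of_growthStepAt {b k : ℕ} {W₁ W : Web} (g : Glue b k W₁.raw W.raw)
    (hW : W.NonElliptic) (hc : W₁.Confluent)
    (hc₂ : ∀ {c' k' W₂ y₂}, Glue c' k' W₂.raw W₁.raw → Grows y₂ W₂ → W₂.Confluent)
    {l bt r : SignStateString} {A B : Bool × SignType} (hr : LocalRule [A, B] bt)
    (hb : bt.length = b) (hl : l.length = k) (hy : Grows (l ++ bt ++ r) W₁)
    {c : Piece} {k' : ℕ} {z : SignStateString} (hz : GrowthStepAt c k' (l ++ [A, B] ++ r) z) :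
    W.raw.Cap c.legs k' := by
  have hg₁ := hy.good
  obtain ⟨l', A', B', z', r', hr', hl', hx, -⟩ := hz.split
  have hlen := congrArg List.length hx
  simp only [List.length_append, List.length_cons, List.length_nil] at hlen
  have hcases : k' + 2 ≤ k ∨ k' + 1 = k ∨ k' = k ∨ k' = k + 1 ∨ k + 2 ≤ k' := by omega
  rcases hcases with hk | hk | hk | hk | hk
  · -- the rule applies to the left of the strip
    obtain ⟨m, rfl⟩ : l' ++ [A', B'] <+: l := by
      refine List.prefix_of_prefix_length_le ⟨r', hx.symm⟩ ⟨[A, B] ++ r, ?_⟩ ?_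
      · rw [List.append_assoc]
      · simp; omega
    refine g.cap_left hg₁ (hc.cap hy ⟨l', m ++ bt ++ r, _, z', hr', hl', ?_, rfl⟩) (by omega)
    simp
  · -- the rule applies to the left top strand of the strip and the strand before it
    obtain ⟨rfl, h2⟩ : l = l' ++ [A'] ∧ [A, B] ++ r = [B'] ++ r' := by
      refine List.append_inj ?_ (by simp; omega)
      simpa using hx
    obtain ⟨rfl, rfl⟩ : A = B' ∧ B :: r = r' := by simpa using h2
    obtain ⟨C, b₀, c', y', rfl, h3, h4⟩ := hr.exchange_left hr'
    have hstep : GrowthStepAt c' k' (l' ++ [A'] ++ C :: b₀ ++ r) (l' ++ y' ++ (b₀ ++ r)) :=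
      ⟨l', b₀ ++ r, _, y', h3, hl', by simp, rfl⟩
    have hpos : 0 < b := by rw [← hb]; simp
    rcases h4 with h4 | ⟨D, F, z₀, z₁, rfl, rfl, h4⟩
    · exact h4 ▸ g.cap_adjacent_left hg₁ (hc.cap hy hstep) hk hpos
    · -- an `H` on top of this piece on top of a `Y` would close a region with four sides
      obtain ⟨W₂, ⟨g₂⟩, hy₂⟩ := hc.exists_glue hy hstep
      have hcap := (hc₂ g₂ hy₂).cap hy₂ (c := .Y) (k := k' + z₀.length)
        ⟨l' ++ z₀, r, _, z₁, h4, by simp [hl'], by simp, rfl⟩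
      have hlegs := h3.length
      simp only [List.length_append, List.length_cons, List.length_nil] at hlegs hb
      have := g.le_of_cap hg₁ (g₂.cap_adjacent_right hy₂.good hcap (by omega) (by omega))
        (by omega) (by omega) hW
      simp [Piece.legs] at this
  · -- the rule applies to the top strands of the strip
    obtain ⟨h2, h3⟩ : l = l' ∧ [A, B] ++ r = [A', B'] ++ r' := by
      refine List.append_inj ?_ (by omega)
      simpa using hx
    obtain ⟨rfl, rfl, -⟩ : A = A' ∧ B = B' ∧ r = r' := by simpa using h3
    rw [hk, ← hr'.length, ← hr.eq_of_growthRule hr', hb]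
    exact g.cap hg₁
  · -- the rule applies to the right top strand of the strip and the strand after it
    obtain ⟨rfl, h2⟩ : l ++ [A] = l' ∧ [B] ++ r = [A', B'] ++ r' := by
      refine List.append_inj ?_ (by simp; omega)
      simpa using hx
    obtain ⟨rfl, rfl⟩ : B = A' ∧ r = B' :: r' := by simpa using h2
    obtain ⟨b₀, D, c', y', rfl, h3, h4⟩ := hr.exchange_right hr'
    have hstep : GrowthStepAt c' (k + b₀.length) (l ++ (b₀ ++ [D]) ++ B' :: r')
        (l ++ b₀ ++ y' ++ r') := ⟨l ++ b₀, r', _, y', h3, by simp [hl], by simp, rfl⟩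
    simp only [List.length_append, List.length_cons, List.length_nil] at hb
    rcases h4 with h4 | ⟨C, F, z₀, z₁, rfl, rfl, h4⟩
    · rw [hk, ← h4]
      exact g.cap_adjacent_right hg₁ (hc.cap hy hstep) (by omega) (by omega)
    · obtain ⟨W₂, ⟨g₂⟩, hy₂⟩ := hc.exists_glue hy hstep
      have hcap := (hc₂ g₂ hy₂).cap hy₂ (c := .Y) (k := k)
        ⟨l, z₀ ++ r', _, z₁, h4, hl, by simp, rfl⟩
      have hlegs := h3.length
      simp only [List.length_cons, List.length_nil] at hlegs hb
      have := g.le_of_cap hg₁ (g₂.cap_adjacent_left hy₂.good hcap (by simp) (by omega))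
        (by omega) (by omega) hW
      simp [Piece.legs] at this
  · -- the rule applies to the right of the strip
    obtain ⟨m, rfl⟩ : l ++ [A, B] <+: l' := by
      refine List.prefix_of_prefix_length_le ⟨r, rfl⟩ ⟨[A', B'] ++ r', ?_⟩ ?_
      · rw [hx, List.append_assoc]
      · simp; omega
    obtain rfl : r = m ++ [A', B'] ++ r' := by simpa using hx
    have := g.cap_right hg₁ (hc.cap hy (k := k + b + m.length)
      ⟨l ++ bt ++ m, r', _, z', hr', by simp [hl, hb, add_assoc], by simp, rfl⟩) (by omega)
    simp only [List.length_append, List.length_cons, List.length_nil] at hl'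
    rwa [show k + b + m.length + 2 - b = k' by omega] at this

theorem Glue.card_lt {b k : ℕ} {R₁ R : Raw} (g : Glue b k R₁ R) (h : R.Good) :
    Nat.card R₁.Dart < Nat.card R.Dart := by
  have := h.finite
  have := g.finite_left
  have := g.card
  omega

/-- Every non-elliptic web is produced by the growth algorithm, and the choices do not matter.  By
induction the web below a cap is produced from a string, which the cap extends to a string `x` that
is read off by minimal cut paths.  Every growth step of `x` belongs to a cap, and
removing this cap instead is the step, because the string that is read off is unique. -/
theorem Web.exists_grows_and_confluent (W : Web) (hW : W.NonElliptic) :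
    (∃ x, Grows x W) ∧ W.Confluent := by
  induction hn : Nat.card W.Dart using Nat.strong_induction_on generalizing W with
  | _ n ih =>
    have hg := good_of_nonElliptic W hW
    have := hg.finite
    by_cases hp : W.raw.period = 1
    · have hempty : Grows [] W := .empty W (Raw.eq_base_of_period hg hp)
      refine ⟨⟨_, hempty⟩, fun x hx c k y hxy => ?_⟩
      obtain ⟨l, A, B, bt, r, -, -, rfl, -⟩ := hxy.split
      have := hx.sound.2.1.hasSigns.1
      simp [hp] at this
    have hp : 1 < W.raw.period := by have := W.raw.period_pos; omega
    -- the web below a cap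
    have hbelow : ∀ {b k}, b ≤ 2 → W.raw.Cap b k → ∃ (W₁ : Web) (g : Glue b k W₁.raw W.raw),
        W₁.Confluent ∧ (∃ l A B bt r, LocalRule [A, B] bt ∧ bt.length = b ∧ l.length = k ∧
          Grows (l ++ bt ++ r) W₁ ∧ W.out (g.u 0) = !A.1 ∧ W.Reads (l ++ [A, B] ++ r)) := by
      intro b k hb hcap
      obtain ⟨R₁, ⟨g⟩⟩ := hg.exists_glue_of_cap hb hcap
      have hg₁ := g.good_left hg
      let W₁ : Web := hg₁.toWeb
      have g : Glue b k W₁.raw W.raw := g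
      have ⟨⟨y, hy⟩, hc⟩ := ih _ (hn ▸ g.card_lt hg) W₁ (g.nonElliptic_left hg hW) rfl
      obtain ⟨l, A, B, bt, r, hr, hbt, hl, rfl, hA⟩ := g.exists_localRule hb hW hc hy
      obtain ⟨h1, φ, h2, h3⟩ := hy.sound.2.1
      have h4 := g.exists_potential rfl hr hbt hl h2 h3 h1 hA
      exact ⟨W₁, g, hc, l, A, B, bt, r, hr, hbt, hl, hy, hA, h4.2, h4.1⟩
    obtain ⟨b, k, hb, hcap⟩ := hg.exists_cap hW hp
    obtain ⟨W₁, g, hc, l, A, B, bt, r, hr, hbt, hl, hy, -, hx⟩ := hbelow hb hcap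
    have hstep : ∀ c k' z, GrowthStepAt c k' (l ++ [A, B] ++ r) z →
        ∃ W₁, Attach c k' W₁ W ∧ Grows z W₁ := by
      intro c k' z hz
      have hcap' := g.cap_of_growthStepAt hW hc (fun {c' k'' W₂ y₂} g₂ hy₂ =>
        (ih _ (hn ▸ (g₂.card_lt hy.good).trans (g.card_lt hg)) W₂ hy₂.sound.1 rfl).2)
        hr hbt hl hy hz
      have hz' := hz
      obtain ⟨l', A', B', z', r', hr', hl', hx', rfl⟩ := hz'.split
      obtain ⟨W₁', g', -, l₂, A₂, B₂, bt₂, r₂, hr₂, hbt₂, hl₂, hy₂, hA₂, hx₂⟩ :=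
        hbelow hr'.legs_le hcap'
      have he := hx₂.minCutString.unique hx.minCutString
      rw [hx', List.append_assoc, List.append_assoc] at he
      obtain ⟨rfl, h2⟩ := List.append_inj he (hl₂.trans hl'.symm)
      obtain ⟨h3, rfl⟩ := List.append_inj h2 rfl
      obtain ⟨rfl, rfl⟩ : A₂ = A' ∧ B₂ = B' := by simpa using h3
      obtain rfl := hr₂.eq_of_growthRule hr'
      exact ⟨W₁', g'.attach hr' hA₂, hy₂⟩
    have hgrows : Grows (l ++ [A, B] ++ r) W := by
      obtain ⟨z, c, k', hz⟩ := exists_growthStep hx.minCutString.isDominant (by simp)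
      obtain ⟨W₁, h1, h2⟩ := hstep c k' z hz
      exact .step hz h2 h1
    refine ⟨⟨_, hgrows⟩, fun x hx' c k y hxy => hstep c k y ?_⟩
    rwa [hx.minCutString.unique hx'.sound.2.1.minCutString]

/-! ### The bijection -/

/-- The web produced by the growth algorithm does not depend on the choices. -/
theorem Grows.iso {x : SignStateString} {W W' : Web} (h : Grows x W) (h' : Grows x W') :
    W.Iso W' := by
  induction h generalizing W' with
  | empty W h =>
    have hp : W'.raw.period = 1 := by simpa using h'.sound.2.1.hasSigns.1.symm
    have hb : ∀ d, d = W'.base := Raw.eq_base_of_period h'.good hp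
    refine ⟨⟨fun _ => W'.base, fun _ => W.base, fun d => (h d).symm, fun d => (hb d).symm⟩,
      fun _ => (hb _).symm, fun _ => (hb _).symm, rfl, fun d => ?_, fun d d' => ?_⟩
    · rw [h d, W.out_base]
      exact W'.out_base
    · rw [h d, h d']
      exact ⟨fun _ => W.region.refl _, fun _ => W'.region.refl _⟩
  | step hxy h₁ ha ih =>
    obtain ⟨W₁', ha', h₁'⟩ := (W'.exists_grows_and_confluent h'.sound.1).2 _ h' _ _ _ hxy
    obtain ⟨l, A, B, bt, r, hr, hl, rfl, rfl⟩ := hxy.split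
    obtain ⟨g, hg⟩ := ha.glue hr hl h₁.sound.2.1.hasSigns
    obtain ⟨g', hg'⟩ := ha'.glue hr hl h₁'.sound.2.1.hasSigns
    exact g.iso g' (ih h₁') (hg'.trans hg.symm)

theorem Attach.of_iso {c : Piece} {k : ℕ} {W₁ W W' : Web} (h : Attach c k W₁ W) (hW : W.Iso W') :
    Attach c k W₁ W' := by
  obtain ⟨f, f1, f2, f3, f4, f5⟩ := hW
  cases c <;> obtain ⟨e, h⟩ := h <;> refine ⟨e.trans f, ?_⟩ <;>
    simpa only [Equiv.trans_apply, ← f1, ← f2, ← f3, f4, f5, f.apply_eq_iff_eq] using h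

theorem Grows.of_iso {x : SignStateString} {W W' : Web} (h : Grows x W) (hW : W.Iso W') :
    Grows x W' := by
  cases h with
  | empty _ h =>
    obtain ⟨f, -, -, f3, -⟩ := hW
    refine .empty W' fun d => ?_
    rw [← f3, ← h (f.symm d), f.apply_symm_apply]
  | step hxy h₁ ha => exact .step hxy h₁ (ha.of_iso hW)

theorem Grows.boundary_eq {x : SignStateString} {W : Web} (h : Grows x W) :
    x.map Prod.fst = W.boundary := Web.boundary_eq h.sound.2.1.hasSigns

theorem Grows.minCutString {x : SignStateString} {W : Web} (h : Grows x W) : W.MinCutString x :=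
  h.sound.2.1.minCutString

/-- The web produced from a dominant string. -/
noncomputable def DominantString.web {S : List Bool} (x : DominantString S) : NonEllipticRep S :=
  ⟨(exists_grows x.2.2).choose, (exists_grows x.2.2).choose_spec.sound.1,
    (exists_grows x.2.2).choose_spec.boundary_eq.symm.trans x.2.1⟩

theorem DominantString.grows_web {S : List Bool} (x : DominantString S) : Grows x.1 x.web.1 :=
  (exists_grows x.2.2).choose_spec

theorem DominantString.mk_web_eq_iff {S : List Bool} (x : DominantString S) (W : NonEllipticRep S) :
    (⟦x.web⟧ : NonEllipticWeb S) = ⟦W⟧ ↔ Grows x.1 W.1 :=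
  Quotient.eq.trans ⟨x.grows_web.of_iso, x.grows_web.iso⟩

theorem DominantString.bijective_web (S : List Bool) :
    Function.Bijective fun x : DominantString S => (⟦x.web⟧ : NonEllipticWeb S) := by
  constructor
  · intro x x' h
    exact Subtype.ext
      (((x.mk_web_eq_iff x'.web).1 h).minCutString.unique x'.grows_web.minCutString)
  · intro q
    induction q using Quotient.ind with
    | _ W =>
      obtain ⟨x, hx⟩ := (W.1.exists_grows_and_confluent W.2.1).1
      exact ⟨⟨x, hx.boundary_eq.trans W.2.2, hx.minCutString.isDominant⟩,
        (DominantString.mk_web_eq_iff _ W).2 hx⟩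

theorem isDominant_of_reflTransGen {x y : SignStateString}
    (h : Relation.ReflTransGen GrowthStep x y) (hx : IsDominant x) : IsDominant y := by
  induction h with
  | refl => exact hx
  | tail _ h ih => exact h.isDominant ih

theorem mainTheorem3 (S : List Bool) :
    (∀ x : DominantString S,
      Acc (fun y z => GrowthStep z y) x.1 ∧
      ∀ y, Relation.ReflTransGen GrowthStep x.1 y → (∀ z, ¬ GrowthStep y z) → y = []) ∧
    ∃ g : DominantString S ≃ NonEllipticWeb S,
      (∀ (x : DominantString S) (W : Web),
        Grows x.1 W ↔ ∃ h : W.NonElliptic ∧ W.boundary = S, g x = ⟦(⟨W, h⟩ : NonEllipticRep S)⟧) ∧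
      (∀ (W : NonEllipticRep S) (x : SignStateString),
        W.1.MinCutString x ↔ (g.symm ⟦W⟧).1 = x) := by
  refine ⟨fun x => ⟨acc_growthStep x.1, fun y hy hterm => ?_⟩,
    Equiv.ofBijective _ (DominantString.bijective_web S), fun x W => ?_, fun W x => ?_⟩
  · by_contra h0
    obtain ⟨z, hz⟩ := exists_growthStep (isDominant_of_reflTransGen hy x.2.2) h0
    exact hterm z hz
  · constructor
    · intro h
      exact ⟨⟨h.sound.1, h.boundary_eq.symm.trans x.2.1⟩, (x.mk_web_eq_iff _).2 h⟩
    · rintro ⟨h, he⟩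
      exact (x.mk_web_eq_iff ⟨W, h⟩).1 he
  · obtain ⟨x', hx'⟩ : ∃ x', x' =
        (Equiv.ofBijective _ (DominantString.bijective_web S)).symm ⟦W⟧ := ⟨_, rfl⟩
    rw [← hx']
    have h := (x'.mk_web_eq_iff W).1 ((Equiv.eq_symm_apply _).1 hx')
    exact ⟨fun hx => h.minCutString.unique hx, fun hx => hx ▸ h.minCutString⟩
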